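/- **Theorem 5.1 (Hamiltonian evolution).** Let $r_\infty\ge 3$, $g=r_\infty-3$, $\hbar\in\mathbb C\setminus\{0\}$. Let $U\subset\mathbb C^{2r_\infty-2}$ be an open set of irregular times $\mathbf t=(t_{\infty,k})_{1\le k\le 2r_\infty-2}$ and let $\tilde L(\lambda,\mathbf t)$, $\mathbf t\in U$, be a family of $2\times2$ matrices, polynomial in $\lambda$ of degree at most $r_\infty-2$, such that for every $\mathbf t\in U$: * (normalization) $\tilde L(\lambda,\mathbf t)=\begin{pmatrix}-\frac12t_{\infty,2r_\infty-2}&0\\ \frac14t_{\infty,2r_\infty-3}^2&-\frac12t_{\infty,2r_\infty-2}\end{pmatrix}\lambda^{r_\infty-2}+\begin{pmatrix}-\frac12t_{\infty,2r_\infty-4}&1\\ \delta&-\frac12t_{\infty,2r_\infty-4}\end{pmatrix}\lambda^{r_\infty-3}+O(\lambda^{r_\infty-4})$ for some $\delta\in\mathbb C$, with $t_{\infty,2r_\infty-3}\neq0$ (twisted case); * (irregular type $\mathbf t$) with $z=\lambda^{1/2}$, there is an invertible formal gauge matrix $G_\infty(z)=G_{\infty,-1}z+G_{\infty,0}+\sum_{k\ge1}G_{\infty,k}z^{-k}$,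 $G_{\infty,-1}$ of rank $1$, that takes $\hbar\partial_\lambda\tilde\Psi=\tilde L\tilde\Psi$ to the system with fundamental solution $\operatorname{diag}\big(e^{-\frac1\hbar\sum_k\frac{t_{\infty,k}}kz^k+\frac12\ln z},\,e^{-\frac1\hbar\sum_k(-1)^k\frac{t_{\infty,k}}kz^k+\frac12\ln z}\big)$; * (isomonodromy) there is an invertible wave matrix $\tilde\Psi(\lambda,\mathbf t)$, holomorphic on $\mathbb C\times U$, with $\hbar\partial_\lambda\tilde\Psi=\tilde L\tilde\Psi$ and $\hbar\partial_{t_{\infty,k}}\tilde\Psi=\tilde A_k\tilde\Psi$, where each $\tilde A_k$ is polynomial in $\lambda$. Let $q_1,\dots,q_g$ be continuous branches on $U$ of the zeros of $\tilde L_{1,2}$, assumed pairwise distinct, and $p_j=\tilde L_{1,1}(q_j)$. For $\boldsymbol\alpha\in\mathbb C^{2r_\infty-2}$ put $\mathcal L_{\boldsymbol\alpha}=\hbar\sum_k\alpha_{\infty,k}\partial_{t_{\infty,k}}$. Define (times and entries of $\boldsymbol\alpha$ with an index outside $1,\dots,2r_\infty-2$ being $0$): * $\tilde P_1(\lambda)=-\sum_{j=0}^{r_\infty-2}t_{\infty,2j+2}\lambda^j$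 and $\tilde P_2(\lambda)=\sum_{k=r_\infty-3}^{2r_\infty-4}\Big(\frac14\sum_{j}(-1)^jt_{\infty,j}t_{\infty,2k-j+4}\Big)\lambda^k+\frac\hbar2t_{\infty,2r_\infty-2}\lambda^{r_\infty-3}$; * $M_\infty$, the lower triangular Toeplitz matrix of size $r_\infty-1$ with first column $(t_{\infty,2r_\infty-3},t_{\infty,2r_\infty-5},\dots,t_{\infty,1})$; the solution $\nu=(\nu_{-1},\dots,\nu_{r_\infty-3})$ of $M_\infty\nu=\big(\frac{2\alpha_{\infty,2r_\infty-3}}{2r_\infty-3},\frac{2\alpha_{\infty,2r_\infty-5}}{2r_\infty-5},\dots,\frac{2\alpha_{\infty,1}}1\big)$; the solution $(c_{r_\infty-1},\dots,c_1)$ of the system with matrix $M_\infty$ whose right-hand side in the row of $c_k$ is $\sum_{m=k}^{r_\infty-1}\Big(\frac{\alpha_{\infty,2k+2r_\infty-2m-3}}{2k+2r_\infty-2m-3}t_{\infty,2m}-\frac{\alpha_{\infty,2k+2r_\infty-2m-2}}{2k+2r_\infty-2m-2}t_{\infty,2m-1}\Big)$; * for $\mathbf q$ with pairwise distinct entries and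 $\mathbf p\in\mathbb C^g$, the solutions $\mu_j$ of $\sum_{j=1}^gq_j^k\mu_j=\nu_{k+1}$ $(0\le k\le r_\infty-4)$ and $H_{\infty,k}$ of $\sum_{k=0}^{r_\infty-4}H_{\infty,k}q_j^k=p_j^2-\tilde P_1(q_j)p_j+\tilde P_2(q_j)+\hbar\sum_{i\ne j}\frac{p_i-p_j}{q_j-q_i}$ $(1\le j\le g)$; * $\mathrm{Ham}^{(\boldsymbol\alpha)}(\mathbf q,\mathbf p)=\sum_{k=0}^{r_\infty-4}\nu_{k+1}H_{\infty,k}-\hbar\sum_{j=1}^g\sum_{k=1}^{r_\infty-1}c_kq_j^k-\hbar\nu_0\sum_{j=1}^gp_j-\hbar\nu_{-1}\sum_{j=1}^gq_jp_j$. Then, for all $\mathbf t\in U$ and all $\boldsymbol\alpha$: 1. Let $\Psi=\begin{pmatrix}1&0\\ \tilde L_{1,1}&\tilde L_{1,2}\end{pmatrix}\tilde\Psi$, $L=\hbar(\partial_\lambda\Psi)\Psi^{-1}$ and $A_{\boldsymbol\alpha}=\mathcal L_{\boldsymbol\alpha}[\Psi]\Psi^{-1}$. For $\lambda\notin\{q_1,\dots,q_g\}$,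 the first row of $L$ is $(0,1)$, $L_{2,1}=-\tilde P_2(\lambda)+\sum_kH_{\infty,k}\lambda^k-\sum_j\frac{\hbar p_j}{\lambda-q_j}$, $L_{2,2}=\tilde P_1(\lambda)+\sum_j\frac\hbar{\lambda-q_j}$, $[A_{\boldsymbol\alpha}]_{1,2}=\nu_{-1}\lambda+\nu_0+\sum_j\frac{\mu_j}{\lambda-q_j}$, and $[A_{\boldsymbol\alpha}]_{1,1}=c_0+\sum_{k=1}^{r_\infty-1}c_k\lambda^k-\sum_j\frac{\mu_jp_j}{\lambda-q_j}$ with $c_0$ independent of $\lambda$. 2. The $q_j$, $p_j$ are differentiable and, for $1\le j\le g$, $$\mathcal L_{\boldsymbol\alpha}[q_j]=2\mu_j\Big(p_j-\tfrac12\tilde P_1(q_j)\Big)-\hbar\nu_0-\hbar\nu_{-1}q_j-\hbar\sum_{i\ne j}\frac{\mu_j+\mu_i}{q_j-q_i},$$ $$\mathcal L_{\boldsymbol\alpha}[p_j]=\hbar\sum_{i\ne j}\frac{(\mu_i+\mu_j)(p_i-p_j)}{(q_j-q_i)^2}+\mu_j\Big(p_j\tilde P_1'(q_j)-\tilde P_2'(q_j)+\sum_{k=1}^{r_\infty-4}kH_{\infty,k}q_j^{k-1}\Big)+\hbar\nu_{-1}p_j+\hbar\sum_{k=1}^{r_\infty-1}kc_kq_j^{k-1}.$$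 3. These evolutions are Hamiltonian: $\mathcal L_{\boldsymbol\alpha}[q_j]=\partial\mathrm{Ham}^{(\boldsymbol\alpha)}/\partial p_j$ and $\mathcal L_{\boldsymbol\alpha}[p_j]=-\partial\mathrm{Ham}^{(\boldsymbol\alpha)}/\partial q_j$ at $(\mathbf q(\mathbf t),\mathbf p(\mathbf t))$; moreover the right-hand sides in 2 equal $\partial\mathrm{Ham}^{(\boldsymbol\alpha)}/\partial p_j$ and $-\partial\mathrm{Ham}^{(\boldsymbol\alpha)}/\partial q_j$ at every $(\mathbf q,\mathbf p)\in\mathbb C^g\times\mathbb C^g$ with pairwise distinct $q_i$. -/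

import Mathlib

open Polynomial

noncomputable section

namespace TwistedPainleve

/-! The order of the pole at infinity is `r = g + 3`, where `g` is the number of apparent
singularities, so `2r - 2 = 2g + 4` and `2r - 3 = 2g + 3`. -/

/-- The space of irregular times `(t₁, …, t_{2g+4})`; it is also the space of deformation
vectors `α`. -/
abbrev Times (g : ℕ) : Type := Fin (2 * g + 4) → ℂ

/-- `coord t k` is the entry `t_k`, with the indexing `1 ≤ k ≤ 2g+4` (and `0` for any other `k`). -/
def coord {g : ℕ} (t : Times g) (k : ℕ) : ℂ :=
  if h : 1 ≤ k ∧ k ≤ 2 * g + 4 then t ⟨k - 1, by omega⟩ else 0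

/-- The deformation operator `𝓛_α = ħ ∑_k α_k ∂_{t_k}`. -/
def deform {g : ℕ} (hbar : ℂ) (α : Times g) (f : Times g → ℂ) (t : Times g) : ℂ :=
  hbar * ∑ k, α k * fderiv ℂ f t (Pi.single k 1)

/-! ### Connections with given irregular type, normalized at infinity -/

/-- Polynomials in `λ` as formal Laurent series in `w = 1/z = λ^{-1/2}`: `λ ↦ w^{-2}`. -/
def toSeries : ℂ[X] →ₐ[ℂ] LaurentSeries ℂ :=
  Polynomial.aeval (HahnSeries.single (-2 : ℤ) (1 : ℂ))

/-- The derivation `∂_λ = -(1/2) w³ d/dw` of formal Laurent series in `w = λ^{-1/2}`. -/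
def dLambda (f : LaurentSeries ℂ) : LaurentSeries ℂ :=
  HahnSeries.single (3 : ℤ) (-1 / 2 : ℂ) * LaurentSeries.derivative ℂ f

/-- The series `-(1/2) ∑_{k=1}^{2g+4} ε^k t_k z^{k-2} + ħ/(4 z²)`, which is `ħ ∂_λ` of
`-(1/ħ) ∑_k ε^k (t_k / k) z^k + (1/2) ln z`, where `z = λ^{1/2}`. -/
def irregularPart {g : ℕ} (hbar : ℂ) (t : Times g) (ε : ℂ) : LaurentSeries ℂ :=
  (∑ k ∈ Finset.Icc 1 (2 * g + 4),
    HahnSeries.single (2 - (k : ℤ)) (-(1 / 2) * ε ^ k * coord t k)) +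
  HahnSeries.single (2 : ℤ) (hbar / 4)

/-- `L(λ)` has irregular type `t` at infinity: some formal gauge matrix
`G(z) = G_{-1} z + G_0 + G_1 z⁻¹ + …` with `G_{-1}` of rank one takes the connection
`ħ ∂_λ Ψ = L Ψ` to Turrittin-Levelt form, that is, `G Ψ` is the diagonal matrix with entries
`exp (-(1/ħ) ∑_k (±1)^k (t_k / k) z^k + (1/2) ln z)`; equivalently
`G L G⁻¹ + ħ (∂_λ G) G⁻¹` is the diagonal matrix of the logarithmic derivatives of these entries.
(The invertible factor in `GL₂(ℂ[[z⁻¹]])` which may stand to the left of the diagonal matrix is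
absorbed in `G`; this changes neither the pole order of `G` nor the rank of `G_{-1}`.) -/
def HasIrregularType {g : ℕ} (hbar : ℂ) (L : Matrix (Fin 2) (Fin 2) ℂ[X]) (t : Times g) : Prop :=
  ∃ G : Matrix (Fin 2) (Fin 2) (LaurentSeries ℂ),
    (∀ i j, ∀ n : ℤ, n < -1 → (G i j).coeff n = 0) ∧
    (Matrix.of fun i j => (G i j).coeff (-1)).rank = 1 ∧
    G.det ≠ 0 ∧
    G * L.map toSeries + hbar • G.map dLambda =
      Matrix.diagonal ![irregularPart hbar t 1, irregularPart hbar t (-1)] * G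

/-- `L(λ)` is the representative, normalized at infinity, of a twisted connection of irregular
type `t`: it is polynomial of degree at most `g + 1 = r - 2` with the prescribed two leading
coefficients, and the leading one is not diagonalizable (`t_{2g+3} ≠ 0`). -/
structure IsNormalized {g : ℕ} (hbar : ℂ) (t : Times g) (L : Matrix (Fin 2) (Fin 2) ℂ[X]) :
    Prop where
  natDegree_le : ∀ i j, (L i j).natDegree ≤ g + 1
  leading : (Matrix.of fun i j => (L i j).coeff (g + 1)) =
    !![-(1 / 2) * coord t (2 * g + 4), 0;
       1 / 4 * coord t (2 * g + 3) ^ 2, -(1 / 2) * coord t (2 * g + 4)]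
  subleading : ∃ δ : ℂ, (Matrix.of fun i j => (L i j).coeff g) =
    !![-(1 / 2) * coord t (2 * g + 2), 1; δ, -(1 / 2) * coord t (2 * g + 2)]
  twisted : coord t (2 * g + 3) ≠ 0
  irregularType : HasIrregularType hbar L t

/-- The value of a polynomial matrix. -/
def evalMat (L : Matrix (Fin 2) (Fin 2) ℂ[X]) (x : ℂ) : Matrix (Fin 2) (Fin 2) ℂ :=
  L.map (Polynomial.eval x)

/-- `L` is an isomonodromic family over the open set `U` of irregular times: `L(·, t)` is normalized
of irregular type `t`, and `Ψ(λ, t)` is an invertible holomorphic wave matrix with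
`ħ ∂_λ Ψ = L Ψ` and `ħ ∂_{t_k} Ψ = A_k Ψ` where each `A_k` is polynomial in `λ`. -/
structure IsIsomonodromic {g : ℕ} (hbar : ℂ) (U : Set (Times g))
    (L : Times g → Matrix (Fin 2) (Fin 2) ℂ[X])
    (Psi : ℂ → Times g → Matrix (Fin 2) (Fin 2) ℂ) : Prop where
  normalized : ∀ t ∈ U, IsNormalized hbar t (L t)
  analytic : ∀ i j, AnalyticOnNhd ℂ (fun x : ℂ × Times g => Psi x.1 x.2 i j) (Set.univ ×ˢ U)
  det_ne_zero : ∀ x, ∀ t ∈ U, (Psi x t).det ≠ 0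
  spectral : ∀ x, ∀ t ∈ U, ∀ i j,
    hbar * deriv (fun y => Psi y t i j) x = (evalMat (L t) x * Psi x t) i j
  deformation : ∀ t ∈ U, ∀ k, ∃ A : Matrix (Fin 2) (Fin 2) ℂ[X], ∀ x i j,
    hbar * fderiv ℂ (fun s => Psi x s i j) t (Pi.single k 1) = (evalMat A x * Psi x t) i j

/-- The spectral Darboux coordinates on `U`: `q₁, …, q_g` are continuous branches of the zeros of
`L₁₂`, pairwise distinct, and `p_j` is the value of `L₁₁` at `q_j`. -/
structure IsDarboux {g : ℕ} (U : Set (Times g)) (L : Times g → Matrix (Fin 2) (Fin 2) ℂ[X])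
    (q p : Times g → Fin g → ℂ) : Prop where
  continuousOn : ContinuousOn q U
  injective : ∀ t ∈ U, Function.Injective (q t)
  zero : ∀ t ∈ U, ∀ j, (L t 0 1).eval (q t j) = 0
  value : ∀ t ∈ U, ∀ j, p t j = (L t 0 0).eval (q t j)

/-! ### The companion gauge -/

/-- The companion wave matrix `G Ψ` with `G = (1, 0; L₁₁, L₁₂)`, that is
`(ψ₁, ψ₂; ħ∂_λψ₁, ħ∂_λψ₂)`. -/
def companionWave {g : ℕ} (L : Times g → Matrix (Fin 2) (Fin 2) ℂ[X])
    (Psi : ℂ → Times g → Matrix (Fin 2) (Fin 2) ℂ) (x : ℂ) (t : Times g) :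
    Matrix (Fin 2) (Fin 2) ℂ :=
  !![1, 0; (L t 0 0).eval x, (L t 0 1).eval x] * Psi x t

/-- The companion Lax matrix `(ħ ∂_λ Ψ) Ψ⁻¹`, with `Ψ` the companion wave matrix. -/
def companionLax {g : ℕ} (hbar : ℂ) (L : Times g → Matrix (Fin 2) (Fin 2) ℂ[X])
    (Psi : ℂ → Times g → Matrix (Fin 2) (Fin 2) ℂ) (x : ℂ) (t : Times g) :
    Matrix (Fin 2) (Fin 2) ℂ :=
  (Matrix.of fun i j => hbar * deriv (fun y => companionWave L Psi y t i j) x) *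
    (companionWave L Psi x t)⁻¹

/-- The auxiliary matrix `A_α = 𝓛_α[Ψ] Ψ⁻¹`, with `Ψ` the companion wave matrix. -/
def auxMatrix {g : ℕ} (hbar : ℂ) (α : Times g) (L : Times g → Matrix (Fin 2) (Fin 2) ℂ[X])
    (Psi : ℂ → Times g → Matrix (Fin 2) (Fin 2) ℂ) (x : ℂ) (t : Times g) :
    Matrix (Fin 2) (Fin 2) ℂ :=
  (Matrix.of fun i j => deform hbar α (fun s => companionWave L Psi x s i j) t) *
    (companionWave L Psi x t)⁻¹

/-! ### The explicit coefficients -/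

/-- `P₁(λ) = -∑_{j=0}^{g+1} t_{2j+2} λ^j`. -/
def P1 {g : ℕ} (t : Times g) : ℂ[X] :=
  -∑ j ∈ Finset.range (g + 2), C (coord t (2 * j + 2)) * X ^ j

/-- The coefficient `(1/4) ∑_j (-1)^j t_j t_{2k+4-j}`, for `g ≤ k ≤ 2g+2`. The sum runs over the `j`
for which both indices lie in `1, …, 2g+4` (terms with an index outside that range vanish). -/
def P2Coeff {g : ℕ} (t : Times g) (k : ℕ) : ℂ :=
  1 / 4 * ∑ j ∈ Finset.Icc (2 * k - 2 * g) (2 * g + 4),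
    (-1) ^ j * coord t j * coord t (2 * k + 4 - j)

/-- `P₂(λ) = ∑_{k=g}^{2g+2} P₂ₖ λ^k + (ħ/2) t_{2g+4} λ^g`. The last term is the contribution of
order `ħ` to the coefficient of `λ^g` in the lower left entry of the companion Lax matrix. -/
def P2 {g : ℕ} (hbar : ℂ) (t : Times g) : ℂ[X] :=
  (∑ k ∈ Finset.Icc g (2 * g + 2), C (P2Coeff t k) * X ^ k) +
    C (hbar / 2 * coord t (2 * g + 4)) * X ^ g

/-- The lower triangular Toeplitz matrix `M_∞` of size `g + 2 = r - 1`, with `t_{2g+3}` on the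
diagonal, `t_{2g+1}` just below it, and so on down to `t₁`. -/
def toeplitz {g : ℕ} (t : Times g) : Matrix (Fin (g + 2)) (Fin (g + 2)) ℂ :=
  Matrix.of fun i j => if j ≤ i then coord t (2 * g + 3 - 2 * ((i : ℕ) - j)) else 0

/-- The column `(ν_{-1}, ν_0, …, ν_g)`, so entry `i` is `ν_{i-1}`: the solution of the system
with matrix `M_∞` and right hand side `2 α_{2g+3-2i} / (2g+3-2i)`, `i = 0, …, g+1`. -/
def nu {g : ℕ} (t α : Times g) : Fin (g + 2) → ℂ :=
  (toeplitz t)⁻¹.mulVec fun i =>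
    2 * coord α (2 * g + 3 - 2 * (i : ℕ)) / ((2 * g + 3 - 2 * (i : ℕ) : ℕ) : ℂ)

/-- The right hand side, in the row of `c_k`, of the system for the `c`'s:
`∑_{m=k}^{g+2} (α_{2k+2g+3-2m} t_{2m} / (2k+2g+3-2m) - α_{2k+2g+4-2m} t_{2m-1} / (2k+2g+4-2m))`. -/
def cRhs {g : ℕ} (t α : Times g) (k : ℕ) : ℂ :=
  ∑ m ∈ Finset.Icc k (g + 2),
    (coord α (2 * k + 2 * g + 3 - 2 * m) / ((2 * k + 2 * g + 3 - 2 * m : ℕ) : ℂ)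
        * coord t (2 * m) -
      coord α (2 * k + 2 * g + 4 - 2 * m) / ((2 * k + 2 * g + 4 - 2 * m : ℕ) : ℂ)
        * coord t (2 * m - 1))

/-- Entry `i` is `c_{i+1}`, `i = 0, …, g+1`, where the column `(c_{g+2}, …, c_1)` solves the system
with matrix `M_∞` and right hand side `cRhs`. -/
def cCoeff {g : ℕ} (t α : Times g) (i : Fin (g + 2)) : ℂ :=
  (toeplitz t)⁻¹.mulVec (fun l => cRhs t α (g + 2 - (l : ℕ))) (Fin.rev i)

/-- The column `(μ_1, …, μ_g)`, solution of `V_∞ μ = (ν_1, …, ν_g)` where `V_∞` has entries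
`q_j ^ k`, row index `k = 0, …, g-1`. -/
def mu {g : ℕ} (t α : Times g) (q : Fin g → ℂ) : Fin g → ℂ :=
  ((Matrix.vandermonde q).transpose)⁻¹.mulVec fun k => nu t α k.succ.succ

/-- The column `(H_0, …, H_{g-1})`, solution of `∑_k H_k q_j^k =
p_j² - P₁(q_j) p_j + P₂(q_j) + ħ ∑_{i ≠ j} (p_i - p_j) / (q_j - q_i)`. -/
def H {g : ℕ} (hbar : ℂ) (t : Times g) (q p : Fin g → ℂ) : Fin g → ℂ :=
  (Matrix.vandermonde q)⁻¹.mulVec fun j =>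
    p j ^ 2 - (P1 t).eval (q j) * p j + (P2 hbar t).eval (q j) +
      hbar * ∑ i ∈ Finset.univ.erase j, (p i - p j) / (q j - q i)

/-- The Hamiltonian `∑_k ν_{k+1} H_k - ħ ∑_j ∑_k c_k q_j^k - ħ ν_0 ∑_j p_j - ħ ν_{-1} ∑_j q_j p_j`. -/
def Ham {g : ℕ} (hbar : ℂ) (t α : Times g) (q p : Fin g → ℂ) : ℂ :=
  ∑ k : Fin g, nu t α k.succ.succ * H hbar t q p k -
    hbar * ∑ j, ∑ i : Fin (g + 2), cCoeff t α i * q j ^ ((i : ℕ) + 1) -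
    hbar * nu t α 1 * ∑ j, p j -
    hbar * nu t α 0 * ∑ j, q j * p j

/-- The explicit evolution of `q_j`. -/
def qField {g : ℕ} (hbar : ℂ) (t α : Times g) (q p : Fin g → ℂ) (j : Fin g) : ℂ :=
  2 * mu t α q j * (p j - 1 / 2 * (P1 t).eval (q j)) - hbar * nu t α 1 - hbar * nu t α 0 * q j -
    hbar * ∑ i ∈ Finset.univ.erase j, (mu t α q j + mu t α q i) / (q j - q i)

/-- The explicit evolution of `p_j`. -/
def pField {g : ℕ} (hbar : ℂ) (t α : Times g) (q p : Fin g → ℂ) (j : Fin g) : ℂ :=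
  hbar * ∑ i ∈ Finset.univ.erase j,
      (mu t α q i + mu t α q j) * (p i - p j) / (q j - q i) ^ 2 +
    mu t α q j * (p j * (derivative (P1 t)).eval (q j) - (derivative (P2 hbar t)).eval (q j) +
      ∑ k : Fin g, (k : ℕ) * H hbar t q p k * q j ^ ((k : ℕ) - 1)) +
    hbar * nu t α 0 * p j +
    hbar * ∑ i : Fin (g + 2), ((i : ℕ) + 1) * cCoeff t α i * q j ^ (i : ℕ)

end TwistedPainleve

end

/-!
All the coefficients in the theorem come from formal solutions at infinity, expanded in
`w = λ^{-1/2}`. A row of the gauge matrix provides a formal solution of `ħ ∂_λ Ψ = L Ψ`; the ratio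
`ξ = Ψ₂₁ / Ψ₁₁` of its entries solves a Riccati equation, and `y = L₁₁ + L₁₂ ξ`, the logarithmic
derivative `ħ ∂_λ` of its first entry, equals the irregular part `slope t (±1)` up to `O(w²)`
(`IsFormalSlope`, `HasIrregularType.exists_isFormalSlope`). The two rows give `y₁` and `y₂`.

*The companion Lax matrix.* The trace `L₁₁ + L₂₂` is a polynomial which agrees with
`slope t 1 + slope t (-1)` up to `O(w²)`, hence is `P₁`. Eliminating `ξ` from the Riccati equation
shows that `y₁` and `y₂` solve one quadratic differential equation (`IsFormalSlope.quadratic`) in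
which the polynomial `companionNumerator` stands for the lower left entry of the companion Lax
matrix. Comparing the equations of `y₁` and `y₂` determines its coefficients of order at least
`λ^g`, which are those of `P₂` (`vanishesBelow_sub_P2`). The remaining `g` coefficients are found by
evaluation at the apparent singularities `q_j`; this is the Vandermonde system which defines `H`
(`IsNormalized.sum_H`).

*The deformation matrix.* Equality of the mixed derivatives of the wave matrix is the zero curvature
equation `𝓛_α L = ħ ∂_λ A + [A, L]` (`IsIsomonodromic.zeroCurvature`). By that equation, and the
Riccati equation for `ξ`, the series `ħ ∂_λ (A₁₁ + A₁₂ ξ)` solves the linearization of the quadratic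
equation of `y`. Up to an error of known order, `slope (ħ α) (±1)` solves it as well, because the
principal part `slope t (±1)` depends linearly on `t`. The linearized operator raises orders by an
exact amount, as `t_{2g+3} ≠ 0`, so that the polar part of `A₁₁ + A₁₂ ξ` is that of the deformed
exponent `-∑_k (±1)^k (α_k / k) z^k` (`IsFormalSlope.coeff_deformation`). This argument never
differentiates formal gauge matrices with respect to `t`. The difference of the two series
`A₁₁ + A₁₂ ξ` is `(A₁₂ / L₁₂) (y₁ - y₂)`, and a similar cross combination gives
`A₁₁ - L₁₁ A₁₂ / L₁₂`. As `y₁ - y₂` only has odd powers of `w` in its principal part, multiplication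
by it is the Toeplitz matrix `M_∞` on leading coefficients, whence the systems for `ν` and `c`
(`HasDeformedExponents.upper_right`, `HasDeformedExponents.upper_left`); expanding the simple poles
at `q_j` in `1 / λ` gives the system for `μ`.

*The evolution.* The coefficients of `L` depend differentiably on `t`, by interpolation, and so do
its simple zeros `q_j`. Differentiating `L₁₂(q_j) = 0` and `p_j = L₁₁(q_j)` and inserting the zero
curvature equation at `λ = q_j` gives the evolution of the Darboux coordinates (`evolution_eq`).

*The Hamiltonian.* Since `∑_j μ_j q_j ^ k = ν_{k+1}`, the pairing of `ν` with `H` is the pairing of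
`μ` with the right hand side of the system for `H`. When `q` varies, `μ` may be kept fixed at the
price of the terms `H_k (q_j ^ k - z_j ^ k)`, with `z` the moving point; their second factors vanish
at `z = q`, so only the continuity of `H` is needed (`hasDerivAt_Ham_right`, `hasDerivAt_Ham_left`).
-/

open Polynomial Filter Topology Asymptotics

namespace TwistedPainleve

/-! ### Orders of vanishing of Laurent series -/

/-- The series `f` is `O(w ^ N)`. -/
def VanishesBelow (N : ℤ) (f : LaurentSeries ℂ) : Prop :=
  ∀ n < N, f.coeff n = 0

namespace VanishesBelow

variable {N M : ℤ} {f h : LaurentSeries ℂ}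

theorem mono (hf : VanishesBelow N f) (hMN : M ≤ N) : VanishesBelow M f :=
  fun n hn => hf n (hn.trans_le hMN)

theorem add (hf : VanishesBelow N f) (hh : VanishesBelow N h) : VanishesBelow N (f + h) :=
  fun n hn => by simp [hf n hn, hh n hn]

theorem sub (hf : VanishesBelow N f) (hh : VanishesBelow N h) : VanishesBelow N (f - h) :=
  fun n hn => by simp [hf n hn, hh n hn]

theorem neg (hf : VanishesBelow N f) : VanishesBelow N (-f) :=
  fun n hn => by simp [hf n hn]

theorem smul (c : ℂ) (hf : VanishesBelow N f) : VanishesBelow N (c • f) :=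
  fun n hn => by simp [hf n hn]

theorem sum {ι : Type*} {s : Finset ι} {F : ι → LaurentSeries ℂ}
    (hF : ∀ i ∈ s, VanishesBelow N (F i)) : VanishesBelow N (∑ i ∈ s, F i) := by
  intro n hn
  rw [HahnSeries.coeff_sum]
  exact Finset.sum_eq_zero fun i hi => hF i hi n hn

end VanishesBelow

theorem exists_vanishesBelow (f : LaurentSeries ℂ) : ∃ N, VanishesBelow N f :=
  ⟨f.order, fun _ hn => HahnSeries.coeff_eq_zero_of_lt_order hn⟩

theorem vanishesBelow_single {N n : ℤ} (c : ℂ) (h : N ≤ n) :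
    VanishesBelow N (HahnSeries.single n c) :=
  fun m hm => HahnSeries.coeff_single_of_ne (by omega)

theorem coeff_mul_eq_sum_Icc {N M : ℤ} {f h : LaurentSeries ℂ} (hf : VanishesBelow N f)
    (hh : VanishesBelow M h) (n : ℤ) :
    (f * h).coeff n = ∑ i ∈ Finset.Icc N (n - M), f.coeff i * h.coeff (n - i) := by
  have hinj : Function.Injective (fun i : ℤ => (i, n - i)) := fun a b hab => by
    simpa using congrArg Prod.fst hab
  rw [HahnSeries.coeff_mul]
  refine Eq.trans ?_ (Finset.sum_map (Finset.Icc N (n - M)) ⟨_, hinj⟩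
    (fun ij => f.coeff ij.1 * h.coeff ij.2))
  refine Finset.sum_subset ?_ ?_
  · rintro ⟨a, b⟩ hab
    rw [Finset.mem_antidiagonal] at hab
    obtain ⟨ha, hb, hab⟩ := hab
    have h1 : N ≤ a := by
      by_contra hlt
      exact ha (hf a (by omega))
    have h2 : M ≤ b := by
      by_contra hlt
      exact hb (hh b (by omega))
    simp only [Finset.mem_map, Finset.mem_Icc, Function.Embedding.coeFn_mk, Prod.mk.injEq]
    exact ⟨a, ⟨h1, by simp only at hab; omega⟩, rfl, by simp only at hab; omega⟩
  · rintro ⟨a, b⟩ hab hnot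
    simp only [Finset.mem_map, Finset.mem_Icc, Function.Embedding.coeFn_mk, Prod.mk.injEq] at hab
    obtain ⟨i, -, rfl, rfl⟩ := hab
    by_contra hne
    refine hnot (Finset.mem_antidiagonal.2 ⟨left_ne_zero_of_mul hne, right_ne_zero_of_mul hne, ?_⟩)
    simp

theorem VanishesBelow.mul {N M : ℤ} {f h : LaurentSeries ℂ} (hf : VanishesBelow N f)
    (hh : VanishesBelow M h) : VanishesBelow (N + M) (f * h) := by
  intro n hn
  rw [coeff_mul_eq_sum_Icc hf hh, Finset.Icc_eq_empty (by omega), Finset.sum_empty]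

theorem coeff_mul_add_of_vanishesBelow {N M : ℤ} {f h : LaurentSeries ℂ} (hf : VanishesBelow N f)
    (hh : VanishesBelow M h) : (f * h).coeff (N + M) = f.coeff N * h.coeff M := by
  rw [coeff_mul_eq_sum_Icc hf hh]
  simp

/-- A product whose first factor only has powers of `w` of the parity of its leading one. -/
theorem coeff_mul_add_two_mul {N M : ℤ} {f h : LaurentSeries ℂ} (hf : VanishesBelow N f)
    (hpar : ∀ k, f.coeff (N + 2 * k + 1) = 0) (hh : VanishesBelow M h) (i : ℕ) :
    (f * h).coeff (N + M + 2 * i) =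
      ∑ j ∈ Finset.range (i + 1), f.coeff (N + 2 * j) * h.coeff (M + 2 * (i - j : ℕ)) := by
  have hinj : Function.Injective (fun j : ℕ => N + 2 * (j : ℤ)) := fun a b hab => by
    simp only at hab; omega
  rw [coeff_mul_eq_sum_Icc hf hh]
  trans ∑ k ∈ (Finset.range (i + 1)).map ⟨_, hinj⟩,
      f.coeff k * h.coeff (N + M + 2 * i - k)
  · symm
    refine Finset.sum_subset ?_ ?_
    · intro k hk
      simp only [Finset.mem_map, Finset.mem_range, Function.Embedding.coeFn_mk] at hk
      obtain ⟨a, ha, rfl⟩ := hk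
      rw [Finset.mem_Icc]
      omega
    · intro k hk hnot
      rw [Finset.mem_Icc] at hk
      rcases Int.even_or_odd' (k - N) with ⟨m, hm | hm⟩
      · refine absurd ?_ hnot
        simp only [Finset.mem_map, Finset.mem_range, Function.Embedding.coeFn_mk]
        exact ⟨m.toNat, by omega, by omega⟩
      · rw [show k = N + 2 * m + 1 by omega, hpar, zero_mul]
  · rw [Finset.sum_map]
    refine Finset.sum_congr rfl fun j hj => ?_
    rw [Finset.mem_range] at hj
    simp only [Function.Embedding.coeFn_mk]
    congr 2
    omega

/-! ### The derivation `∂_λ` -/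

theorem dLambda_coeff (f : LaurentSeries ℂ) (n : ℤ) :
    (dLambda f).coeff n = -((n : ℂ) - 2) / 2 * f.coeff (n - 2) := by
  rw [dLambda, HahnSeries.coeff_single_mul, LaurentSeries.derivative_apply,
    LaurentSeries.hasseDeriv_coeff]
  simp only [Nat.cast_one, Ring.choose_one_right, zsmul_eq_mul]
  rw [show n - 3 + 1 = n - 2 by ring]
  push_cast
  ring

theorem dLambda_add (f h : LaurentSeries ℂ) : dLambda (f + h) = dLambda f + dLambda h := by
  ext n; simp only [dLambda_coeff, HahnSeries.coeff_add]; ring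

theorem dLambda_sub (f h : LaurentSeries ℂ) : dLambda (f - h) = dLambda f - dLambda h := by
  ext n; simp only [dLambda_coeff, HahnSeries.coeff_sub]; ring

theorem dLambda_neg (f : LaurentSeries ℂ) : dLambda (-f) = -dLambda f := by
  ext n; simp only [dLambda_coeff, HahnSeries.coeff_neg]; ring

theorem VanishesBelow.dLambda {N : ℤ} {f : LaurentSeries ℂ} (hf : VanishesBelow N f) :
    VanishesBelow (N + 2) (dLambda f) := fun n hn => by
  rw [dLambda_coeff, hf _ (by omega), mul_zero]

theorem dLambda_mul (f h : LaurentSeries ℂ) :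
    dLambda (f * h) = dLambda f * h + f * dLambda h := by
  obtain ⟨N, hf⟩ := exists_vanishesBelow f
  obtain ⟨M, hh⟩ := exists_vanishesBelow h
  ext n
  rw [dLambda_coeff, HahnSeries.coeff_add, coeff_mul_eq_sum_Icc hf hh,
    coeff_mul_eq_sum_Icc hf.dLambda hh, coeff_mul_eq_sum_Icc hf hh.dLambda]
  have hshift : ∑ i ∈ Finset.Icc (N + 2) (n - M),
      (TwistedPainleve.dLambda f).coeff i * h.coeff (n - i) =
      ∑ i ∈ Finset.Icc N (n - 2 - M), (TwistedPainleve.dLambda f).coeff (i + 2) *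
        h.coeff (n - (i + 2)) := by
    rw [show n - M = (n - 2 - M) + 2 by ring, ← Finset.map_add_right_Icc, Finset.sum_map]
    rfl
  rw [hshift, show n - (M + 2) = n - 2 - M by ring, Finset.mul_sum, ← Finset.sum_add_distrib]
  refine Finset.sum_congr rfl fun i _ => ?_
  rw [dLambda_coeff, dLambda_coeff, show i + 2 - 2 = i by ring, show n - (i + 2) = n - 2 - i by ring,
    show n - i - 2 = n - 2 - i by ring]
  push_cast
  ring

/-- The derivation `∂_λ` multiplies a leading term `w ^ N` by `-(N / 2) w²`. -/
theorem vanishesBelow_dLambda_add {N : ℤ} {f : LaurentSeries ℂ} (hf : VanishesBelow N f) :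
    VanishesBelow (N + 3)
      (dLambda f + ((N : ℂ) / 2) • (HahnSeries.single (2 : ℤ) (1 : ℂ) * f)) := by
  intro n hn
  rw [HahnSeries.coeff_add, HahnSeries.coeff_smul, HahnSeries.coeff_single_mul, dLambda_coeff,
    smul_eq_mul, one_mul]
  rcases eq_or_ne (n - 2) N with h | h
  · rw [h, ← h]
    push_cast
    ring
  · rw [hf (n - 2) (by omega)]
    ring

/-- Constants of integration: `∂_λ f` determines the coefficients of `f` other than the constant
one. -/
theorem coeff_eq_of_dLambda_coeff {f : LaurentSeries ℂ} {n : ℤ} (hn : n ≠ 0) :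
    f.coeff n = -2 / n * (dLambda f).coeff (n + 2) := by
  have : (n : ℂ) ≠ 0 := by exact_mod_cast hn
  rw [dLambda_coeff, show n + 2 - 2 = n by ring]
  push_cast
  field_simp
  ring

/-- If `f` has order exactly `m`, the operator `δ ↦ f δ + h ∂_λ δ` raises orders by exactly `m`,
because `∂_λ` raises them by two. -/
theorem vanishesBelow_of_mul_add_mul_dLambda {m N : ℤ} {f h δ : LaurentSeries ℂ}
    (hf : VanishesBelow m f) (hfm : f.coeff m ≠ 0) (hh : VanishesBelow m h)
    (H : VanishesBelow (m + N) (f * δ + h * dLambda δ)) : VanishesBelow N δ := by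
  by_contra hnot
  have hδ : δ ≠ 0 := by
    rintro rfl
    exact hnot fun n _ => by simp
  have hord : VanishesBelow δ.order δ := fun _ hn => HahnSeries.coeff_eq_zero_of_lt_order hn
  have hlt : δ.order < N := by
    by_contra hle
    exact hnot (hord.mono (by omega))
  have h1 := H (m + δ.order) (by omega)
  rw [HahnSeries.coeff_add, coeff_mul_add_of_vanishesBelow hf hord,
    (hh.mul hord.dLambda) _ (by omega), add_zero] at h1
  exact mul_ne_zero hfm (HahnSeries.coeff_order_eq_zero.not.2 hδ) h1

/-! ### Polynomials in `λ` as Laurent series in `w` -/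

theorem toSeries_X : toSeries X = HahnSeries.single (-2 : ℤ) (1 : ℂ) := by
  simp [toSeries]

theorem toSeries_monomial (n : ℕ) (c : ℂ) :
    toSeries (monomial n c) = HahnSeries.single (-2 * (n : ℤ)) c := by
  rw [← C_mul_X_pow_eq_monomial, map_mul, map_pow, toSeries_X, HahnSeries.single_pow,
    ← algebraMap_eq, AlgHom.commutes,
    show algebraMap ℂ (LaurentSeries ℂ) c = HahnSeries.single 0 c from
      HahnSeries.ofPowerSeries_C c,
    HahnSeries.single_mul_single]
  simp [mul_comm]

theorem toSeries_coeff_neg_two_mul (P : ℂ[X]) (n : ℕ) :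
    (toSeries P).coeff (-2 * (n : ℤ)) = P.coeff n := by
  induction P using Polynomial.induction_on' with
  | add p q hp hq => rw [map_add, HahnSeries.coeff_add, hp, hq, coeff_add]
  | monomial m c =>
    rw [toSeries_monomial, coeff_monomial]
    rcases eq_or_ne m n with rfl | h
    · simp
    · rw [HahnSeries.coeff_single_of_ne (by omega), if_neg h]

theorem toSeries_coeff_eq_zero (P : ℂ[X]) {n : ℤ} (hn : ∀ k : ℕ, n ≠ -2 * (k : ℤ)) :
    (toSeries P).coeff n = 0 := by
  induction P using Polynomial.induction_on' with
  | add p q hp hq => simp [hp, hq]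
  | monomial m c => rw [toSeries_monomial, HahnSeries.coeff_single_of_ne (hn m)]

theorem toSeries_coeff_of_pos (P : ℂ[X]) {n : ℤ} (hn : 0 < n) : (toSeries P).coeff n = 0 :=
  toSeries_coeff_eq_zero P fun k => by omega

theorem toSeries_coeff_odd (P : ℂ[X]) (k : ℤ) : (toSeries P).coeff (2 * k + 1) = 0 :=
  toSeries_coeff_eq_zero P fun m => by omega

theorem toSeries_injective : Function.Injective toSeries := by
  intro P Q h
  ext n
  rw [← toSeries_coeff_neg_two_mul, h, toSeries_coeff_neg_two_mul]

theorem vanishesBelow_toSeries {P : ℂ[X]} {d : ℕ} (h : P.natDegree ≤ d) :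
    VanishesBelow (-2 * d) (toSeries P) := by
  intro n hn
  by_cases hk : ∃ k : ℕ, n = -2 * (k : ℤ)
  · obtain ⟨k, rfl⟩ := hk
    rw [toSeries_coeff_neg_two_mul]
    exact coeff_eq_zero_of_natDegree_lt (by omega)
  · exact toSeries_coeff_eq_zero P fun k hk' => hk ⟨k, hk'⟩

theorem natDegree_le_of_vanishesBelow {P : ℂ[X]} {d : ℕ}
    (h : VanishesBelow (-2 * d) (toSeries P)) : P.natDegree ≤ d := by
  rw [natDegree_le_iff_coeff_eq_zero]
  intro n hn
  rw [← toSeries_coeff_neg_two_mul]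
  exact h _ (by omega)

theorem eq_zero_of_vanishesBelow {P : ℂ[X]} (h : VanishesBelow 1 (toSeries P)) : P = 0 := by
  ext n
  rw [← toSeries_coeff_neg_two_mul, h _ (by omega), coeff_zero]

theorem dLambda_toSeries (P : ℂ[X]) : dLambda (toSeries P) = toSeries (derivative P) := by
  induction P using Polynomial.induction_on' with
  | add p q hp hq => simp [hp, hq, dLambda_add]
  | monomial m c =>
    rw [derivative_monomial, toSeries_monomial, toSeries_monomial]
    ext n
    rw [dLambda_coeff]
    rcases Nat.eq_zero_or_pos m with rfl | hm
    · rcases eq_or_ne n 2 with rfl | h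
      · simp
      · rw [HahnSeries.coeff_single_of_ne (by push_cast; omega)]
        simp
    · rcases eq_or_ne n (-2 * ((m - 1 : ℕ) : ℤ)) with rfl | h
      · rw [HahnSeries.coeff_single_same,
          show -2 * ((m - 1 : ℕ) : ℤ) - 2 = -2 * (m : ℤ) by push_cast [Nat.cast_sub hm]; ring,
          HahnSeries.coeff_single_same]
        push_cast [Nat.cast_sub hm]
        ring
      · rw [HahnSeries.coeff_single_of_ne h, HahnSeries.coeff_single_of_ne (by omega), mul_zero]

/-! ### The irregular part and the formal solutions -/

theorem VanishesBelow.of_mul {m N : ℤ} {f δ : LaurentSeries ℂ} (hf : VanishesBelow m f)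
    (hfm : f.coeff m ≠ 0) (H : VanishesBelow (m + N) (f * δ)) : VanishesBelow N δ :=
  vanishesBelow_of_mul_add_mul_dLambda (h := 0) hf hfm (fun n _ => by simp) (by simpa using H)

theorem vanishesBelow_dLambda_div {f : LaurentSeries ℂ} (hf : f ≠ 0) :
    VanishesBelow 2 (dLambda f / f) := by
  have hord : VanishesBelow f.order f := fun _ hn => HahnSeries.coeff_eq_zero_of_lt_order hn
  refine VanishesBelow.of_mul hord (HahnSeries.coeff_order_eq_zero.not.2 hf) ?_
  rw [mul_div_cancel₀ _ hf]
  exact hord.dLambda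

theorem coord_zero {g : ℕ} (t : Times g) : coord t 0 = 0 := by simp [coord]

theorem coord_of_lt {g : ℕ} (t : Times g) {k : ℕ} (hk : 2 * g + 4 < k) : coord t k = 0 :=
  dif_neg (by omega)

/-- The series `-(1/2) ∑_k ε^k t_k z^{k-2}`: the irregular part up to `O(w²)`. -/
noncomputable def slope {g : ℕ} (t : Times g) (ε : ℂ) : LaurentSeries ℂ :=
  ∑ k ∈ Finset.Icc 1 (2 * g + 4), HahnSeries.single (2 - (k : ℤ)) (-(1 / 2) * ε ^ k * coord t k)

theorem slope_coeff {g : ℕ} (t : Times g) (ε : ℂ) (n : ℤ) :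
    (slope t ε).coeff n = -(1 / 2) * ε ^ (2 - n).toNat * coord t (2 - n).toNat := by
  rw [slope, HahnSeries.coeff_sum]
  by_cases h : (2 - n).toNat ∈ Finset.Icc 1 (2 * g + 4)
  · rw [Finset.sum_eq_single_of_mem _ h]
    · rw [Finset.mem_Icc] at h
      rw [show 2 - (((2 - n).toNat : ℕ) : ℤ) = n by omega, HahnSeries.coeff_single_same]
    · intro k hk hne
      rw [Finset.mem_Icc] at h
      exact HahnSeries.coeff_single_of_ne (by omega)
  · rw [show coord t (2 - n).toNat = 0 from dif_neg (by simpa using h), mul_zero]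
    refine Finset.sum_eq_zero fun k hk => HahnSeries.coeff_single_of_ne ?_
    rintro rfl
    rw [show (2 - (2 - (k : ℤ))).toNat = k by omega] at h
    exact h hk

theorem vanishesBelow_slope {g : ℕ} (t : Times g) (ε : ℂ) :
    VanishesBelow (-(2 * g + 2)) (slope t ε) := fun n hn => by
  rw [slope_coeff, coord_of_lt _ (by omega), mul_zero]

theorem irregularPart_eq {g : ℕ} (hbar : ℂ) (t : Times g) (ε : ℂ) :
    irregularPart hbar t ε = slope t ε + HahnSeries.single (2 : ℤ) (hbar / 4) := rfl

theorem toSeries_P1 {g : ℕ} (t : Times g) : toSeries (P1 t) = slope t 1 + slope t (-1) := by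
  ext n
  rw [HahnSeries.coeff_add, slope_coeff, slope_coeff]
  by_cases h : ∃ k : ℕ, n = -2 * (k : ℤ)
  · obtain ⟨k, rfl⟩ := h
    rw [toSeries_coeff_neg_two_mul, show (2 - -2 * (k : ℤ)).toNat = 2 * k + 2 by omega, P1,
      coeff_neg, finsetSum_coeff]
    simp only [coeff_C_mul, coeff_X_pow, mul_ite, mul_one, mul_zero, Finset.sum_ite_eq,
      Finset.mem_range]
    rw [show 2 * k + 2 = 2 * (k + 1) by ring, pow_mul]
    split_ifs with hk
    · norm_num
      ring
    · rw [coord_of_lt _ (by omega)]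
      ring
  · rw [toSeries_coeff_eq_zero _ fun k hk => h ⟨k, hk⟩]
    rcases lt_or_ge n 2 with hn | hn
    · obtain ⟨m, hm⟩ : ∃ m : ℕ, (2 - n).toNat = 2 * m + 1 := by
        rcases Nat.even_or_odd' (2 - n).toNat with ⟨m, hm | hm⟩
        · exact absurd ⟨m - 1, by omega⟩ h
        · exact ⟨m, hm⟩
      rw [hm, one_pow, (odd_two_mul_add_one m).neg_one_pow]
      ring
    · rw [show (2 - n).toNat = 0 by omega, coord_zero]
      ring

/-- The leading term of `slope t 1 - slope t (-1)` is `-t_{2g+3} z^{2g+1}`. -/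
theorem slope_sub_coeff {g : ℕ} (t : Times g) (m : ℕ) :
    (slope t 1 - slope t (-1)).coeff (-(2 * g + 1) + 2 * m) =
      if m ≤ g + 1 then -coord t (2 * g + 3 - 2 * m) else 0 := by
  rw [HahnSeries.coeff_sub, slope_coeff, slope_coeff]
  split_ifs with hm
  · rw [show (2 - (-(2 * (g : ℤ) + 1) + 2 * m)).toNat = 2 * (g + 1 - m) + 1 by omega,
      show 2 * g + 3 - 2 * m = 2 * (g + 1 - m) + 1 by omega, one_pow,
      (odd_two_mul_add_one _).neg_one_pow]
    ring
  · rw [show (2 - (-(2 * (g : ℤ) + 1) + 2 * m)).toNat = 0 by omega, coord_zero]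
    ring

theorem vanishesBelow_slope_sub {g : ℕ} (t : Times g) :
    VanishesBelow (-(2 * g + 1)) (slope t 1 - slope t (-1)) := by
  intro n hn
  rcases eq_or_ne n (-(2 * g + 2)) with rfl | h
  · rw [HahnSeries.coeff_sub, slope_coeff, slope_coeff,
      show (2 - -(2 * (g : ℤ) + 2)).toNat = 2 * (g + 2) by omega, pow_mul, pow_mul]
    norm_num
  · have h' : n < -(2 * g + 2) := by omega
    rw [HahnSeries.coeff_sub, vanishesBelow_slope t 1 n h', vanishesBelow_slope t (-1) n h',
      sub_zero]

/-- If the row vector `(h₀, h₁)` satisfies `h L + ħ ∂_λ h = F h`, the column with entries `h₁, -h₀`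
is, up to a factor, the exponential-free part of a formal solution of `ħ ∂_λ Ψ = L Ψ`. The ratio
`ξ = -h₀ / h₁` of its entries solves a Riccati equation, and `L₁₁ + L₁₂ ξ` is the logarithmic
derivative of its first entry. -/
theorem exists_riccati_of_rows {hbar : ℂ} {a b c d g₀ g₁ h₀ h₁ E F : LaurentSeries ℂ} (hb : b ≠ 0)
    (hdet : g₀ * h₁ - g₁ * h₀ ≠ 0)
    (hg₀ : g₀ * a + g₁ * c + hbar • dLambda g₀ = E * g₀)
    (hg₁ : g₀ * b + g₁ * d + hbar • dLambda g₁ = E * g₁)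
    (hh₀ : h₀ * a + h₁ * c + hbar • dLambda h₀ = F * h₀)
    (hh₁ : h₀ * b + h₁ * d + hbar • dLambda h₁ = F * h₁) :
    VanishesBelow 2 (a + d - E - F) ∧
    ∃ ξ, hbar • dLambda ξ = c + (d - a) * ξ - b * ξ ^ 2 ∧ VanishesBelow 2 (a + b * ξ - E) := by
  simp only [← HahnSeries.C_mul_eq_smul] at *
  set κ := (HahnSeries.C hbar : LaurentSeries ℂ) with hκ
  have hh₁0 : h₁ ≠ 0 := by
    rintro rfl
    have : dLambda 0 = 0 := by ext n; simp [dLambda_coeff]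
    have h0 : h₀ = 0 := by simpa [this, hb] using hh₁
    exact hdet (by simp [h0])
  set D := g₀ * h₁ - g₁ * h₀ with hD
  have hD' : dLambda D = dLambda g₀ * h₁ + g₀ * dLambda h₁ - (dLambda g₁ * h₀ + g₁ * dLambda h₀) := by
    rw [hD, dLambda_sub, dLambda_mul, dLambda_mul]
  have htr : a + d - E - F = -(hbar • (dLambda D / D)) := by
    rw [← HahnSeries.C_mul_eq_smul, ← hκ]
    field_simp
    rw [hD']
    linear_combination h₁ * hg₀ - h₀ * hg₁ + g₀ * hh₁ - g₁ * hh₀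
  have htr2 : VanishesBelow 2 (a + d - E - F) := by
    rw [htr]
    exact ((vanishesBelow_dLambda_div hdet).smul _).neg
  refine ⟨htr2, -h₀ / h₁, ?_, ?_⟩
  · set ξ := -h₀ / h₁ with hξ
    have h1 : h₀ = -(ξ * h₁) := by rw [hξ]; field_simp
    have h2 : dLambda h₀ = -(dLambda ξ * h₁ + ξ * dLambda h₁) := by
      rw [h1, ← dLambda_mul, dLambda_neg]
    rw [h2, h1] at hh₀
    rw [h1] at hh₁
    refine mul_right_cancel₀ hh₁0 ?_
    linear_combination -hh₀ - ξ * hh₁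
  · have : a + b * (-h₀ / h₁) - E = (a + d - E - F) + hbar • (dLambda h₁ / h₁) := by
      rw [← HahnSeries.C_mul_eq_smul, ← hκ]
      field_simp
      linear_combination -hh₁
    rw [this]
    exact htr2.add ((vanishesBelow_dLambda_div hh₁0).smul _)

/-- `ξ` is the slope `Ψ₂₁ / Ψ₁₁` of a formal solution of `ħ ∂_λ Ψ = L Ψ`, and the logarithmic
derivative of its first entry is `slope t ε` up to `O(w²)`. -/
structure IsFormalSlope {g : ℕ} (hbar : ℂ) (L : Matrix (Fin 2) (Fin 2) ℂ[X]) (t : Times g) (ε : ℂ)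
    (ξ : LaurentSeries ℂ) : Prop where
  riccati : hbar • dLambda ξ =
    toSeries (L 1 0) + (toSeries (L 1 1) - toSeries (L 0 0)) * ξ - toSeries (L 0 1) * ξ ^ 2
  asymptotic : VanishesBelow 2 (toSeries (L 0 0) + toSeries (L 0 1) * ξ - slope t ε)

theorem HasIrregularType.exists_isFormalSlope {g : ℕ} {hbar : ℂ} {L : Matrix (Fin 2) (Fin 2) ℂ[X]}
    {t : Times g} (h : HasIrregularType hbar L t) (hb : L 0 1 ≠ 0) :
    L 0 0 + L 1 1 = P1 t ∧ (∃ ξ, IsFormalSlope hbar L t 1 ξ) ∧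
      ∃ ξ, IsFormalSlope hbar L t (-1) ξ := by
  obtain ⟨G, -, -, hdet, hG⟩ := h
  have hb' : toSeries (L 0 1) ≠ 0 := fun h0 => hb (toSeries_injective (by simpa using h0))
  rw [Matrix.det_fin_two] at hdet
  have e := fun i j => congrFun (congrFun hG i) j
  have e00 := e 0 0
  have e01 := e 0 1
  have e10 := e 1 0
  have e11 := e 1 1
  simp [Matrix.mul_apply, Fin.sum_univ_two] at e00 e01 e10 e11
  have hsing : VanishesBelow 2 (HahnSeries.single (2 : ℤ) (hbar / 4)) :=
    vanishesBelow_single _ le_rfl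
  obtain ⟨htr, ξ, hξ, hξ'⟩ := exists_riccati_of_rows hb' hdet e00 e01 e10 e11
  obtain ⟨-, η, hη, hη'⟩ := exists_riccati_of_rows hb'
    (fun h0 => hdet (by linear_combination -h0)) e10 e11 e00 e01
  refine ⟨?_, ⟨ξ, hξ, ?_⟩, η, hη, ?_⟩
  · rw [← sub_eq_zero]
    refine eq_zero_of_vanishesBelow (VanishesBelow.mono (N := 2) ?_ (by norm_num))
    rw [map_sub, map_add, toSeries_P1]
    convert (htr.add hsing).add hsing using 1
    rw [irregularPart_eq, irregularPart_eq]
    ring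
  · convert hξ'.add hsing using 1
    rw [irregularPart_eq]
    ring
  · convert hη'.add hsing using 1
    rw [irregularPart_eq]
    ring

/-! ### The polynomials `P₁` and `P₂` at infinity -/

theorem coeff_mul_eq_zero {f h : LaurentSeries ℂ} {n : ℤ}
    (H : ∀ i, f.coeff i * h.coeff (n - i) = 0) : (f * h).coeff n = 0 := by
  obtain ⟨N, hf⟩ := exists_vanishesBelow f
  obtain ⟨M, hh⟩ := exists_vanishesBelow h
  rw [coeff_mul_eq_sum_Icc hf hh]
  exact Finset.sum_eq_zero fun i _ => H i

theorem slope_mul_slope_coeff {g : ℕ} (t : Times g) {k : ℕ} (hk : g ≤ k) :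
    (slope t 1 * slope t (-1)).coeff (-2 * (k : ℤ)) = P2Coeff t k := by
  rw [coeff_mul_eq_sum_Icc (vanishesBelow_slope t 1) (vanishesBelow_slope t (-1)), P2Coeff,
    Finset.mul_sum]
  refine Finset.sum_nbij' (fun i => (i + 2 * k + 2).toNat) (fun j => (j : ℤ) - 2 * k - 2)
    ?_ ?_ ?_ ?_ ?_
  · intro i hi
    rw [Finset.mem_Icc] at hi ⊢
    omega
  · intro j hj
    rw [Finset.mem_Icc] at hj ⊢
    omega
  · intro i hi
    rw [Finset.mem_Icc] at hi
    omega
  · intro j hj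
    rw [Finset.mem_Icc] at hj
    omega
  · intro i hi
    rw [Finset.mem_Icc] at hi
    rw [slope_coeff, slope_coeff, show (2 - (-2 * (k : ℤ) - i)).toNat = (i + 2 * k + 2).toNat by omega,
      show (2 - i).toNat = 2 * k + 4 - (i + 2 * k + 2).toNat by omega]
    ring

/-- The part of order zero in `ħ` of `P₂` gives the coefficients of order at least `λ^g` of the
product of the two slopes. -/
theorem vanishesBelow_slope_mul_slope_sub {g : ℕ} (t : Times g) :
    VanishesBelow (1 - 2 * g) (slope t 1 * slope t (-1) -
      toSeries (∑ k ∈ Finset.Icc g (2 * g + 2), C (P2Coeff t k) * X ^ k)) := by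
  intro n hn
  rw [HahnSeries.coeff_sub]
  rcases Int.even_or_odd' n with ⟨m, hm | hm⟩
  · obtain ⟨k, rfl⟩ : ∃ k : ℕ, n = -2 * (k : ℤ) := ⟨(-m).toNat, by omega⟩
    have hk : g ≤ k := by omega
    rw [slope_mul_slope_coeff t hk, toSeries_coeff_neg_two_mul, finsetSum_coeff]
    simp only [coeff_C_mul, coeff_X_pow, mul_ite, mul_one, mul_zero, Finset.sum_ite_eq,
      Finset.mem_Icc]
    split_ifs with h
    · exact sub_self _
    · rw [P2Coeff, Finset.Icc_eq_empty (by omega)]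
      simp
  · rw [hm, toSeries_coeff_odd, sub_zero]
    -- `4 D₁ D₂ = (D₁ + D₂)² - (D₁ - D₂)²`, where the sum is even and the difference odd in `w`.
    have hodd : ∀ i : ℤ, (slope t 1 - slope t (-1)).coeff (2 * i) = 0 := by
      intro i
      rw [HahnSeries.coeff_sub, slope_coeff, slope_coeff]
      rcases lt_or_ge i 1 with hi | hi
      · rw [show (2 - 2 * i).toNat = 2 * (1 - i).toNat by omega, pow_mul, pow_mul]
        norm_num
      · rw [show (2 - 2 * i).toNat = 0 by omega, coord_zero]
        ring
    have h4 : 4 * (slope t 1 * slope t (-1)) = toSeries (P1 t) * toSeries (P1 t) -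
        (slope t 1 - slope t (-1)) * (slope t 1 - slope t (-1)) := by
      rw [toSeries_P1]; ring
    have h5 : (4 * (slope t 1 * slope t (-1))).coeff (2 * m + 1) = 0 := by
      rw [h4, HahnSeries.coeff_sub, coeff_mul_eq_zero, coeff_mul_eq_zero, sub_zero]
      · intro i
        rcases Int.even_or_odd' i with ⟨l, rfl | rfl⟩
        · rw [hodd, zero_mul]
        · rw [show 2 * m + 1 - (2 * l + 1) = 2 * (m - l) by ring, hodd, mul_zero]
      · intro i
        rcases Int.even_or_odd' i with ⟨l, rfl | rfl⟩
        · rw [show 2 * m + 1 - 2 * l = 2 * (m - l) + 1 by ring, toSeries_coeff_odd, mul_zero]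
        · rw [toSeries_coeff_odd, zero_mul]
    rw [show (4 : LaurentSeries ℂ) = HahnSeries.C (4 : ℂ) from (map_ofNat _ 4).symm,
      HahnSeries.C_mul_eq_smul, HahnSeries.coeff_smul, smul_eq_mul] at h5
    simpa using h5

theorem P1_natDegree_le {g : ℕ} (t : Times g) : (P1 t).natDegree ≤ g + 1 := by
  rw [P1, natDegree_neg]
  exact natDegree_sum_le_of_forall_le _ _ fun j hj =>
    (natDegree_C_mul_X_pow_le _ _).trans (by rw [Finset.mem_range] at hj; omega)

theorem P1_coeff_top {g : ℕ} (t : Times g) : (P1 t).coeff (g + 1) = -coord t (2 * g + 4) := by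
  rw [P1, coeff_neg, finsetSum_coeff]
  simp only [coeff_C_mul, coeff_X_pow, mul_ite, mul_one, mul_zero, Finset.sum_ite_eq,
    Finset.mem_range]
  rw [if_pos (by omega)]
  congr 2

theorem vanishesBelow_monomial_add_P1 {g : ℕ} (t : Times g) :
    VanishesBelow (2 - 2 * g) (toSeries (monomial g (coord t (2 * g + 4))) +
      HahnSeries.single (2 : ℤ) (1 : ℂ) * toSeries (P1 t)) := by
  intro n hn
  rw [HahnSeries.coeff_add, toSeries_monomial, HahnSeries.coeff_single_mul, one_mul]
  rcases eq_or_ne n (-2 * g) with rfl | h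
  · rw [HahnSeries.coeff_single_same, show -2 * (g : ℤ) - 2 = -2 * ((g + 1 : ℕ) : ℤ) by push_cast; ring,
      toSeries_coeff_neg_two_mul, P1_coeff_top]
    ring
  · rw [HahnSeries.coeff_single_of_ne h, zero_add]
    rcases lt_or_ge n (-2 * g) with h' | h'
    · exact vanishesBelow_toSeries (P1_natDegree_le t) _ (by push_cast; omega)
    · rw [show n - 2 = 2 * (-(g : ℤ) - 1) + 1 by omega, toSeries_coeff_odd]

/-- The leading term of `∂_λ`, without denominators. -/
theorem vanishesBelow_two_mul_dLambda {N : ℤ} {f : LaurentSeries ℂ} (hf : VanishesBelow N f) :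
    VanishesBelow (N + 3)
      (2 * dLambda f + N * (HahnSeries.single (2 : ℤ) (1 : ℂ) * f)) := by
  have h := (vanishesBelow_dLambda_add hf).smul 2
  convert h using 1
  rw [smul_add, smul_smul, mul_div_cancel₀ _ two_ne_zero, ← HahnSeries.C_mul_eq_smul,
    ← HahnSeries.C_mul_eq_smul, map_ofNat, map_intCast]

theorem VanishesBelow.natCast_mul {N : ℤ} {f : LaurentSeries ℂ} (hf : VanishesBelow N f) (n : ℕ) :
    VanishesBelow N (n * f) := by
  have h := hf.smul (n : ℂ)
  rwa [← HahnSeries.C_mul_eq_smul, map_natCast] at h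

theorem VanishesBelow.C_mul {N : ℤ} {f : LaurentSeries ℂ} (hf : VanishesBelow N f) (c : ℂ) :
    VanishesBelow N (HahnSeries.C c * f) := by
  rw [HahnSeries.C_mul_eq_smul]
  exact hf.smul c

/-- Both formal logarithmic derivatives `y` of the first component satisfy the same quadratic
differential equation `b (y² - P₁ y) + N + ħ (b y' - b' y) = 0`. Since their principal parts are
known, so are the leading terms of `N / b`. -/
theorem vanishesBelow_sub_P2 {g : ℕ} {hbar : ℂ} {t : Times g} (ht : coord t (2 * g + 3) ≠ 0)
    {b : ℂ[X]} (hb : b.Monic) (hbg : b.natDegree = g) {N y₁ y₂ : LaurentSeries ℂ}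
    (hy₁ : VanishesBelow 2 (y₁ - slope t 1)) (hy₂ : VanishesBelow 2 (y₂ - slope t (-1)))
    (e₁ : toSeries b * (y₁ ^ 2 - toSeries (P1 t) * y₁) + N +
      HahnSeries.C hbar * (toSeries b * dLambda y₁ - dLambda (toSeries b) * y₁) = 0)
    (e₂ : toSeries b * (y₂ ^ 2 - toSeries (P1 t) * y₂) + N +
      HahnSeries.C hbar * (toSeries b * dLambda y₂ - dLambda (toSeries b) * y₂) = 0) :
    VanishesBelow (1 - 4 * g) (N - toSeries (b * P2 hbar t)) := by
  have hP := toSeries_P1 t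
  have hPdeg := vanishesBelow_toSeries (P1_natDegree_le t)
  have hlead := vanishesBelow_monomial_add_P1 t
  have hprod := vanishesBelow_slope_mul_slope_sub t
  have hw : VanishesBelow 2 (HahnSeries.single (2 : ℤ) (1 : ℂ)) := vanishesBelow_single _ le_rfl
  have hB := vanishesBelow_toSeries hbg.le
  have hB0 : (toSeries b).coeff (-2 * g) ≠ 0 := by
    rw [toSeries_coeff_neg_two_mul, ← hbg, hb.coeff_natDegree]
    exact one_ne_zero
  have hP2 : toSeries (b * P2 hbar t) = toSeries b *
      (toSeries (∑ k ∈ Finset.Icc g (2 * g + 2), C (P2Coeff t k) * X ^ k) +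
        HahnSeries.C (hbar / 2) * toSeries (monomial g (coord t (2 * g + 4)))) := by
    rw [map_mul, P2, map_add, HahnSeries.C_mul_eq_smul, toSeries_monomial,
      C_mul_X_pow_eq_monomial, toSeries_monomial]
    congr 2
    ext n
    simp [HahnSeries.coeff_single]
  have hC2 : (2 : LaurentSeries ℂ) * HahnSeries.C (hbar / 2) = HahnSeries.C hbar := by
    rw [← map_ofNat HahnSeries.C 2, ← map_mul, mul_div_cancel₀ _ two_ne_zero]
  rw [hP2]
  set B := toSeries b
  set P := toSeries (P1 t)
  set w := HahnSeries.single (2 : ℤ) (1 : ℂ)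
  set κ : LaurentSeries ℂ := HahnSeries.C hbar with hκ
  set κ₂ : LaurentSeries ℂ := HahnSeries.C (hbar / 2)
  set M := toSeries (∑ k ∈ Finset.Icc g (2 * g + 2), C (P2Coeff t k) * X ^ k)
  set T := toSeries (monomial g (coord t (2 * g + 4)))
  set D₁ := slope t 1
  set D₂ := slope t (-1)
  have hΔ₀ : VanishesBelow (-(2 * g + 1)) (D₁ - D₂) := vanishesBelow_slope_sub t
  have hρ : VanishesBelow 2 ((y₁ - y₂) - (D₁ - D₂)) := by
    convert hy₁.sub hy₂ using 1; ring
  have hΔ : VanishesBelow (-(2 * g + 1)) (y₁ - y₂) := by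
    convert hΔ₀.add (hρ.mono (by omega)) using 1; ring
  have hΔ0 : (y₁ - y₂).coeff (-(2 * g + 1)) ≠ 0 := by
    have h1 := slope_sub_coeff t 0
    have h2 := hρ (-(2 * g + 1)) (by omega)
    rw [HahnSeries.coeff_sub, sub_eq_zero] at h2
    simp only [Nat.cast_zero, mul_zero, add_zero, zero_le, if_true, Nat.sub_zero] at h1
    rw [h2, h1]
    exact neg_ne_zero.2 ht
  have hσ : VanishesBelow 2 (y₁ + y₂ - P) := by
    convert hy₁.add hy₂ using 1; rw [hP]; ring
  have hS : VanishesBelow (-(2 * g + 2)) (y₁ + y₂) := by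
    convert (hPdeg.mono (M := -(2 * g + 2)) (by push_cast; omega)).add
      (hσ.mono (by omega)) using 1
    ring
  have E₁ := vanishesBelow_two_mul_dLambda hΔ
  have E₂ := vanishesBelow_two_mul_dLambda hB
  have E₃ := vanishesBelow_two_mul_dLambda hS
  rw [dLambda_sub] at E₁
  rw [dLambda_add] at E₃
  push_cast at E₁ E₂ E₃
  set ε₁ := 2 * (dLambda y₁ - dLambda y₂) + -(2 * (g : LaurentSeries ℂ) + 1) * (w * (y₁ - y₂))
    with hε₁
  set ε₂ := 2 * dLambda B + -2 * (g : LaurentSeries ℂ) * (w * B) with hε₂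
  set ε₃ := 2 * (dLambda y₁ + dLambda y₂) + -(2 * (g : LaurentSeries ℂ) + 2) * (w * (y₁ + y₂))
    with hε₃
  -- The sum of the two logarithmic derivatives is `P₁ - (ħ / 2) λ⁻¹` up to `O(w³)`.
  have E₄ : VanishesBelow 3 (2 * (y₁ + y₂ - P) + κ * w) := by
    have hBΔ := hB.mul hΔ
    have hBΔ0 : (B * (y₁ - y₂)).coeff (-2 * g + -(2 * g + 1)) ≠ 0 := by
      rw [coeff_mul_add_of_vanishesBelow hB hΔ]
      exact mul_ne_zero hB0 hΔ0
    refine VanishesBelow.of_mul hBΔ hBΔ0 ?_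
    have hid : B * (y₁ - y₂) * (2 * (y₁ + y₂ - P) + κ * w) =
        κ * (ε₂ * (y₁ - y₂)) - κ * (B * ε₁) := by
      rw [hε₁, hε₂]
      linear_combination 2 * e₁ - 2 * e₂
    rw [hid]
    refine VanishesBelow.sub (VanishesBelow.C_mul ?_ _) (VanishesBelow.C_mul ?_ _)
    · exact (E₂.mul hΔ).mono (by omega)
    · exact (hB.mul E₁).mono (by omega)
  -- The product `y₁ y₂` agrees with `P₂ + (ħ / 4) λ⁻¹ (y₁ + y₂)` up to terms of order below `λ ^ g`.
  have hZ : VanishesBelow (1 - 2 * g) (4 * (y₁ * y₂) - 4 * (M + κ₂ * T) - κ * (w * (y₁ + y₂))) := by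
    have hid : 4 * (y₁ * y₂) - 4 * (M + κ₂ * T) - κ * (w * (y₁ + y₂)) =
        (4 : ℕ) * (D₁ * D₂ - M) - (2 : ℕ) * (κ * (T + w * P)) + P * (2 * (y₁ + y₂ - P) + κ * w) +
          (y₁ + y₂ - P) * (y₁ + y₂ - P) - ((y₁ - y₂) - (D₁ - D₂)) * ((y₁ - y₂) + (D₁ - D₂))
          - κ * (w * (y₁ + y₂ - P)) := by
      rw [hP]
      push_cast
      linear_combination -2 * T * hC2
    rw [hid]
    have h1 := hprod.natCast_mul 4
    have h2 := ((hlead.C_mul hbar).natCast_mul 2).mono (M := 1 - 2 * g) (by omega)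
    have h3 := (hPdeg.mul E₄).mono (M := 1 - 2 * g) (by push_cast; omega)
    have h4 := (hσ.mul hσ).mono (M := 1 - 2 * g) (by omega)
    have h5 := (hρ.mul (hΔ.add hΔ₀)).mono (M := 1 - 2 * g) (by omega)
    have h6 := ((hw.mul hσ).C_mul hbar).mono (M := 1 - 2 * g) (by omega)
    exact ((((h1.sub h2).add h3).add h4).sub h5).sub h6
  -- The combination `y₁ e₂ - y₂ e₁` isolates `N`; the derivatives which it leaves are replaced by
  -- their leading terms.
  have hR : VanishesBelow (1 - 4 * g) (4 * (N - B * (M + κ₂ * T))) := by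
    refine VanishesBelow.of_mul hΔ hΔ0 ?_
    have hid : (y₁ - y₂) * (4 * (N - B * (M + κ₂ * T))) =
        B * ((y₁ - y₂) * (4 * (y₁ * y₂) - 4 * (M + κ₂ * T) - κ * (w * (y₁ + y₂)))) +
        κ * (B * ((y₁ + y₂) * ε₁ - (y₁ - y₂) * ε₃)) := by
      rw [hε₁, hε₃]
      linear_combination (-4 * y₂) * e₁ + (4 * y₁) * e₂
    rw [hid]
    have h1 := (hB.mul (hΔ.mul hZ)).mono (M := -(2 * (g : ℤ) + 1) + (1 - 4 * g)) (by omega)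
    have h2 := (hS.mul E₁).mono (M := -4 * (g : ℤ)) (by omega)
    have h3 := (hΔ.mul E₃).mono (M := -4 * (g : ℤ)) (by omega)
    have h4 := ((hB.mul (h2.sub h3)).C_mul hbar).mono
      (M := -(2 * (g : ℤ) + 1) + (1 - 4 * g)) (by omega)
    exact h1.add h4
  have h4 : N - B * (M + κ₂ * T) = (1 / 4 : ℂ) • (4 * (N - B * (M + κ₂ * T))) := by
    rw [← HahnSeries.C_mul_eq_smul, ← mul_assoc, ← map_ofNat HahnSeries.C 4, ← map_mul]
    norm_num
  rw [h4]
  exact hR.smul _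

/-! ### Coefficientwise derivatives of families of Laurent series -/

/-- The family `f` of Laurent series, of locally bounded pole order, has the coefficientwise
derivative `f'` at `s₀`. -/
def HasCoeffDerivAt (f : ℂ → LaurentSeries ℂ) (f' : LaurentSeries ℂ) (s₀ : ℂ) : Prop :=
  (∃ N, ∀ᶠ s in 𝓝 s₀, VanishesBelow N (f s)) ∧
    ∀ n, HasDerivAt (fun s => (f s).coeff n) (f'.coeff n) s₀

namespace HasCoeffDerivAt

variable {f h : ℂ → LaurentSeries ℂ} {f' h' : LaurentSeries ℂ} {s₀ : ℂ}

theorem vanishesBelow {N : ℤ} (hf : HasCoeffDerivAt f f' s₀)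
    (hN : ∀ᶠ s in 𝓝 s₀, VanishesBelow N (f s)) : VanishesBelow N f' := by
  intro n hn
  have h0 : (fun s => (f s).coeff n) =ᶠ[𝓝 s₀] fun _ => (0 : ℂ) := hN.mono fun s hs => hs n hn
  exact (hf.2 n).unique ((hasDerivAt_const s₀ (0 : ℂ)).congr_of_eventuallyEq h0)

theorem add (hf : HasCoeffDerivAt f f' s₀) (hh : HasCoeffDerivAt h h' s₀) :
    HasCoeffDerivAt (fun s => f s + h s) (f' + h') s₀ := by
  obtain ⟨⟨N, hN⟩, hf⟩ := hf
  obtain ⟨⟨M, hM⟩, hh⟩ := hh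
  refine ⟨⟨min N M, ?_⟩, fun n => ?_⟩
  · filter_upwards [hN, hM] with s h1 h2
    exact (h1.mono (min_le_left _ _)).add (h2.mono (min_le_right _ _))
  · simpa only [HahnSeries.coeff_add] using (hf n).fun_add (hh n)

theorem neg (hf : HasCoeffDerivAt f f' s₀) : HasCoeffDerivAt (fun s => -f s) (-f') s₀ := by
  obtain ⟨⟨N, hN⟩, hf⟩ := hf
  refine ⟨⟨N, hN.mono fun s h => h.neg⟩, fun n => ?_⟩
  simpa only [HahnSeries.coeff_neg] using (hf n).fun_neg

theorem sub (hf : HasCoeffDerivAt f f' s₀) (hh : HasCoeffDerivAt h h' s₀) :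
    HasCoeffDerivAt (fun s => f s - h s) (f' - h') s₀ := by
  simpa only [sub_eq_add_neg] using hf.add hh.neg

theorem mul (hf : HasCoeffDerivAt f f' s₀) (hh : HasCoeffDerivAt h h' s₀) :
    HasCoeffDerivAt (fun s => f s * h s) (f' * h s₀ + f s₀ * h') s₀ := by
  obtain ⟨N, hN⟩ := hf.1
  obtain ⟨M, hM⟩ := hh.1
  refine ⟨⟨N + M, by filter_upwards [hN, hM] with s h1 h2 using h1.mul h2⟩, fun n => ?_⟩
  have hev : (fun s => (f s * h s).coeff n) =ᶠ[𝓝 s₀] fun s =>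
      ∑ i ∈ Finset.Icc N (n - M), (f s).coeff i * (h s).coeff (n - i) := by
    filter_upwards [hN, hM] with s h1 h2 using coeff_mul_eq_sum_Icc h1 h2 n
  refine HasDerivAt.congr_of_eventuallyEq ?_ hev
  rw [HahnSeries.coeff_add, coeff_mul_eq_sum_Icc (hf.vanishesBelow hN) hM.self_of_nhds,
    coeff_mul_eq_sum_Icc hN.self_of_nhds (hh.vanishesBelow hM), ← Finset.sum_add_distrib]
  exact HasDerivAt.fun_sum fun i _ => (hf.2 i).fun_mul (hh.2 (n - i))

theorem const_mul (c : ℂ) (hf : HasCoeffDerivAt f f' s₀) :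
    HasCoeffDerivAt (fun s => HahnSeries.C c * f s) (HahnSeries.C c * f') s₀ := by
  obtain ⟨⟨N, hN⟩, hf⟩ := hf
  refine ⟨⟨N, hN.mono fun s h => h.C_mul c⟩, fun n => ?_⟩
  simpa only [HahnSeries.C_mul_eq_smul, HahnSeries.coeff_smul, smul_eq_mul] using
    (hf n).const_mul c

theorem dLambda (hf : HasCoeffDerivAt f f' s₀) :
    HasCoeffDerivAt (fun s => dLambda (f s)) (dLambda f') s₀ := by
  obtain ⟨⟨N, hN⟩, hf⟩ := hf
  refine ⟨⟨N + 2, hN.mono fun s h => h.dLambda⟩, fun n => ?_⟩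
  simpa only [dLambda_coeff] using (hf (n - 2)).const_mul _

theorem toSeries {d : ℕ} {P : ℂ → ℂ[X]} {P' : ℂ[X]} (hd : ∀ᶠ s in 𝓝 s₀, (P s).natDegree ≤ d)
    (hP : ∀ n, HasDerivAt (fun s => (P s).coeff n) (P'.coeff n) s₀) :
    HasCoeffDerivAt (fun s => toSeries (P s)) (toSeries P') s₀ := by
  refine ⟨⟨-2 * d, hd.mono fun s h => vanishesBelow_toSeries h⟩, fun n => ?_⟩
  by_cases hk : ∃ k : ℕ, n = -2 * (k : ℤ)
  · obtain ⟨k, rfl⟩ := hk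
    simpa only [toSeries_coeff_neg_two_mul] using hP k
  · push Not at hk
    simpa only [toSeries_coeff_eq_zero _ hk] using hasDerivAt_const s₀ (0 : ℂ)

end HasCoeffDerivAt

theorem coord_add {g : ℕ} (s t : Times g) (k : ℕ) : coord (s + t) k = coord s k + coord t k := by
  unfold coord; split_ifs <;> simp

theorem coord_smul {g : ℕ} (c : ℂ) (t : Times g) (k : ℕ) : coord (c • t) k = c * coord t k := by
  unfold coord; split_ifs <;> simp

theorem slope_smul {g : ℕ} (c : ℂ) (t : Times g) (ε : ℂ) :
    slope (c • t) ε = HahnSeries.C c * slope t ε := by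
  ext n
  rw [HahnSeries.C_mul_eq_smul, HahnSeries.coeff_smul, slope_coeff, slope_coeff, coord_smul,
    smul_eq_mul]
  ring

theorem hasCoeffDerivAt_slope {g : ℕ} (t β : Times g) (ε : ℂ) :
    HasCoeffDerivAt (fun s : ℂ => slope (t + s • β) ε) (slope β ε) 0 := by
  refine ⟨⟨_, Eventually.of_forall fun s => vanishesBelow_slope _ _⟩, fun n => ?_⟩
  simp only [slope_coeff, coord_add, coord_smul]
  have h := (((hasDerivAt_id (0 : ℂ)).mul_const (coord β (2 - n).toNat)).const_add
    (coord t (2 - n).toNat)).const_mul (-(1 / 2) * ε ^ (2 - n).toNat)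
  simpa only [id, one_mul] using h

/-! ### Normalized connections -/

section Normalized

variable {g : ℕ} {hbar : ℂ} {t : Times g} {L : Matrix (Fin 2) (Fin 2) ℂ[X]}

theorem IsNormalized.natDegree_upper_right (h : IsNormalized hbar t L) : (L 0 1).natDegree = g := by
  have h1 : (L 0 1).coeff (g + 1) = 0 := congrFun (congrFun h.leading 0) 1
  obtain ⟨δ, hδ⟩ := h.subleading
  have h2 : (L 0 1).coeff g = 1 := congrFun (congrFun hδ 0) 1
  refine le_antisymm ?_ (le_natDegree_of_ne_zero (by rw [h2]; exact one_ne_zero))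
  rw [natDegree_le_iff_coeff_eq_zero]
  intro n hn
  rcases eq_or_ne n (g + 1) with rfl | hne
  · exact h1
  · exact coeff_eq_zero_of_natDegree_lt ((h.natDegree_le 0 1).trans_lt (by omega))

theorem IsNormalized.monic_upper_right (h : IsNormalized hbar t L) : (L 0 1).Monic := by
  obtain ⟨δ, hδ⟩ := h.subleading
  have h2 : (L 0 1).coeff g = 1 := congrFun (congrFun hδ 0) 1
  rw [Monic, leadingCoeff, h.natDegree_upper_right, h2]

theorem IsNormalized.trace (h : IsNormalized hbar t L) : L 0 0 + L 1 1 = P1 t :=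
  (h.irregularType.exists_isFormalSlope h.monic_upper_right.ne_zero).1

theorem IsNormalized.exists_isFormalSlope (h : IsNormalized hbar t L) {ε : ℂ}
    (hε : ε = 1 ∨ ε = -1) : ∃ ξ, IsFormalSlope hbar L t ε ξ := by
  obtain ⟨-, h1, h2⟩ := h.irregularType.exists_isFormalSlope h.monic_upper_right.ne_zero
  rcases hε with rfl | rfl
  exacts [h1, h2]

end Normalized

/-- The polynomial `L₁₂ det L + ħ (L₁₁ L₁₂' - L₁₁' L₁₂)`. Up to the factor `-L₁₂` it is the lower
left entry of the companion Lax matrix. -/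
noncomputable def companionNumerator (hbar : ℂ) (L : Matrix (Fin 2) (Fin 2) ℂ[X]) : ℂ[X] :=
  L 0 1 * (L 0 0 * L 1 1 - L 0 1 * L 1 0) +
    C hbar * (L 0 0 * derivative (L 0 1) - derivative (L 0 0) * L 0 1)

theorem toSeries_C (c : ℂ) : toSeries (C c) = HahnSeries.C c := by
  rw [← monomial_zero_left, toSeries_monomial]
  simp [HahnSeries.C_apply]

/-- Elimination of `ξ = (y - L₁₁) / L₁₂` from the Riccati equation: the logarithmic derivative
`y = L₁₁ + L₁₂ ξ` solves a quadratic differential equation with polynomial coefficients. -/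
theorem IsFormalSlope.quadratic {g : ℕ} {hbar : ℂ} {t : Times g}
    {L : Matrix (Fin 2) (Fin 2) ℂ[X]} {ε : ℂ} {ξ : LaurentSeries ℂ}
    (htr : L 0 0 + L 1 1 = P1 t) (h : IsFormalSlope hbar L t ε ξ) :
    toSeries (L 0 1) * ((toSeries (L 0 0) + toSeries (L 0 1) * ξ) ^ 2 -
      toSeries (P1 t) * (toSeries (L 0 0) + toSeries (L 0 1) * ξ)) +
      toSeries (companionNumerator hbar L) +
      HahnSeries.C hbar * (toSeries (L 0 1) * dLambda (toSeries (L 0 0) + toSeries (L 0 1) * ξ) -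
        dLambda (toSeries (L 0 1)) * (toSeries (L 0 0) + toSeries (L 0 1) * ξ)) = 0 := by
  have hr := h.riccati
  rw [← HahnSeries.C_mul_eq_smul] at hr
  simp only [companionNumerator, map_add, map_mul, map_sub, toSeries_C, ← dLambda_toSeries, ← htr,
    dLambda_add, dLambda_mul]
  linear_combination (toSeries (L 0 1)) ^ 2 * hr

/-- The principal part `D` of a formal logarithmic derivative satisfies its quadratic equation up to
terms of known order. -/
theorem vanishesBelow_quadratic_slope {g : ℕ} {hbar : ℂ} {B P N D y : LaurentSeries ℂ}
    (hB : VanishesBelow (-2 * g) B) (hD : VanishesBelow (-(2 * g + 1)) (2 * D - P))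
    (hy : VanishesBelow 2 (y - D))
    (e : B * (y ^ 2 - P * y) + N + HahnSeries.C hbar * (B * dLambda y - dLambda B * y) = 0) :
    VanishesBelow (1 - 4 * g)
      (B * (D ^ 2 - P * D) + N + HahnSeries.C hbar * (B * dLambda D - dLambda B * D)) := by
  have hid : B * (D ^ 2 - P * D) + N + HahnSeries.C hbar * (B * dLambda D - dLambda B * D) =
      -(B * ((2 * D - P + (y - D)) * (y - D)) +
        HahnSeries.C hbar * (B * dLambda (y - D) - dLambda B * (y - D))) := by
    rw [dLambda_sub]
    linear_combination e
  rw [hid]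
  refine VanishesBelow.neg (VanishesBelow.add ?_ (VanishesBelow.C_mul (VanishesBelow.sub ?_ ?_) _))
  · exact (hB.mul ((hD.add (hy.mono (by omega))).mul hy)).mono (by omega)
  · exact (hB.mul hy.dLambda).mono (by omega)
  · exact (hB.dLambda.mul hy).mono (by omega)

/-- If `y` solves the quadratic equation and `y'` its linearization, whereas `(D, D')` does so up to
terms of known order, then `y'` agrees with `D'` as far as `y` agrees with `D`. -/
theorem vanishesBelow_sub_of_linearized {g : ℕ} {hbar : ℂ}
    {B P D y B' P' N' D' y' : LaurentSeries ℂ}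
    (hB : VanishesBelow (-2 * g) B) (hB0 : B.coeff (-2 * g) ≠ 0) (hB' : VanishesBelow (-2 * g) B')
    (hD : VanishesBelow (-(2 * g + 1)) (2 * D - P)) (hD0 : (2 * D - P).coeff (-(2 * g + 1)) ≠ 0)
    (hD' : VanishesBelow (-(2 * g + 1)) (2 * D' - P')) (hy : VanishesBelow 2 (y - D))
    (e : B' * (y ^ 2 - P * y) + B * (2 * y * y' - P' * y - P * y') + N' +
      HahnSeries.C hbar * (B' * dLambda y + B * dLambda y' - dLambda B' * y - dLambda B * y') = 0)
    (hr : VanishesBelow (1 - 4 * g) (B' * (D ^ 2 - P * D) + B * (2 * D * D' - P' * D - P * D') + N' +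
      HahnSeries.C hbar * (B' * dLambda D + B * dLambda D' - dLambda B' * D - dLambda B * D'))) :
    VanishesBelow 2 (D' - y') := by
  have h2y : VanishesBelow (-(2 * g + 1)) (2 * y - P) := by
    convert hD.add ((hy.natCast_mul 2).mono (by omega)) using 1
    push_cast
    ring
  have h2y0 : (2 * y - P).coeff (-(2 * g + 1)) ≠ 0 := by
    have : 2 * y - P = 2 * D - P + (2 : ℕ) * (y - D) := by push_cast; ring
    rw [this, HahnSeries.coeff_add, (hy.natCast_mul 2) _ (by omega), add_zero]
    exact hD0
  refine vanishesBelow_of_mul_add_mul_dLambda (m := -2 * g + -(2 * g + 1))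
    (f := B * (2 * y - P) - HahnSeries.C hbar * dLambda B) (h := HahnSeries.C hbar * B) ?_ ?_ ?_ ?_
  · exact (hB.mul h2y).sub ((hB.dLambda.C_mul hbar).mono (by omega))
  · rw [HahnSeries.coeff_sub, coeff_mul_add_of_vanishesBelow hB h2y,
      (hB.dLambda.C_mul hbar) _ (by omega), sub_zero]
    exact mul_ne_zero hB0 h2y0
  · exact (hB.C_mul hbar).mono (by omega)
  · have hid : (B * (2 * y - P) - HahnSeries.C hbar * dLambda B) * (D' - y') +
        HahnSeries.C hbar * B * dLambda (D' - y') =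
        (B' * (D ^ 2 - P * D) + B * (2 * D * D' - P' * D - P * D') + N' +
          HahnSeries.C hbar * (B' * dLambda D + B * dLambda D' - dLambda B' * D - dLambda B * D')) +
        (B * ((2 * D' - P') * (y - D)) + B' * ((2 * D - P + (y - D)) * (y - D)) +
          HahnSeries.C hbar * (B' * dLambda (y - D) - dLambda B' * (y - D))) := by
      rw [dLambda_sub, dLambda_sub]
      linear_combination -e
    rw [hid]
    refine (hr.mono (by omega)).add (VanishesBelow.add (VanishesBelow.add ?_ ?_)
      (VanishesBelow.C_mul (VanishesBelow.sub ?_ ?_) _))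
    · exact (hB.mul (hD'.mul hy)).mono (by omega)
    · exact (hB'.mul ((hD.add (hy.mono (by omega))).mul hy)).mono (by omega)
    · exact (hB'.mul hy.dLambda).mono (by omega)
    · exact (hB'.dLambda.mul hy).mono (by omega)

theorem two_mul_slope_sub_P1 {g : ℕ} (t : Times g) {ε : ℂ} (hε : ε = 1 ∨ ε = -1) :
    VanishesBelow (-(2 * g + 1)) (2 * slope t ε - toSeries (P1 t)) ∧
      (coord t (2 * g + 3) ≠ 0 →
        (2 * slope t ε - toSeries (P1 t)).coeff (-(2 * g + 1)) ≠ 0) := by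
  have h0 := slope_sub_coeff t 0
  simp only [Nat.cast_zero, mul_zero, add_zero, zero_le, if_true, Nat.sub_zero] at h0
  rw [toSeries_P1]
  rcases hε with rfl | rfl
  · rw [show 2 * slope t 1 - (slope t 1 + slope t (-1)) = slope t 1 - slope t (-1) by ring]
    exact ⟨vanishesBelow_slope_sub t, fun h => by rw [h0]; exact neg_ne_zero.2 h⟩
  · rw [show 2 * slope t (-1) - (slope t 1 + slope t (-1)) = -(slope t 1 - slope t (-1)) by ring]
    refine ⟨(vanishesBelow_slope_sub t).neg, fun h => ?_⟩
    rw [HahnSeries.coeff_neg, h0, neg_neg]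
    exact h

/-- The zero curvature equation `L' = ħ ∂_λ A + [A, L]`. -/
def ZeroCurvature (hbar : ℂ) (L L' A : Matrix (Fin 2) (Fin 2) ℂ[X]) : Prop :=
  ∀ i j, L' i j = C hbar * derivative (A i j) + (A * L - L * A) i j

/-- The polynomial `P₁` is linear in the times. -/
theorem hasDerivAt_P1_coeff {g : ℕ} (t β : Times g) (n : ℕ) :
    HasDerivAt (fun s : ℂ => (P1 (t + s • β)).coeff n) ((P1 β).coeff n) 0 := by
  have h : ∀ τ : Times g, (P1 τ).coeff n = if n < g + 2 then -coord τ (2 * n + 2) else 0 := by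
    intro τ
    rw [P1, coeff_neg, finsetSum_coeff]
    simp only [coeff_C_mul, coeff_X_pow, mul_ite, mul_one, mul_zero, Finset.sum_ite_eq,
      Finset.mem_range]
    split_ifs <;> simp
  simp only [h]
  split_ifs
  · simp only [coord_add, coord_smul]
    simpa using (((hasDerivAt_id (0 : ℂ)).mul_const (coord β (2 * n + 2))).const_add
      (coord t (2 * n + 2))).fun_neg
  · exact hasDerivAt_const _ _

/-- Along an isomonodromic family, `A₁₁ + A₁₂ ξ` is the logarithmic derivative, in the direction of
the deformation, of the first component of the formal solution of slope `ξ`. Its polar part is that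
of the derivative of the exponent. -/
theorem IsFormalSlope.coeff_deformation {g : ℕ} {hbar : ℂ} (hhbar : hbar ≠ 0) {t α : Times g}
    {L : ℂ → Matrix (Fin 2) (Fin 2) ℂ[X]} {L' A : Matrix (Fin 2) (Fin 2) ℂ[X]}
    (hL : ∀ᶠ s : ℂ in 𝓝 0, IsNormalized hbar (t + s • hbar • α) (L s))
    (hL' : ∀ i j n, HasDerivAt (fun s => (L s i j).coeff n) ((L' i j).coeff n) 0)
    (hA : ZeroCurvature hbar (L 0) L' A) {ε : ℂ} (hε : ε = 1 ∨ ε = -1) {ξ : LaurentSeries ℂ}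
    (hξ : IsFormalSlope hbar (L 0) t ε ξ) {k : ℕ} (hk : k ≠ 0) :
    (toSeries (A 0 0) + toSeries (A 0 1) * ξ).coeff (-(k : ℤ)) = -(ε ^ k * coord α k / k) := by
  have hL0 : IsNormalized hbar t (L 0) := by simpa using hL.self_of_nhds
  have hser : ∀ i j, HasCoeffDerivAt (fun s => toSeries (L s i j)) (toSeries (L' i j)) 0 :=
    fun i j => HasCoeffDerivAt.toSeries (hL.mono fun s hs => hs.natDegree_le i j) (hL' i j)
  have hBfam : ∀ᶠ s in 𝓝 (0 : ℂ), VanishesBelow (-2 * g) (toSeries (L s 0 1)) :=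
    hL.mono fun s hs => vanishesBelow_toSeries hs.natDegree_upper_right.le
  have hPfam : HasCoeffDerivAt (fun s : ℂ => toSeries (P1 (t + s • hbar • α)))
      (toSeries (P1 (hbar • α))) 0 :=
    HasCoeffDerivAt.toSeries (Eventually.of_forall fun s => P1_natDegree_le _)
      (hasDerivAt_P1_coeff t _)
  have hDfam := hasCoeffDerivAt_slope t (hbar • α) ε
  obtain ⟨N', hN', hNfam⟩ : ∃ N', N' = toSeries (L' 0 1) * (toSeries (L 0 0 0) * toSeries (L 0 1 1) -
          toSeries (L 0 0 1) * toSeries (L 0 1 0)) +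
        toSeries (L 0 0 1) * (toSeries (L' 0 0) * toSeries (L 0 1 1) +
          toSeries (L 0 0 0) * toSeries (L' 1 1) - (toSeries (L' 0 1) * toSeries (L 0 1 0) +
          toSeries (L 0 0 1) * toSeries (L' 1 0))) +
        HahnSeries.C hbar * (toSeries (L' 0 0) * dLambda (toSeries (L 0 0 1)) +
          toSeries (L 0 0 0) * dLambda (toSeries (L' 0 1)) -
          (dLambda (toSeries (L' 0 0)) * toSeries (L 0 0 1) +
            dLambda (toSeries (L 0 0 0)) * toSeries (L' 0 1))) ∧
      HasCoeffDerivAt (fun s => toSeries (companionNumerator hbar (L s))) N' 0 := by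
    refine ⟨_, rfl, ?_⟩
    simp only [companionNumerator, map_add, map_mul, map_sub, toSeries_C, ← dLambda_toSeries]
    exact ((hser 0 1).mul (((hser 0 0).mul (hser 1 1)).sub ((hser 0 1).mul (hser 1 0)))).add
      ((((hser 0 0).mul (hser 0 1).dLambda).sub ((hser 0 0).dLambda.mul (hser 0 1))).const_mul hbar)
  have hFfam := (((hser 0 1).mul ((hDfam.mul hDfam).sub (hPfam.mul hDfam))).add hNfam).add
    ((((hser 0 1).mul hDfam.dLambda).sub ((hser 0 1).dLambda.mul hDfam)).const_mul hbar)
  -- The defect of `slope` in the quadratic equation is small along the whole family, hence so is its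
  -- derivative, which is the defect in the linearized equation.
  have hFsmall := hFfam.vanishesBelow (N := 1 - 4 * g) (by
    filter_upwards [hL] with s hs
    obtain ⟨η, hη⟩ := hs.exists_isFormalSlope hε
    have h := vanishesBelow_quadratic_slope
      (vanishesBelow_toSeries hs.natDegree_upper_right.le) (two_mul_slope_sub_P1 _ hε).1
      hη.asymptotic (hη.quadratic hs.trace)
    simpa only [sq] using h)
  simp only [zero_smul, add_zero] at hFsmall
  have htr := hL0.trace
  have hB0 : (toSeries (L 0 0 1)).coeff (-2 * g) ≠ 0 := by
    rw [toSeries_coeff_neg_two_mul, ← hL0.natDegree_upper_right, hL0.monic_upper_right.coeff_natDegree]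
    exact one_ne_zero
  have htr' : P1 (hbar • α) = L' 0 0 + L' 1 1 := by
    ext n
    refine HasDerivAt.unique (hasDerivAt_P1_coeff t (hbar • α) n) ?_
    rw [coeff_add]
    refine ((hL' 0 0 n).fun_add (hL' 1 1 n)).congr_of_eventuallyEq ?_
    filter_upwards [hL] with s hs
    rw [← hs.trace, coeff_add]
  have key := vanishesBelow_sub_of_linearized (hbar := hbar) (B := toSeries (L 0 0 1))
    (P := toSeries (P1 t)) (D := slope t ε) (y := toSeries (L 0 0 0) + toSeries (L 0 0 1) * ξ)
    (B' := toSeries (L' 0 1)) (P' := toSeries (P1 (hbar • α))) (D' := slope (hbar • α) ε)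
    (y' := HahnSeries.C hbar * dLambda (toSeries (A 0 0) + toSeries (A 0 1) * ξ))
    (vanishesBelow_toSeries hL0.natDegree_upper_right.le) hB0
    ((hser 0 1).vanishesBelow hBfam) (two_mul_slope_sub_P1 _ hε).1
    ((two_mul_slope_sub_P1 _ hε).2 hL0.twisted) (two_mul_slope_sub_P1 _ hε).1 hξ.asymptotic
    (N' := N') ?_ (by convert hFsmall using 1; ring)
  · rw [slope_smul, ← mul_sub] at key
    have h2 := key.C_mul hbar⁻¹
    rw [← mul_assoc, ← map_mul, inv_mul_cancel₀ hhbar, map_one, one_mul] at h2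
    have h3 := h2 (2 - k) (by omega)
    rw [HahnSeries.coeff_sub, sub_eq_zero, slope_coeff] at h3
    rw [coeff_eq_of_dLambda_coeff (by omega), show -(k : ℤ) + 2 = 2 - k by ring, ← h3,
      show (2 - (2 - (k : ℤ))).toNat = k by omega]
    have : (k : ℂ) ≠ 0 := by exact_mod_cast hk
    push_cast
    field_simp
  · have hr := hξ.riccati
    rw [← HahnSeries.C_mul_eq_smul] at hr
    have h00 := congrArg toSeries (hA 0 0)
    have h01 := congrArg toSeries (hA 0 1)
    have h10 := congrArg toSeries (hA 1 0)
    have h11 := congrArg toSeries (hA 1 1)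
    simp only [Matrix.sub_apply, Matrix.mul_apply, Fin.sum_univ_two, map_add, map_mul, map_sub,
      toSeries_C, ← dLambda_toSeries] at h00 h01 h10 h11
    -- By zero curvature, `ħ ∂_λ (A₁₁ + A₁₂ ξ)` is the deformation `L₁₁' + L₁₂' ξ + L₁₂ ξ'` of `y`, with
    -- `ξ'` the infinitesimal action of `A` on slopes.
    have hy' : HahnSeries.C hbar * dLambda (toSeries (A 0 0) + toSeries (A 0 1) * ξ) =
        toSeries (L' 0 0) + toSeries (L' 0 1) * ξ + toSeries (L 0 0 1) * (toSeries (A 1 0) +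
          (toSeries (A 1 1) - toSeries (A 0 0)) * ξ - toSeries (A 0 1) * ξ ^ 2) := by
      rw [dLambda_add, dLambda_mul]
      linear_combination -h00 - ξ * h01 + toSeries (A 0 1) * hr
    rw [hy', ← htr, htr', hN', map_add, map_add]
    simp only [dLambda_add, dLambda_sub, dLambda_mul, sq]
    linear_combination (2 * toSeries (L 0 0 1) * toSeries (L' 0 1) + toSeries (L 0 0 1) ^ 2 *
      (toSeries (A 1 1) - toSeries (A 0 0) - 2 * toSeries (A 0 1) * ξ)) * hr +
      toSeries (L 0 0 1) ^ 2 * (ξ * h00 - ξ * h11 - h10 + ξ ^ 2 * h01)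

/-! ### Analysis -/

/-- Symmetry of the mixed second derivatives of an analytic function of two variables. -/
theorem hasDerivAt_deriv_swap {f : ℂ × ℂ → ℂ} {x s₀ : ℂ} (hf : AnalyticAt ℂ f (x, s₀)) :
    HasDerivAt (fun s => deriv (fun y => f (y, s)) x)
      (deriv (fun y => deriv (fun s => f (y, s)) s₀) x) s₀ := by
  have hev : ∀ᶠ z in 𝓝 (x, s₀), DifferentiableAt ℂ f z :=
    hf.eventually_analyticAt.mono fun z hz => hz.differentiableAt
  have hf' : HasFDerivAt (fderiv ℂ f) (fderiv ℂ (fderiv ℂ f) (x, s₀)) (x, s₀) :=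
    hf.fderiv.differentiableAt.hasFDerivAt
  have hsymm : fderiv ℂ (fderiv ℂ f) (x, s₀) (0, 1) (1, 0) =
      fderiv ℂ (fderiv ℂ f) (x, s₀) (1, 0) (0, 1) :=
    (hf.contDiffAt (n := ⊤)).isSymmSndFDerivAt (by simp) (0, 1) (1, 0)
  have hline₁ : ∀ s, HasDerivAt (fun y : ℂ => (y, s)) ((1 : ℂ), (0 : ℂ)) x := fun s =>
    (hasDerivAt_id x).prodMk (hasDerivAt_const x s)
  have hline₂ : ∀ y, HasDerivAt (fun s : ℂ => (y, s)) ((0 : ℂ), (1 : ℂ)) s₀ := fun y =>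
    (hasDerivAt_const s₀ y).prodMk (hasDerivAt_id s₀)
  have e₁ : (fun s => deriv (fun y => f (y, s)) x) =ᶠ[𝓝 s₀] fun s => fderiv ℂ f (x, s) (1, 0) := by
    filter_upwards [(hline₂ x).continuousAt.eventually hev] with s hs
    exact (hs.hasFDerivAt.comp_hasDerivAt x (hline₁ s)).deriv
  have e₂ : (fun y => deriv (fun s => f (y, s)) s₀) =ᶠ[𝓝 x] fun y => fderiv ℂ f (y, s₀) (0, 1) := by
    filter_upwards [(hline₁ s₀).continuousAt.eventually hev] with y hy
    exact (hy.hasFDerivAt.comp_hasDerivAt s₀ (hline₂ y)).deriv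
  rw [e₂.deriv_eq]
  refine HasDerivAt.congr_of_eventuallyEq ?_ e₁
  have hv : ∀ v, HasFDerivAt (fun z => fderiv ℂ f z v)
      ((fderiv ℂ (fderiv ℂ f) (x, s₀)).flip v) (x, s₀) := fun v =>
    (ContinuousLinearMap.apply ℂ ℂ v).hasFDerivAt.comp (x, s₀) hf'
  have h₁ := (hv (1, 0)).comp_hasDerivAt s₀ (hline₂ x)
  have h₂ := ((hv (0, 1)).comp_hasDerivAt x (hline₁ s₀)).deriv
  rw [ContinuousLinearMap.flip_apply] at h₁ h₂
  rw [Function.comp_def] at h₁ h₂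
  rw [h₂, ← hsymm]
  exact h₁

/-- A function which vanishes at a point and is differentiable there stays so after multiplication
by a function which is merely continuous at this point. -/
theorem hasFDerivAt_mul_of_eq_zero {E : Type*} [NormedAddCommGroup E]
    [NormedSpace ℂ E] {u v : E → ℂ} {u' : E →L[ℂ] ℂ} {t : E} (hu : HasFDerivAt u u' t)
    (hu0 : u t = 0) (hv : ContinuousAt v t) : HasFDerivAt (fun s => u s * v s) (v t • u') t := by
  have h := hu.isLittleO
  rw [hasFDerivAt_iff_isLittleO]
  have hO : (fun s => u' (s - t)) =O[𝓝 t] fun s => s - t :=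
    ContinuousLinearMap.isBigO_sub _ _ _
  have hv1 : v =O[𝓝 t] fun _ => (1 : ℝ) := hv.isBigO_one ℝ
  have hv2 : (fun s => v s - v t) =o[𝓝 t] fun _ => (1 : ℝ) := by
    rw [isLittleO_one_iff]
    simpa using hv.tendsto.sub_const (v t)
  have h1 := h.norm_right.mul_isBigO hv1
  have h2 := hO.norm_right.mul_isLittleO hv2
  simp only [mul_one] at h1 h2
  refine ((h1.add h2).of_norm_right).congr_left fun s => ?_
  simp only [hu0, zero_mul, sub_zero, smul_apply, smul_eq_mul]
  ring

/-- The coefficients of a polynomial of bounded degree are linear combinations of its values at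
fixed points, by Lagrange interpolation. -/
theorem differentiableAt_coeff {E : Type*} [NormedAddCommGroup E] [NormedSpace ℂ E]
    {P : E → ℂ[X]} {t : E} {d : ℕ} (hd : ∀ᶠ s in 𝓝 t, (P s).natDegree ≤ d)
    (hP : ∀ x, DifferentiableAt ℂ (fun s => (P s).eval x) t) (n : ℕ) :
    DifferentiableAt ℂ (fun s => (P s).coeff n) t := by
  have hinj : Set.InjOn (fun i : ℕ => (i : ℂ)) (Finset.range (d + 1) : Set ℕ) :=
    Nat.cast_injective.injOn
  have hev : (fun s => (P s).coeff n) =ᶠ[𝓝 t] fun s => ∑ i ∈ Finset.range (d + 1),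
      (P s).eval (i : ℂ) * (Lagrange.basis (Finset.range (d + 1)) (fun i : ℕ => (i : ℂ)) i).coeff n := by
    filter_upwards [hd] with s hs
    have h := Lagrange.eq_interpolate hinj (f := P s) (by
      rw [Finset.card_range]
      exact (degree_le_of_natDegree_le hs).trans_lt (by exact_mod_cast Nat.lt_succ_self d))
    conv_lhs => rw [h, Lagrange.interpolate_apply, finsetSum_coeff]
    simp only [coeff_C_mul]
  refine DifferentiableAt.congr_of_eventuallyEq ?_ hev
  exact DifferentiableAt.fun_sum fun i _ => (hP i).mul_const _

theorem hasDerivAt_eval {P : ℂ → ℂ[X]} {P' : ℂ[X]} {d : ℕ} {s₀ : ℂ}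
    (hd : ∀ᶠ s in 𝓝 s₀, (P s).natDegree ≤ d)
    (hP : ∀ n, HasDerivAt (fun s => (P s).coeff n) (P'.coeff n) s₀) {q : ℂ → ℂ} {q' : ℂ}
    (hq : HasDerivAt q q' s₀) :
    HasDerivAt (fun s => (P s).eval (q s))
      (P'.eval (q s₀) + (derivative (P s₀)).eval (q s₀) * q') s₀ := by
  have hd' : P'.natDegree ≤ d := by
    rw [natDegree_le_iff_coeff_eq_zero]
    intro n hn
    refine (hP n).unique ((hasDerivAt_const s₀ (0 : ℂ)).congr_of_eventuallyEq ?_)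
    exact hd.mono fun s hs => coeff_eq_zero_of_natDegree_lt (hs.trans_lt hn)
  have hev : (fun s => (P s).eval (q s)) =ᶠ[𝓝 s₀] fun s => ∑ n ∈ Finset.range (d + 1),
      (P s).coeff n * q s ^ n := by
    filter_upwards [hd] with s hs using eval_eq_sum_range' (Nat.lt_succ_of_le hs) _
  refine HasDerivAt.congr_of_eventuallyEq ?_ hev
  have hsum : (derivative (P s₀)).eval (q s₀) =
      ∑ n ∈ Finset.range (d + 1), (P s₀).coeff n * (n * q s₀ ^ (n - 1)) := by
    rw [derivative_eval, sum_over_range' _ (by simp) _ (Nat.lt_succ_of_le hd.self_of_nhds)]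
    simp only [mul_assoc]
  rw [eval_eq_sum_range' (Nat.lt_succ_of_le hd'), hsum, Finset.sum_mul, ← Finset.sum_add_distrib]
  refine (HasDerivAt.fun_sum fun n _ => (hP n).fun_mul (hq.fun_pow n)).congr_deriv ?_
  exact Finset.sum_congr rfl fun n _ => by ring

/-- The operator `𝓛_α` is the derivative along the line through `t` with direction `ħ α`. -/
theorem hasDerivAt_deform {g : ℕ} (hbar : ℂ) (α : Times g) {f : Times g → ℂ} {t : Times g}
    (hf : DifferentiableAt ℂ f t) :
    HasDerivAt (fun s : ℂ => f (t + s • hbar • α)) (deform hbar α f t) 0 := by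
  have hγ : HasDerivAt (fun s : ℂ => t + s • hbar • α) (hbar • α) 0 := by
    simpa using ((hasDerivAt_id (0 : ℂ)).smul_const (hbar • α)).const_add t
  have h := HasFDerivAt.comp_hasDerivAt (0 : ℂ) (l := f) (f := fun s : ℂ => t + s • hbar • α)
    (by simpa using hf.hasFDerivAt) hγ
  refine h.congr_deriv (Eq.symm ?_)
  rw [deform, map_smul, smul_eq_mul, ← ContinuousLinearMap.coe_coe, LinearMap.pi_apply_eq_sum_univ]
  congr 1
  refine Finset.sum_congr rfl fun k _ => ?_
  rw [smul_eq_mul]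
  congr 2
  ext i
  simp [Pi.single_apply, eq_comm]

/-! ### Isomonodromic families -/

section Isomonodromic

variable {g : ℕ} {hbar : ℂ} {U : Set (Times g)} {L : Times g → Matrix (Fin 2) (Fin 2) ℂ[X]}
  {Psi : ℂ → Times g → Matrix (Fin 2) (Fin 2) ℂ} {t : Times g}

theorem eventually_curve (hU : IsOpen U) (ht : t ∈ U) (β : Times g) :
    ∀ᶠ s : ℂ in 𝓝 0, t + s • β ∈ U := by
  have hc : ContinuousAt (fun s : ℂ => t + s • β) 0 := by fun_prop
  exact hc.eventually (by simpa using hU.mem_nhds ht)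

theorem IsIsomonodromic.differentiableAt_wave (h : IsIsomonodromic hbar U L Psi) (ht : t ∈ U)
    (x : ℂ) (i j : Fin 2) : DifferentiableAt ℂ (fun s => Psi x s i j) t :=
  ((h.analytic i j (x, t) ⟨trivial, ht⟩).differentiableAt).comp t
    ((differentiableAt_const x).prodMk differentiableAt_id)

theorem IsIsomonodromic.differentiableAt_wave_left (h : IsIsomonodromic hbar U L Psi) (ht : t ∈ U)
    (x : ℂ) (i j : Fin 2) : DifferentiableAt ℂ (fun y => Psi y t i j) x :=
  DifferentiableAt.comp (g := fun z : ℂ × Times g => Psi z.1 z.2 i j) (f := fun y => (y, t)) x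
    (h.analytic i j (x, t) ⟨trivial, ht⟩).differentiableAt
    (differentiableAt_id.prodMk (differentiableAt_const t))

theorem IsIsomonodromic.differentiableAt_deriv_wave (h : IsIsomonodromic hbar U L Psi)
    (hU : IsOpen U) (ht : t ∈ U) (x : ℂ) (i j : Fin 2) :
    DifferentiableAt ℂ (fun s => deriv (fun y => Psi y s i j) x) t := by
  have hline : DifferentiableAt ℂ (fun s : Times g => (x, s)) t :=
    (differentiableAt_const x).prodMk differentiableAt_id
  have h1 : DifferentiableAt ℂ (fun s : Times g =>
      fderiv ℂ (fun z : ℂ × Times g => Psi z.1 z.2 i j) (x, s) (1, 0)) t :=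
    ((ContinuousLinearMap.apply ℂ ℂ ((1 : ℂ), (0 : Times g))).differentiableAt.comp (x, t)
      (h.analytic i j (x, t) ⟨trivial, ht⟩).fderiv.differentiableAt).comp t hline
  refine h1.congr_of_eventuallyEq ?_
  filter_upwards [hU.mem_nhds ht] with s hs
  exact ((h.analytic i j (x, s) ⟨trivial, hs⟩).differentiableAt.hasFDerivAt.comp_hasDerivAt x
    ((hasDerivAt_id x).prodMk (hasDerivAt_const x s))).deriv

theorem IsIsomonodromic.differentiableAt_coeff (h : IsIsomonodromic hbar U L Psi) (hU : IsOpen U)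
    (ht : t ∈ U) (i j : Fin 2) (n : ℕ) : DifferentiableAt ℂ (fun s => (L s i j).coeff n) t := by
  refine TwistedPainleve.differentiableAt_coeff (d := g + 1) ?_ ?_ n
  · filter_upwards [hU.mem_nhds ht] with s hs using (h.normalized s hs).natDegree_le i j
  intro x
  have hev : (fun s => (L s i j).eval x) =ᶠ[𝓝 t] fun s =>
      (∑ k, hbar * deriv (fun y => Psi y s i k) x * (Psi x s).adjugate k j) / (Psi x s).det := by
    filter_upwards [hU.mem_nhds ht] with s hs
    rw [eq_div_iff (h.det_ne_zero x s hs)]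
    have h1 : (evalMat (L s) x * Psi x s * (Psi x s).adjugate) i j =
        (L s i j).eval x * (Psi x s).det := by
      rw [Matrix.mul_assoc, Matrix.mul_adjugate, Matrix.mul_smul, Matrix.mul_one, mul_comm]
      rfl
    rw [← h1, Matrix.mul_apply]
    simp only [h.spectral x s hs]
  refine DifferentiableAt.congr_of_eventuallyEq ?_ hev
  have hΨ := h.differentiableAt_wave ht x
  have hadj : ∀ k, DifferentiableAt ℂ (fun s => (Psi x s).adjugate k j) t := by
    intro k
    simp only [Matrix.adjugate_fin_two]
    fin_cases k <;> fin_cases j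
    exacts [hΨ 1 1, (hΨ 0 1).neg, (hΨ 1 0).neg, hΨ 0 0]
  have hdet : DifferentiableAt ℂ (fun s => (Psi x s).det) t := by
    simp only [Matrix.det_fin_two]
    exact ((hΨ 0 0).fun_mul (hΨ 1 1)).fun_sub ((hΨ 0 1).fun_mul (hΨ 1 0))
  simp only [div_eq_mul_inv]
  refine DifferentiableAt.fun_mul (DifferentiableAt.fun_sum fun k _ => ?_)
    (hdet.fun_inv (h.det_ne_zero x t ht))
  exact ((h.differentiableAt_deriv_wave hU ht x i k).const_mul hbar).fun_mul (hadj k)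

/-- The deformation of a family of polynomials of degree at most `d`, coefficient by coefficient. The
bound `d` makes the sum finite; coefficients above it are ignored. -/
noncomputable def deformPolynomial (hbar : ℂ) (α : Times g) (d : ℕ) (P : Times g → ℂ[X])
    (t : Times g) : ℂ[X] :=
  ∑ n ∈ Finset.range (d + 1), monomial n (deform hbar α (fun s => (P s).coeff n) t)

theorem IsIsomonodromic.hasDerivAt_coeff (h : IsIsomonodromic hbar U L Psi) (hU : IsOpen U)
    (ht : t ∈ U) (α : Times g) (i j : Fin 2) (n : ℕ) :
    HasDerivAt (fun s : ℂ => (L (t + s • hbar • α) i j).coeff n)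
      ((deformPolynomial hbar α (g + 1) (fun s => L s i j) t).coeff n) 0 := by
  rw [deformPolynomial, finsetSum_coeff]
  simp only [coeff_monomial, Finset.sum_ite_eq', Finset.mem_range]
  split_ifs with hn
  · exact hasDerivAt_deform hbar α (h.differentiableAt_coeff hU ht i j n)
  · refine (hasDerivAt_const _ (0 : ℂ)).congr_of_eventuallyEq ?_
    filter_upwards [eventually_curve hU ht (hbar • α)] with s hs
    exact coeff_eq_zero_of_natDegree_lt (((h.normalized _ hs).natDegree_le i j).trans_lt (by omega))

theorem evalMat_apply (A : Matrix (Fin 2) (Fin 2) ℂ[X]) (x : ℂ) (i j : Fin 2) :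
    evalMat A x i j = (A i j).eval x := rfl

theorem IsIsomonodromic.exists_deformation (h : IsIsomonodromic hbar U L Psi) (ht : t ∈ U)
    (α : Times g) : ∃ A : Matrix (Fin 2) (Fin 2) ℂ[X], ∀ x i j,
      deform hbar α (fun s => Psi x s i j) t = (evalMat A x * Psi x t) i j := by
  choose A hA using h.deformation t ht
  refine ⟨Matrix.of fun i j => ∑ k, C (α k) * A k i j, fun x i j => ?_⟩
  rw [deform, Finset.mul_sum, Matrix.mul_apply]
  simp only [evalMat_apply, Matrix.of_apply, eval_finsetSum, eval_mul, eval_C, Finset.sum_mul]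
  rw [Finset.sum_comm]
  refine Finset.sum_congr rfl fun k _ => ?_
  rw [mul_left_comm, hA, Matrix.mul_apply, Finset.mul_sum]
  simp only [evalMat_apply, mul_assoc]

/-- Compatibility of the spectral and the deformation equations of the wave matrix. -/
theorem IsIsomonodromic.zeroCurvature (h : IsIsomonodromic hbar U L Psi) (hU : IsOpen U)
    (ht : t ∈ U) (α : Times g) {A : Matrix (Fin 2) (Fin 2) ℂ[X]}
    (hA : ∀ x i j, deform hbar α (fun s => Psi x s i j) t = (evalMat A x * Psi x t) i j) :
    ZeroCurvature hbar (L t)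
      (Matrix.of fun i j => deformPolynomial hbar α (g + 1) (fun s => L s i j) t) A := by
  set L' : Matrix (Fin 2) (Fin 2) ℂ[X] :=
    Matrix.of fun i j => deformPolynomial hbar α (g + 1) (fun s => L s i j) t with hL'
  have hL'coeff : ∀ i j n, HasDerivAt (fun s : ℂ => (L (t + s • hbar • α) i j).coeff n)
      ((L' i j).coeff n) 0 := h.hasDerivAt_coeff hU ht α
  have hcurve := eventually_curve hU ht (hbar • α)
  have hwave : ∀ y i j, HasDerivAt (fun s : ℂ => Psi y (t + s • hbar • α) i j)
      ((evalMat A y * Psi y t) i j) 0 := fun y i j => by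
    rw [← hA]
    exact hasDerivAt_deform hbar α (h.differentiableAt_wave ht y i j)
  have hspec : ∀ x i j, hbar * deriv (fun y => Psi y t i j) x = (evalMat (L t) x * Psi x t) i j :=
    fun x i j => h.spectral x t ht i j
  have hLeval : ∀ x i j, HasDerivAt (fun s : ℂ => (L (t + s • hbar • α) i j).eval x)
      ((L' i j).eval x) 0 := fun x i j => by
    have h1 := hasDerivAt_eval (d := g + 1)
      (hcurve.mono fun s hs => (h.normalized _ hs).natDegree_le i j)
      (hL'coeff i j) (hasDerivAt_const (0 : ℂ) x)
    simpa using h1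
  -- Both sides of `L' Ψ = (ħ ∂_λ A + [A, L]) Ψ` come from the mixed second derivative of `Ψ`.
  have hmat : ∀ x, (evalMat L' x - (hbar • evalMat (A.map derivative) x +
      (evalMat A x * evalMat (L t) x - evalMat (L t) x * evalMat A x))) * Psi x t = 0 := by
    intro x
    ext i j
    have han : AnalyticAt ℂ (fun z : ℂ × ℂ => Psi z.1 (t + z.2 • hbar • α) i j) (x, 0) := by
      have h1 := h.analytic i j (x, t) ⟨trivial, ht⟩
      have h2 : AnalyticAt ℂ (fun z : ℂ × ℂ => (z.1, t + z.2 • hbar • α)) (x, 0) :=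
        analyticAt_fst.prod (analyticAt_const.add (analyticAt_snd.smul analyticAt_const))
      exact AnalyticAt.fun_comp (by simpa using h1) h2
    have hswap := (hasDerivAt_deriv_swap han).const_mul hbar
    have hderiv : (fun y => deriv (fun s : ℂ => Psi y (t + s • hbar • α) i j) 0) =
        fun y => ∑ k, (A i k).eval y * Psi y t k j := by
      funext y
      rw [(hwave y i j).deriv, Matrix.mul_apply]
      rfl
    simp only [hderiv] at hswap
    have hd1 : HasDerivAt (fun y => ∑ k, (A i k).eval y * Psi y t k j)
        (∑ k, ((derivative (A i k)).eval x * Psi x t k j +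
          (A i k).eval x * deriv (fun y => Psi y t k j) x)) x :=
      HasDerivAt.fun_sum fun k _ => ((A i k).hasDerivAt x).fun_mul
        (h.differentiableAt_wave_left ht x k j).hasDerivAt
    rw [hd1.deriv] at hswap
    have hother : HasDerivAt (fun s : ℂ => hbar * deriv (fun y => Psi y (t + s • hbar • α) i j) x)
        (∑ k, ((L' i k).eval x * Psi x t k j +
          (L t i k).eval x * (evalMat A x * Psi x t) k j)) 0 := by
      have h1 : HasDerivAt (fun s : ℂ => ∑ k, (L (t + s • hbar • α) i k).eval x *
          Psi x (t + s • hbar • α) k j) (∑ k, ((L' i k).eval x * Psi x t k j +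
          (L t i k).eval x * (evalMat A x * Psi x t) k j)) 0 := by
        refine (HasDerivAt.fun_sum fun k _ => (hLeval x i k).fun_mul (hwave x k j)).congr_deriv ?_
        simp
      refine h1.congr_of_eventuallyEq ?_
      filter_upwards [hcurve] with s hs
      rw [h.spectral x _ hs, Matrix.mul_apply]
      rfl
    have huniq := hswap.unique hother
    have hspec0 := hspec x 0 j
    have hspec1 := hspec x 1 j
    simp only [Matrix.mul_apply, Matrix.sub_apply, Matrix.add_apply, Matrix.smul_apply,
      Fin.sum_univ_two, evalMat_apply, Matrix.map_apply, smul_eq_mul, Matrix.zero_apply]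
      at huniq hspec0 hspec1 ⊢
    linear_combination -huniq + (A i 0).eval x * hspec0 + (A i 1).eval x * hspec1
  intro i j
  refine Polynomial.funext fun x => ?_
  have hinv := h.det_ne_zero x t ht
  have h0 : evalMat L' x - (hbar • evalMat (A.map derivative) x +
      (evalMat A x * evalMat (L t) x - evalMat (L t) x * evalMat A x)) = 0 := by
    have h1 := congrArg (· * (Psi x t)⁻¹) (hmat x)
    simpa only [Matrix.mul_assoc, Matrix.mul_nonsing_inv _ hinv.isUnit, Matrix.mul_one,
      Matrix.zero_mul] using h1
  have h1 := congrFun (congrFun h0 i) j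
  simp only [Matrix.mul_apply, Matrix.sub_apply, Matrix.add_apply, Matrix.smul_apply,
      Fin.sum_univ_two, evalMat_apply, Matrix.map_apply, smul_eq_mul, Matrix.zero_apply] at h1
  simp only [Matrix.mul_apply, Matrix.sub_apply, Fin.sum_univ_two, eval_add, eval_sub, eval_mul,
    eval_C]
  linear_combination h1

/-! ### Darboux coordinates -/

variable {q p : Times g → Fin g → ℂ}

theorem IsDarboux.upper_right_eq (hqp : IsDarboux U L q p) (h : IsIsomonodromic hbar U L Psi)
    (ht : t ∈ U) : L t 0 1 = ∏ j, (X - C (q t j)) := by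
  have hm := (h.normalized t ht).monic_upper_right
  have hdeg := (h.normalized t ht).natDegree_upper_right
  have hdvd : ∏ j, (X - C (q t j)) ∣ L t 0 1 :=
    Finset.prod_dvd_of_coprime
      (fun i _ j _ hij => pairwise_coprime_X_sub_C (hqp.injective t ht) hij)
      fun j _ => dvd_iff_isRoot.2 (hqp.zero t ht j)
  refine eq_of_monic_of_dvd_of_natDegree_le (monic_prod_X_sub_C _ _) hm hdvd ?_
  rw [hdeg, natDegree_prod_of_monic _ _ fun j _ => monic_X_sub_C _]
  simp

/-- The zeros of `L₁₂` are simple, so that their continuous branches are differentiable. -/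
theorem IsDarboux.differentiableAt_zero (hqp : IsDarboux U L q p)
    (h : IsIsomonodromic hbar U L Psi) (hU : IsOpen U) (ht : t ∈ U) (j : Fin g) :
    DifferentiableAt ℂ (fun s => q s j) t := by
  have hq : ∀ j, ContinuousAt (fun s => q s j) t := fun j =>
    (continuous_apply j).continuousAt.comp (hqp.continuousOn.continuousAt (hU.mem_nhds ht))
  have hprod : ContinuousAt (fun s => ∏ i ∈ Finset.univ.erase j, (q s j - q t i)) t :=
    tendsto_finsetProd _ fun i _ => (hq j).sub continuousAt_const
  have hprod0 : ∏ i ∈ Finset.univ.erase j, (q t j - q t i) ≠ 0 :=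
    Finset.prod_ne_zero_iff.2 fun i hi =>
      sub_ne_zero.2 fun h0 => Finset.ne_of_mem_erase hi (hqp.injective t ht h0).symm
  -- `L₁₂(t)` at `q_j(s)` is `∏ (q_j(s) - q_i(t))`, whereas `L₁₂(s)` vanishes there.
  have hev : (fun s => q s j) =ᶠ[𝓝 t] fun s => q t j +
      ∑ n ∈ Finset.range (g + 2), ((L t 0 1).coeff n - (L s 0 1).coeff n) *
        (q s j ^ n / ∏ i ∈ Finset.univ.erase j, (q s j - q t i)) := by
    filter_upwards [hU.mem_nhds ht, hprod.eventually_ne hprod0] with s hs hne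
    have h1 : (L t 0 1).eval (q s j) = (q s j - q t j) *
        ∏ i ∈ Finset.univ.erase j, (q s j - q t i) := by
      rw [hqp.upper_right_eq h ht, eval_prod, ← Finset.mul_prod_erase _ _ (Finset.mem_univ j)]
      simp
    have h2 := hqp.zero s hs j
    have hd : ∀ s ∈ U, (L s 0 1).natDegree < g + 2 := fun s hs =>
      ((h.normalized s hs).natDegree_le 0 1).trans_lt (by omega)
    rw [eval_eq_sum_range' (hd t ht)] at h1
    rw [eval_eq_sum_range' (hd s hs)] at h2
    simp only [mul_div_assoc', ← Finset.sum_div, sub_mul, Finset.sum_sub_distrib]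
    rw [h1, h2]
    field_simp
    ring
  refine DifferentiableAt.congr_of_eventuallyEq ?_ hev
  refine (differentiableAt_const _).fun_add (DifferentiableAt.fun_sum fun n _ => ?_)
  exact (hasFDerivAt_mul_of_eq_zero
    ((differentiableAt_const _).fun_sub (h.differentiableAt_coeff hU ht 0 1 n)).hasFDerivAt
    (sub_self _) (((hq j).pow n).div hprod hprod0)).differentiableAt

theorem IsDarboux.differentiableAt_value (hqp : IsDarboux U L q p)
    (h : IsIsomonodromic hbar U L Psi) (hU : IsOpen U) (ht : t ∈ U) (j : Fin g) :
    DifferentiableAt ℂ (fun s => p s j) t := by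
  have hev : (fun s => p s j) =ᶠ[𝓝 t] fun s =>
      ∑ n ∈ Finset.range (g + 2), (L s 0 0).coeff n * q s j ^ n := by
    filter_upwards [hU.mem_nhds ht] with s hs
    rw [hqp.value s hs, eval_eq_sum_range'
      (((h.normalized s hs).natDegree_le 0 0).trans_lt (by omega : g + 1 < g + 2))]
  refine DifferentiableAt.congr_of_eventuallyEq ?_ hev
  exact DifferentiableAt.fun_sum fun n _ => (h.differentiableAt_coeff hU ht 0 0 n).fun_mul
    ((hqp.differentiableAt_zero h hU ht j).fun_pow n)

/-- Differentiating `L₁₂(q_j) = 0` and `p_j = L₁₁(q_j)` along the deformation. -/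
theorem IsDarboux.deform_eq (hqp : IsDarboux U L q p)
    (h : IsIsomonodromic hbar U L Psi) (hU : IsOpen U) (ht : t ∈ U) (α : Times g) (j : Fin g) :
    (deformPolynomial hbar α (g + 1) (fun s => L s 0 1) t).eval (q t j) +
      (derivative (L t 0 1)).eval (q t j) * deform hbar α (fun s => q s j) t = 0 ∧
    deform hbar α (fun s => p s j) t =
      (deformPolynomial hbar α (g + 1) (fun s => L s 0 0) t).eval (q t j) +
      (derivative (L t 0 0)).eval (q t j) * deform hbar α (fun s => q s j) t := by
  have hcurve := eventually_curve hU ht (hbar • α)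
  have hdeg : ∀ i k, ∀ᶠ s : ℂ in 𝓝 0, (L (t + s • hbar • α) i k).natDegree ≤ g + 1 :=
    fun i k => hcurve.mono fun s hs => (h.normalized _ hs).natDegree_le i k
  have hq := hasDerivAt_deform hbar α (hqp.differentiableAt_zero h hU ht j)
  have hp := hasDerivAt_deform hbar α (hqp.differentiableAt_value h hU ht j)
  have h1 := hasDerivAt_eval (hdeg 0 1) (h.hasDerivAt_coeff hU ht α 0 1) hq
  have h2 := hasDerivAt_eval (hdeg 0 0) (h.hasDerivAt_coeff hU ht α 0 0) hq
  simp only [zero_smul, add_zero] at h1 h2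
  refine ⟨h1.unique ((hasDerivAt_const _ (0 : ℂ)).congr_of_eventuallyEq ?_),
    hp.unique (h2.congr_of_eventuallyEq ?_)⟩
  · exact hcurve.mono fun s hs => hqp.zero _ hs j
  · exact hcurve.mono fun s hs => hqp.value _ hs j

end Isomonodromic

/-! ### Partial fractions -/

section PartialFractions

variable {g : ℕ}

/-- The polynomial `∏_{i ≠ j} (λ - q_i)`. -/
noncomputable def omitFactor (q : Fin g → ℂ) (j : Fin g) : ℂ[X] :=
  ∏ i ∈ Finset.univ.erase j, (X - C (q i))

variable (q : Fin g → ℂ)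

theorem X_sub_C_mul_omitFactor (j : Fin g) :
    (X - C (q j)) * omitFactor q j = ∏ i, (X - C (q i)) :=
  Finset.mul_prod_erase Finset.univ (fun i => X - C (q i)) (Finset.mem_univ j)

theorem derivative_prod_X_sub_C : derivative (∏ i, (X - C (q i))) = ∑ j, omitFactor q j := by
  rw [derivative_prod_finset]
  exact Finset.sum_congr rfl fun j _ => by simp [omitFactor]

theorem eval_omitFactor_of_ne {i j : Fin g} (h : i ≠ j) : (omitFactor q i).eval (q j) = 0 := by
  rw [omitFactor, eval_prod]
  exact Finset.prod_eq_zero (Finset.mem_erase.2 ⟨h.symm, Finset.mem_univ j⟩) (by simp)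

theorem eval_derivative_prod (j : Fin g) :
    (derivative (∏ i, (X - C (q i)))).eval (q j) = (omitFactor q j).eval (q j) := by
  rw [derivative_prod_X_sub_C, eval_finsetSum]
  exact Finset.sum_eq_single_of_mem j (Finset.mem_univ j) fun i _ hi => eval_omitFactor_of_ne q hi

variable {q}

theorem eval_omitFactor_ne_zero (hq : Function.Injective q) (j : Fin g) :
    (omitFactor q j).eval (q j) ≠ 0 := by
  rw [omitFactor, eval_prod]
  exact Finset.prod_ne_zero_iff.2 fun i hi => by
    simpa [sub_eq_zero] using fun h0 => Finset.ne_of_mem_erase hi (hq h0).symm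

theorem eval_derivative_omitFactor_of_ne (hq : Function.Injective q) {i j : Fin g} (h : i ≠ j) :
    (derivative (omitFactor q i)).eval (q j) = (omitFactor q j).eval (q j) / (q j - q i) := by
  have hne : q j - q i ≠ 0 := sub_ne_zero.2 fun h0 => h (hq h0).symm
  have h1 := congrArg (fun P => (derivative P).eval (q j)) (X_sub_C_mul_omitFactor q i)
  simp only [eval_derivative_prod, derivative_mul, derivative_sub, derivative_X, derivative_C,
    sub_zero, one_mul, eval_add, eval_mul, eval_sub, eval_X, eval_C, eval_omitFactor_of_ne q h,
    zero_add] at h1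
  rw [eq_div_iff hne, ← h1]
  ring

theorem eval_derivative_omitFactor_self (hq : Function.Injective q) (j : Fin g) :
    (derivative (omitFactor q j)).eval (q j) =
      ∑ i ∈ Finset.univ.erase j, (omitFactor q j).eval (q j) / (q j - q i) := by
  have h1 := congrArg (fun P => (derivative (derivative P)).eval (q j)) (X_sub_C_mul_omitFactor q j)
  have h2 := congrArg (fun P => (derivative P).eval (q j)) (derivative_prod_X_sub_C q)
  simp only [derivative_mul, derivative_add, derivative_sub, derivative_X, derivative_C,
    sub_zero, one_mul, eval_add, eval_mul, eval_sub, eval_X, eval_C, derivative_sum,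
    eval_finsetSum, sub_self, zero_mul, add_zero] at h1 h2
  rw [← h1, ← Finset.add_sum_erase _ _ (Finset.mem_univ j)] at h2
  rw [← Finset.sum_congr rfl fun i hi =>
    eval_derivative_omitFactor_of_ne hq (Finset.ne_of_mem_erase hi)]
  exact add_left_cancel h2

/-- Lagrange interpolation at the nodes `q_j`: the partial fraction decomposition of
`P / ∏_j (λ - q_j)`, with denominators cleared. -/
theorem exists_eq_mul_add_sum_omitFactor (hq : Function.Injective q) (P : ℂ[X]) :
    ∃ Q, P = Q * ∏ i, (X - C (q i)) +
      ∑ j, C (P.eval (q j) / (omitFactor q j).eval (q j)) * omitFactor q j := by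
  have hdvd : ∏ i, (X - C (q i)) ∣
      P - ∑ j, C (P.eval (q j) / (omitFactor q j).eval (q j)) * omitFactor q j := by
    refine Finset.prod_dvd_of_coprime
      (fun i _ j _ hij => pairwise_coprime_X_sub_C hq hij) fun j _ => ?_
    rw [dvd_iff_isRoot, IsRoot, eval_sub, eval_finsetSum,
      Finset.sum_eq_single_of_mem j (Finset.mem_univ j) fun i _ hi => by
        rw [eval_mul, eval_omitFactor_of_ne q hi, mul_zero],
      eval_mul, eval_C, div_mul_cancel₀ _ (eval_omitFactor_ne_zero hq j), sub_self]
  obtain ⟨Q, hQ⟩ := hdvd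
  exact ⟨Q, by rw [mul_comm, ← hQ, sub_add_cancel]⟩

/-- The polynomial `(P(λ) - P(c)) / (λ - c)`. -/
noncomputable def divDiff (P : ℂ[X]) (c : ℂ) : ℂ[X] := P /ₘ (X - C c)

theorem X_sub_C_mul_divDiff (P : ℂ[X]) (c : ℂ) : (X - C c) * divDiff P c = P - C (P.eval c) := by
  rw [divDiff, X_sub_C_mul_divByMonic_eq_sub_modByMonic, modByMonic_X_sub_C_eq_C_eval]

theorem eval_divDiff_self (P : ℂ[X]) (c : ℂ) : (divDiff P c).eval c = (derivative P).eval c := by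
  have h := congrArg (fun P => (derivative P).eval c) (X_sub_C_mul_divDiff P c)
  simpa using h

theorem eval_divDiff_of_ne (P : ℂ[X]) {c x : ℂ} (h : x ≠ c) :
    (divDiff P c).eval x = (P.eval x - P.eval c) / (x - c) := by
  have h1 := congrArg (fun P => P.eval x) (X_sub_C_mul_divDiff P c)
  rw [eq_div_iff (sub_ne_zero.2 h)]
  simpa [mul_comm] using h1

theorem eval_derivative_divDiff_self (P : ℂ[X]) (c : ℂ) :
    2 * (derivative (divDiff P c)).eval c = (derivative (derivative P)).eval c := by
  have h := congrArg (fun P => (derivative (derivative P)).eval c) (X_sub_C_mul_divDiff P c)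
  simp at h
  rw [← h]
  ring

theorem eval_derivative_divDiff_of_ne (P : ℂ[X]) {c x : ℂ} (h : x ≠ c) :
    (derivative (divDiff P c)).eval x =
      (derivative P).eval x / (x - c) - (P.eval x - P.eval c) / (x - c) ^ 2 := by
  have hne := sub_ne_zero.2 h
  have h1 := congrArg (fun P => (derivative P).eval x) (X_sub_C_mul_divDiff P c)
  simp only [derivative_mul, derivative_sub, derivative_X, derivative_C, sub_zero, one_mul,
    eval_add, eval_mul, eval_sub, eval_X, eval_C, eval_divDiff_of_ne P h] at h1
  rw [← h1]
  field_simp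
  ring

/-- The series `1 / (λ - c)`. -/
noncomputable def poleSeries (c : ℂ) : LaurentSeries ℂ := (toSeries (X - C c))⁻¹

theorem toSeries_ne_zero {P : ℂ[X]} (h : P ≠ 0) : toSeries P ≠ 0 := fun h0 =>
  h (toSeries_injective (by rw [h0, map_zero]))

theorem toSeries_mul_poleSeries (c : ℂ) : toSeries (X - C c) * poleSeries c = 1 :=
  mul_inv_cancel₀ (toSeries_ne_zero (X_sub_C_ne_zero c))

theorem vanishesBelow_poleSeries (c : ℂ) : VanishesBelow 2 (poleSeries c) := by
  have h1 : VanishesBelow (-2) (toSeries (X - C c)) :=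
    vanishesBelow_toSeries (d := 1) (natDegree_X_sub_C_le c)
  refine VanishesBelow.of_mul h1 ?_ ?_
  · have := toSeries_coeff_neg_two_mul (X - C c) 1
    simp only [Nat.cast_one, mul_one] at this
    rw [this]
    simp
  · rw [toSeries_mul_poleSeries, ← HahnSeries.single_zero_one]
    exact vanishesBelow_single _ (by norm_num)

theorem poleSeries_coeff_add_two (c : ℂ) (n : ℤ) :
    (poleSeries c).coeff (n + 2) = c * (poleSeries c).coeff n + if n = 0 then 1 else 0 := by
  have h := congrArg (fun f => HahnSeries.coeff f n) (toSeries_mul_poleSeries c)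
  simp only [map_sub, toSeries_X, toSeries_C, sub_mul, HahnSeries.coeff_sub,
    HahnSeries.coeff_single_mul, HahnSeries.C_mul_eq_smul, HahnSeries.coeff_smul, smul_eq_mul,
    one_mul, HahnSeries.coeff_one, sub_neg_eq_add] at h
  split_ifs at h ⊢ <;> linear_combination h

theorem poleSeries_coeff (c : ℂ) (k : ℕ) : (poleSeries c).coeff (2 * k + 2) = c ^ k := by
  induction k with
  | zero => rw [poleSeries_coeff_add_two, vanishesBelow_poleSeries c _ (by norm_num)]; simp
  | succ k ih =>
    rw [poleSeries_coeff_add_two, show (2 * ((k + 1 : ℕ) : ℤ)) = 2 * k + 2 by push_cast; ring, ih,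
      if_neg (by omega)]
    ring

theorem poleSeries_coeff_odd (c : ℂ) (k : ℤ) : (poleSeries c).coeff (2 * k + 1) = 0 := by
  rcases lt_or_ge k 0 with hk | hk
  · exact vanishesBelow_poleSeries c _ (by omega)
  · induction k, hk using Int.leInduction with
    | base => exact vanishesBelow_poleSeries c _ (by norm_num)
    | succ k hk ih =>
      rw [show 2 * (k + 1) + 1 = (2 * k + 1) + 2 by ring, poleSeries_coeff_add_two, ih,
        if_neg (by omega)]
      ring

end PartialFractions

/-! ### The Toeplitz systems -/

section Toeplitz

variable {g : ℕ} {t : Times g}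

theorem det_toeplitz_ne_zero (ht : coord t (2 * g + 3) ≠ 0) : (toeplitz t).det ≠ 0 := by
  have htri : (toeplitz t).BlockTriangular OrderDual.toDual := by
    intro i j hij
    simp only [toeplitz, Matrix.of_apply]
    rw [if_neg (by simpa using hij)]
  rw [Matrix.det_of_isLowerTriangular _ htri]
  refine Finset.prod_ne_zero_iff.2 fun i _ => ?_
  simpa [toeplitz] using ht

theorem eq_nonsing_inv_mulVec {n : Type*} [Fintype n] [DecidableEq n] {M : Matrix n n ℂ}
    (hM : M.det ≠ 0) {v r : n → ℂ} (h : M.mulVec v = r) : M⁻¹.mulVec r = v := by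
  rw [← h, Matrix.mulVec_mulVec, Matrix.nonsing_inv_mul _ hM.isUnit, Matrix.one_mulVec]

/-- Multiplication of a series in `λ` by the difference of the two slopes, read off on the leading
coefficients, is minus the Toeplitz matrix. -/
theorem toeplitz_mulVec_coeff {Δ f : LaurentSeries ℂ} {N : ℤ}
    (hΔ : VanishesBelow 2 (Δ - (slope t 1 - slope t (-1)))) (hf : VanishesBelow N f)
    (hpar : ∀ k, f.coeff (N + 2 * k + 1) = 0) (i : Fin (g + 2)) :
    (toeplitz t).mulVec (fun j => f.coeff (N + 2 * (j : ℕ))) i =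
      -(f * Δ).coeff (N + -(2 * g + 1) + 2 * (i : ℕ)) := by
  have hΔ' : VanishesBelow (-(2 * g + 1)) Δ := by
    convert (hΔ.mono (by omega)).add (vanishesBelow_slope_sub t) using 1
    ring
  rw [coeff_mul_add_two_mul hf hpar hΔ', Matrix.mulVec, dotProduct]
  have hcoeff : ∀ m : ℕ, m ≤ g + 1 → Δ.coeff (-(2 * g + 1) + 2 * m) = -coord t (2 * g + 3 - 2 * m) := by
    intro m hm
    have h1 := hΔ (-(2 * g + 1) + 2 * m) (by omega)
    rw [HahnSeries.coeff_sub, sub_eq_zero, slope_sub_coeff, if_pos hm] at h1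
    exact h1
  rw [← Finset.sum_neg_distrib]
  have hterm : ∀ j : Fin (g + 2), toeplitz t i j * f.coeff (N + 2 * (j : ℕ)) =
      if (j : ℕ) ≤ i then -(f.coeff (N + 2 * (j : ℕ)) *
        Δ.coeff (-(2 * g + 1) + 2 * ((i : ℕ) - j : ℕ))) else 0 := by
    intro j
    simp only [toeplitz, Matrix.of_apply, Fin.le_def]
    split_ifs with hij
    · rw [hcoeff _ (by omega)]
      ring
    · rw [zero_mul]
  rw [Finset.sum_congr rfl fun j _ => hterm j,
    Fin.sum_univ_eq_sum_range (fun j => if j ≤ (i : ℕ) then -(f.coeff (N + 2 * (j : ℤ)) *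
      Δ.coeff (-(2 * g + 1) + 2 * ((i : ℕ) - j : ℕ))) else 0) (g + 2), ← Finset.sum_filter]
  refine Finset.sum_congr ?_ fun _ _ => rfl
  ext j
  simp only [Finset.mem_filter, Finset.mem_range]
  omega

theorem sum_Icc_pairs (F : ℕ → ℂ) {k : ℕ} (hk : 1 ≤ k) (n : ℕ) (hn : k ≤ n + 1) :
    ∑ κ ∈ Finset.Icc (2 * k - 1) (2 * n), F κ = ∑ m ∈ Finset.Icc k n, (F (2 * m - 1) + F (2 * m)) := by
  induction n with
  | zero => rw [Finset.Icc_eq_empty (by omega), Finset.Icc_eq_empty (by omega)]; rfl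
  | succ n ih =>
    rcases eq_or_lt_of_le hn with h | h
    · rw [Finset.Icc_eq_empty (by omega), Finset.Icc_eq_empty (by omega)]; rfl
    · rw [show 2 * (n + 1) = 2 * n + 1 + 1 by ring, Finset.sum_Icc_succ_top (by omega),
        Finset.sum_Icc_succ_top (by omega), ih (by omega), Finset.sum_Icc_succ_top (by omega),
        add_assoc]
      rfl

/-- The coefficients of `σ₁ y₂ - σ₂ y₁`, where `y₁, y₂` have the principal parts of the two slopes
and `σ₁, σ₂` those of the two deformed exponents. -/
theorem coeff_cross_eq_cRhs {α : Times g} {y₁ y₂ σ₁ σ₂ : LaurentSeries ℂ}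
    (hy₁ : VanishesBelow 2 (y₁ - slope t 1)) (hy₂ : VanishesBelow 2 (y₂ - slope t (-1)))
    (hσ₁ : ∀ k : ℕ, k ≠ 0 → σ₁.coeff (-(k : ℤ)) = -(1 ^ k * coord α k / k))
    (hσ₂ : ∀ k : ℕ, k ≠ 0 → σ₂.coeff (-(k : ℤ)) = -((-1) ^ k * coord α k / k)) :
    VanishesBelow (-(4 * g + 5)) (σ₁ * y₂ - σ₂ * y₁) ∧
      ∀ k : ℕ, 1 ≤ k → k ≤ g + 2 →
        (σ₁ * y₂ - σ₂ * y₁).coeff (-(2 * g + 1 + 2 * k)) = cRhs t α k := by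
  have hV : ∀ {ε : ℂ} {y : LaurentSeries ℂ}, VanishesBelow 2 (y - slope t ε) →
      VanishesBelow (-(2 * g + 2)) y := by
    intro ε y hy
    convert (hy.mono (by omega)).add (vanishesBelow_slope t ε) using 1
    ring
  have hW : ∀ {ε : ℂ} {σ : LaurentSeries ℂ},
      (∀ k : ℕ, k ≠ 0 → σ.coeff (-(k : ℤ)) = -(ε ^ k * coord α k / k)) →
      VanishesBelow (-(2 * g + 4)) σ := by
    intro ε σ hσ n hn
    obtain ⟨k, rfl⟩ : ∃ k : ℕ, n = -(k : ℤ) := ⟨(-n).toNat, by omega⟩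
    rw [hσ k (by omega), coord_of_lt _ (by omega)]
    simp
  have hcy : ∀ {ε : ℂ} {y : LaurentSeries ℂ}, VanishesBelow 2 (y - slope t ε) → ∀ n < 2,
      y.coeff n = -(1 / 2) * ε ^ (2 - n).toNat * coord t (2 - n).toNat := by
    intro ε y hy n hn
    have h1 := hy n hn
    rwa [HahnSeries.coeff_sub, sub_eq_zero, slope_coeff] at h1
  constructor
  · intro n hn
    rcases eq_or_ne n (-(2 * g + 4) + -(2 * g + 2)) with rfl | hne
    · rw [HahnSeries.coeff_sub, coeff_mul_add_of_vanishesBelow (hW hσ₁) (hV hy₂),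
        coeff_mul_add_of_vanishesBelow (hW hσ₂) (hV hy₁), hcy hy₁ _ (by omega),
        hcy hy₂ _ (by omega), show (-(2 * (g : ℤ) + 4)) = -((2 * (g + 2) : ℕ) : ℤ) by push_cast; ring,
        hσ₁ _ (by omega), hσ₂ _ (by omega),
        show (2 - -(2 * (g : ℤ) + 2)).toNat = 2 * (g + 2) by omega, pow_mul, pow_mul]
      norm_num
    · exact (((hW hσ₁).mul (hV hy₂)).sub ((hW hσ₂).mul (hV hy₁))) n (by omega)
  · intro k hk hkg
    rw [HahnSeries.coeff_sub, coeff_mul_eq_sum_Icc (hW hσ₁) (hV hy₂),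
      coeff_mul_eq_sum_Icc (hW hσ₂) (hV hy₁), ← Finset.sum_sub_distrib]
    trans ∑ κ ∈ Finset.Icc (2 * k - 1) (2 * (g + 2)),
        (-(-1) ^ κ * coord α κ / κ * coord t (2 * g + 3 + 2 * k - κ))
    · refine Finset.sum_nbij' (fun l => (-l).toNat) (fun κ => -(κ : ℤ)) ?_ ?_ ?_ ?_ ?_
      · intro l hl
        rw [Finset.mem_Icc] at hl ⊢
        omega
      · intro κ hκ
        rw [Finset.mem_Icc] at hκ ⊢
        omega
      · intro l hl
        rw [Finset.mem_Icc] at hl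
        omega
      · intro κ hκ
        omega
      · intro l hl
        rw [Finset.mem_Icc] at hl
        obtain ⟨κ, rfl⟩ : ∃ κ : ℕ, l = -(κ : ℤ) := ⟨(-l).toNat, by omega⟩
        rw [hσ₁ _ (by omega), hσ₂ _ (by omega), hcy hy₁ _ (by omega), hcy hy₂ _ (by omega),
          show (2 - (-(2 * (g : ℤ) + 1 + 2 * k) - -(κ : ℤ))).toNat = 2 * g + 3 + 2 * k - κ by omega,
          show (-(-(κ : ℤ))).toNat = κ by omega]
        rcases Nat.even_or_odd' κ with ⟨m, hm | hm⟩
        · have hm' : 2 * g + 3 + 2 * k - κ = 2 * (g + 1 + k - m) + 1 := by omega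
          rw [hm', hm, (even_two_mul m).neg_one_pow, (odd_two_mul_add_one _).neg_one_pow]
          simp only [one_pow]
          ring
        · have hm' : 2 * g + 3 + 2 * k - κ = 2 * (g + 1 + k - m) := by omega
          rw [hm', hm, (odd_two_mul_add_one m).neg_one_pow, (even_two_mul _).neg_one_pow]
          simp only [one_pow]
          ring
    · rw [sum_Icc_pairs _ hk _ (by omega), cRhs]
      refine Finset.sum_nbij' (fun m => k + g + 2 - m) (fun m => k + g + 2 - m) ?_ ?_ ?_ ?_ ?_
      · intro m hm
        rw [Finset.mem_Icc] at hm ⊢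
        omega
      · intro m hm
        rw [Finset.mem_Icc] at hm ⊢
        omega
      · intro m hm
        rw [Finset.mem_Icc] at hm
        omega
      · intro m hm
        rw [Finset.mem_Icc] at hm
        omega
      · intro m hm
        rw [Finset.mem_Icc] at hm
        have e1 : 2 * k + 2 * g + 3 - 2 * (k + g + 2 - m) = 2 * m - 1 := by omega
        have e2 : 2 * k + 2 * g + 4 - 2 * (k + g + 2 - m) = 2 * m := by omega
        have e3 : 2 * g + 3 + 2 * k - (2 * m - 1) = 2 * (k + g + 2 - m) := by omega
        have e4 : 2 * g + 3 + 2 * k - 2 * m = 2 * (k + g + 2 - m) - 1 := by omega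
        have ho : Odd (2 * m - 1) := ⟨m - 1, by omega⟩
        simp only [e1, e2, e3, e4, ho.neg_one_pow, (even_two_mul m).neg_one_pow]
        ring

end Toeplitz

/-! ### The coefficients of the companion Lax pair -/

section Coefficients

variable {g : ℕ} {hbar : ℂ} {t α : Times g} {L A : Matrix (Fin 2) (Fin 2) ℂ[X]}
  {q p : Fin g → ℂ}

theorem eq_mu (hq : Function.Injective q) {m : Fin g → ℂ}
    (h : ∀ k : Fin g, ∑ j, m j * q j ^ (k : ℕ) = nu t α k.succ.succ) : mu t α q = m := by
  refine eq_nonsing_inv_mulVec ?_ ?_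
  · rw [Matrix.det_transpose]
    exact Matrix.det_vandermonde_ne_zero_iff.2 hq
  · funext k
    rw [← h k, Matrix.mulVec, dotProduct]
    exact Finset.sum_congr rfl fun j _ => by
      rw [Matrix.transpose_apply, Matrix.vandermonde_apply, mul_comm]

theorem toSeries_mul_sum_poleSeries (c : Fin g → ℂ) :
    toSeries (∏ i, (X - C (q i))) * ∑ j, HahnSeries.C (c j) * poleSeries (q j) =
      toSeries (∑ j, C (c j) * omitFactor q j) := by
  rw [map_sum, Finset.mul_sum]
  refine Finset.sum_congr rfl fun j _ => ?_
  rw [← X_sub_C_mul_omitFactor q j, map_mul, map_mul, toSeries_C]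
  linear_combination HahnSeries.C (c j) * toSeries (omitFactor q j) * toSeries_mul_poleSeries (q j)

theorem vanishesBelow_sum_poleSeries (c : Fin g → ℂ) :
    VanishesBelow 2 (∑ j, HahnSeries.C (c j) * poleSeries (q j)) :=
  VanishesBelow.sum fun j _ => (vanishesBelow_poleSeries (q j)).C_mul (c j)

theorem sum_poleSeries_coeff_odd (c : Fin g → ℂ) (k : ℤ) :
    (∑ j, HahnSeries.C (c j) * poleSeries (q j)).coeff (2 * k + 1) = 0 := by
  rw [HahnSeries.coeff_sum]
  exact Finset.sum_eq_zero fun j _ => by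
    rw [HahnSeries.C_mul_eq_smul, HahnSeries.coeff_smul, poleSeries_coeff_odd, smul_zero]

theorem sum_poleSeries_coeff (c : Fin g → ℂ) (k : ℕ) :
    (∑ j, HahnSeries.C (c j) * poleSeries (q j)).coeff (2 * k + 2) = ∑ j, c j * q j ^ k := by
  rw [HahnSeries.coeff_sum]
  exact Finset.sum_congr rfl fun j _ => by
    rw [HahnSeries.C_mul_eq_smul, HahnSeries.coeff_smul, poleSeries_coeff, smul_eq_mul]

/-- The polar part at infinity of the logarithmic derivatives `A₁₁ + A₁₂ ξ` of the formal solutions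
in the direction `α`. -/
structure HasDeformedExponents (hbar : ℂ) (t α : Times g) (L A : Matrix (Fin 2) (Fin 2) ℂ[X])
    (ξ₁ ξ₂ : LaurentSeries ℂ) : Prop where
  left : IsFormalSlope hbar L t 1 ξ₁
  right : IsFormalSlope hbar L t (-1) ξ₂
  coeff_left : ∀ k : ℕ, k ≠ 0 → (toSeries (A 0 0) + toSeries (A 0 1) * ξ₁).coeff (-(k : ℤ)) =
    -(1 ^ k * coord α k / k)
  coeff_right : ∀ k : ℕ, k ≠ 0 → (toSeries (A 0 0) + toSeries (A 0 1) * ξ₂).coeff (-(k : ℤ)) =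
    -((-1) ^ k * coord α k / k)

theorem vanishesBelow_sub_of_slope {y₁ y₂ : LaurentSeries ℂ} (h₁ : VanishesBelow 2 (y₁ - slope t 1))
    (h₂ : VanishesBelow 2 (y₂ - slope t (-1))) (ht : coord t (2 * g + 3) ≠ 0) :
    VanishesBelow 2 ((y₁ - y₂) - (slope t 1 - slope t (-1))) ∧
      VanishesBelow (-(2 * g + 1)) (y₁ - y₂) ∧ (y₁ - y₂).coeff (-(2 * g + 1)) ≠ 0 := by
  have h : VanishesBelow 2 ((y₁ - y₂) - (slope t 1 - slope t (-1))) := by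
    convert h₁.sub h₂ using 1; ring
  refine ⟨h, ?_, ?_⟩
  · convert (h.mono (by omega)).add (vanishesBelow_slope_sub t) using 1
    ring
  · have h1 := slope_sub_coeff t 0
    have h2 := h (-(2 * g + 1)) (by omega)
    rw [HahnSeries.coeff_sub, sub_eq_zero] at h2
    simp only [Nat.cast_zero, mul_zero, add_zero, zero_le, if_true, Nat.sub_zero] at h1
    rw [h2, h1]
    exact neg_ne_zero.2 ht

/-- The quotient `A₁₂ / L₁₂` is `ν₋₁ λ + ν₀ + ∑_j μ_j / (λ - q_j)`. -/
theorem HasDeformedExponents.upper_right {ξ₁ ξ₂ : LaurentSeries ℂ}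
    (h : HasDeformedExponents hbar t α L A ξ₁ ξ₂) (ht : coord t (2 * g + 3) ≠ 0)
    (hq : Function.Injective q) (hb : L 0 1 = ∏ j, (X - C (q j))) :
    A 0 1 = (C (nu t α 0) * X + C (nu t α 1)) * ∏ j, (X - C (q j)) +
      ∑ j, C (mu t α q j) * omitFactor q j := by
  obtain ⟨Q, hQ⟩ := exists_eq_mul_add_sum_omitFactor hq (A 0 1)
  set m : Fin g → ℂ := fun j => (A 0 1).eval (q j) / (omitFactor q j).eval (q j) with hm
  obtain ⟨hΔ, hΔV, hΔ0⟩ := vanishesBelow_sub_of_slope h.left.asymptotic h.right.asymptotic ht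
  set y₁ := toSeries (L 0 0) + toSeries (L 0 1) * ξ₁ with hy₁
  set y₂ := toSeries (L 0 0) + toSeries (L 0 1) * ξ₂ with hy₂
  set f := toSeries Q + ∑ j, HahnSeries.C (m j) * poleSeries (q j) with hf
  have hfmul : toSeries (L 0 1) * f = toSeries (A 0 1) := by
    rw [hf, mul_add, hb, toSeries_mul_sum_poleSeries, hQ, map_add, map_mul, mul_comm]
  have hfΔ : f * (y₁ - y₂) = (toSeries (A 0 0) + toSeries (A 0 1) * ξ₁) -
      (toSeries (A 0 0) + toSeries (A 0 1) * ξ₂) := by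
    rw [← hfmul]; ring
  have hσ : ∀ n : ℤ, n < 0 → (f * (y₁ - y₂)).coeff n =
      ((-1) ^ (-n).toNat - 1) * coord α (-n).toNat / (-n).toNat := by
    intro n hn
    obtain ⟨k, rfl⟩ : ∃ k : ℕ, n = -(k : ℤ) := ⟨(-n).toNat, by omega⟩
    rw [hfΔ, HahnSeries.coeff_sub, h.coeff_left _ (by omega), h.coeff_right _ (by omega),
      show (-(-(k : ℤ))).toNat = k by omega]
    ring
  have hfV : VanishesBelow (-2) f := by
    refine VanishesBelow.of_mul hΔV hΔ0 fun n hn => ?_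
    rw [mul_comm, hσ n (by omega)]
    -- The order `-(2g + 4)` has an even exponent, which cancels in the difference.
    rcases eq_or_ne n (-(2 * g + 4)) with rfl | hne
    · rw [show (-(-(2 * (g : ℤ) + 4))).toNat = 2 * (g + 2) by omega, pow_mul]
      norm_num
    · rw [coord_of_lt _ (by omega)]
      ring
  have hpole := vanishesBelow_sum_poleSeries (q := q) m
  have hfpar : ∀ k, f.coeff (-2 + 2 * k + 1) = 0 := by
    intro k
    rw [show -2 + 2 * k + 1 = 2 * (k - 1) + 1 by ring, hf, HahnSeries.coeff_add, toSeries_coeff_odd,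
      sum_poleSeries_coeff_odd, add_zero]
  -- Multiplication of `f = A₁₂ / L₁₂` by `y₁ - y₂` keeps the exponents of odd index, doubled.
  have hnu : ∀ i, nu t α i = f.coeff (-2 + 2 * (i : ℕ)) := by
    refine congrFun (eq_nonsing_inv_mulVec (det_toeplitz_ne_zero ht) ?_)
    funext i
    rw [toeplitz_mulVec_coeff hΔ hfV hfpar, hσ _ (by omega),
      show (-(-2 + -(2 * (g : ℤ) + 1) + 2 * (i : ℕ))).toNat = 2 * g + 3 - 2 * (i : ℕ) by omega,
      Odd.neg_one_pow ⟨g + 1 - i, by omega⟩]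
    ring
  have hQdeg : Q.natDegree ≤ 1 := by
    refine natDegree_le_of_vanishesBelow ?_
    have : toSeries Q = f - ∑ j, HahnSeries.C (m j) * poleSeries (q j) := by rw [hf]; ring
    rw [this]
    exact (hfV.mono (by norm_num)).sub (hpole.mono (by norm_num))
  have hQ1 : Q.coeff 1 = nu t α 0 := by
    rw [hnu, hf, HahnSeries.coeff_add, hpole _ (by simp), add_zero, ← toSeries_coeff_neg_two_mul]
    simp
  have hQ0 : Q.coeff 0 = nu t α 1 := by
    rw [hnu, hf, HahnSeries.coeff_add, hpole _ (by simp), add_zero, ← toSeries_coeff_neg_two_mul]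
    simp
  have hmu : mu t α q = m := by
    refine eq_mu hq fun k => ?_
    rw [← sum_poleSeries_coeff m k, hnu]
    simp only [hf, HahnSeries.coeff_add, Fin.val_succ]
    rw [toSeries_coeff_of_pos _ (by push_cast; omega), zero_add]
    congr 1
    push_cast
    ring
  rw [hmu, ← hQ1, ← hQ0, ← eq_X_add_C_of_natDegree_le_one hQdeg]
  exact hQ

/-- The polynomial part of the upper left entry `A₁₁ - L₁₁ A₁₂ / L₁₂` of the companion deformation
matrix has the coefficients `c_k`. -/
theorem HasDeformedExponents.upper_left {ξ₁ ξ₂ : LaurentSeries ℂ}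
    (h : HasDeformedExponents hbar t α L A ξ₁ ξ₂) (ht : coord t (2 * g + 3) ≠ 0)
    (hq : Function.Injective q) (hb : L 0 1 = ∏ j, (X - C (q j)))
    (hp : ∀ j, (L 0 0).eval (q j) = p j) :
    ∃ c₀, A 0 0 = C c₀ + ∑ i : Fin (g + 2), C (cCoeff t α i) * X ^ ((i : ℕ) + 1) +
      (C (nu t α 0) * X + C (nu t α 1)) * L 0 0 +
      ∑ j, C (mu t α q j) * divDiff (L 0 0) (q j) := by
  have hA := h.upper_right ht hq hb
  obtain ⟨Q, hQ⟩ : ∃ Q, Q = C (nu t α 0) * X + C (nu t α 1) := ⟨_, rfl⟩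
  rw [← hQ] at hA ⊢
  set m := mu t α q
  set R := A 0 0 - Q * L 0 0 - ∑ j, C (m j) * divDiff (L 0 0) (q j) with hR
  obtain ⟨hΔ, hΔV, hΔ0⟩ := vanishesBelow_sub_of_slope h.left.asymptotic h.right.asymptotic ht
  obtain ⟨hcross, hcoeff⟩ := coeff_cross_eq_cRhs h.left.asymptotic h.right.asymptotic
    h.coeff_left h.coeff_right
  set y₁ := toSeries (L 0 0) + toSeries (L 0 1) * ξ₁ with hy₁
  set y₂ := toSeries (L 0 0) + toSeries (L 0 1) * ξ₂ with hy₂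
  set f := toSeries R - ∑ j, HahnSeries.C (m j * p j) * poleSeries (q j) with hf
  set f' := toSeries Q + ∑ j, HahnSeries.C (m j) * poleSeries (q j) with hf'
  have hfmul' : toSeries (L 0 1) * f' = toSeries (A 0 1) := by
    rw [hf', mul_add, hb, toSeries_mul_sum_poleSeries, hA, map_add, map_mul, mul_comm]
  have hff' : f + toSeries (L 0 0) * f' = toSeries (A 0 0) := by
    have hdiv : ∀ j, toSeries (divDiff (L 0 0) (q j)) =
        (toSeries (L 0 0) - HahnSeries.C (p j)) * poleSeries (q j) := by
      intro j
      have h1 := congrArg toSeries (X_sub_C_mul_divDiff (L 0 0) (q j))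
      rw [hp j, map_mul, map_sub _ (L 0 0), toSeries_C] at h1
      rw [← h1]
      linear_combination -toSeries (divDiff (L 0 0) (q j)) * toSeries_mul_poleSeries (q j)
    rw [hf, hf', hR]
    simp only [map_sub, map_mul, map_sum, toSeries_C, hdiv, mul_add, Finset.mul_sum, sub_mul,
      mul_sub, Finset.sum_sub_distrib]
    have : ∀ j, HahnSeries.C (m j) * (toSeries (L 0 0) * poleSeries (q j)) =
        toSeries (L 0 0) * (HahnSeries.C (m j) * poleSeries (q j)) := fun j => by ring
    simp only [this, mul_assoc]
    ring
  have hfΔ : f * (y₁ - y₂) = -((toSeries (A 0 0) + toSeries (A 0 1) * ξ₁) * y₂ -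
      (toSeries (A 0 0) + toSeries (A 0 1) * ξ₂) * y₁) := by
    rw [← hff', ← hfmul']; ring
  have hfV : VanishesBelow (-(2 * g + 4)) f := by
    refine VanishesBelow.of_mul hΔV hΔ0 ?_
    rw [mul_comm _ f, hfΔ]
    exact (hcross.mono (by omega)).neg
  have hpole := vanishesBelow_sum_poleSeries (q := q) (fun j => m j * p j)
  have hfpar : ∀ k, f.coeff (-(2 * g + 4) + 2 * k + 1) = 0 := by
    intro k
    rw [show -(2 * (g : ℤ) + 4) + 2 * k + 1 = 2 * (k - g - 2) + 1 by ring, hf, HahnSeries.coeff_sub,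
      toSeries_coeff_odd, sum_poleSeries_coeff_odd, sub_zero]
  have hRcoeff : ∀ k : ℕ, R.coeff k = f.coeff (-2 * (k : ℤ)) := by
    intro k
    rw [hf, HahnSeries.coeff_sub, hpole _ (by omega), sub_zero, toSeries_coeff_neg_two_mul]
  have hRdeg : R.natDegree < g + 3 := by
    refine Nat.lt_succ_of_le ?_
    rw [natDegree_le_iff_coeff_eq_zero]
    intro n hn
    rw [hRcoeff]
    exact hfV _ (by omega)
  have hc : (toeplitz t)⁻¹.mulVec (fun l : Fin (g + 2) => cRhs t α (g + 2 - (l : ℕ))) =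
      fun i : Fin (g + 2) => f.coeff (-(2 * g + 4) + 2 * (i : ℕ)) := by
    refine eq_nonsing_inv_mulVec (det_toeplitz_ne_zero ht) ?_
    funext i
    rw [toeplitz_mulVec_coeff hΔ hfV hfpar, hfΔ, HahnSeries.coeff_neg, neg_neg,
      ← hcoeff (g + 2 - i) (by omega) (by omega)]
    congr 1
    omega
  refine ⟨R.coeff 0, ?_⟩
  have hRsum : R = C (R.coeff 0) +
      ∑ i : Fin (g + 2), C (cCoeff t α i) * X ^ ((i : ℕ) + 1) := by
    conv_lhs => rw [as_sum_range_C_mul_X_pow' _ hRdeg, Finset.sum_range_succ',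
      ← Fin.sum_univ_eq_sum_range (fun i => C (R.coeff (i + 1)) * X ^ (i + 1)) (g + 2), pow_zero,
      mul_one, add_comm]
    congr 1
    refine Finset.sum_congr rfl fun i _ => ?_
    rw [cCoeff, hc, hRcoeff]
    congr 3
    rw [Fin.val_rev]
    omega
  rw [← hRsum, hR]
  ring

/-- The polynomial part of the lower left entry of the companion Lax matrix, after removal of `-P₂`,
has the coefficients `H_k`. -/
theorem IsNormalized.sum_H (h : IsNormalized hbar t L)
    (hq : Function.Injective q) (hb : L 0 1 = ∏ j, (X - C (q j)))
    (hp : ∀ j, (L 0 0).eval (q j) = p j) :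
    P2 hbar t - (L 0 0 * L 1 1 - L 0 1 * L 1 0) +
        C hbar * (derivative (L 0 0) - ∑ j, divDiff (L 0 0) (q j)) =
      ∑ k : Fin g, C (H hbar t q p k) * X ^ (k : ℕ) := by
  set W := P2 hbar t - (L 0 0 * L 1 1 - L 0 1 * L 1 0) +
    C hbar * (derivative (L 0 0) - ∑ j, divDiff (L 0 0) (q j)) with hW
  have hmul : L 0 1 * W = L 0 1 * P2 hbar t - companionNumerator hbar L +
      C hbar * ∑ j, C (p j) * omitFactor q j := by
    have hdiv : L 0 1 * ∑ j, divDiff (L 0 0) (q j) =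
        L 0 0 * derivative (L 0 1) - ∑ j, C (p j) * omitFactor q j := by
      rw [hb, derivative_prod_X_sub_C, Finset.mul_sum, Finset.mul_sum, ← Finset.sum_sub_distrib]
      refine Finset.sum_congr rfl fun j _ => ?_
      have h1 := X_sub_C_mul_divDiff (L 0 0) (q j)
      rw [hp] at h1
      rw [← X_sub_C_mul_omitFactor q j]
      linear_combination omitFactor q j * h1
    rw [hW, companionNumerator]
    linear_combination -C hbar * hdiv
  have hbdeg := h.natDegree_upper_right
  obtain ⟨ξ₁, h₁⟩ := h.exists_isFormalSlope (Or.inl rfl)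
  obtain ⟨ξ₂, h₂⟩ := h.exists_isFormalSlope (Or.inr rfl)
  have hN := vanishesBelow_sub_P2 h.twisted h.monic_upper_right hbdeg h₁.asymptotic h₂.asymptotic
    (h₁.quadratic h.trace) (h₂.quadratic h.trace)
  have hbV := vanishesBelow_toSeries hbdeg.le
  have hb0 : (toSeries (L 0 1)).coeff (-2 * g) ≠ 0 := by
    rw [toSeries_coeff_neg_two_mul, ← hbdeg, h.monic_upper_right.coeff_natDegree]
    exact one_ne_zero
  have hWV : VanishesBelow (1 - 2 * g) (toSeries W) := by
    refine VanishesBelow.of_mul hbV hb0 ?_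
    have hid : toSeries (L 0 1) * toSeries W =
        -(toSeries (companionNumerator hbar L) - toSeries (L 0 1 * P2 hbar t)) +
        HahnSeries.C hbar * (toSeries (L 0 1) * ∑ j, HahnSeries.C (p j) * poleSeries (q j)) := by
      conv_rhs => rw [hb, toSeries_mul_sum_poleSeries, ← hb]
      rw [← map_mul, hmul, map_add, map_sub, map_mul (x := C hbar), toSeries_C]
      ring
    rw [hid]
    refine VanishesBelow.add (hN.neg.mono (by omega)) (VanishesBelow.C_mul ?_ _)
    exact (hbV.mul (vanishesBelow_sum_poleSeries p)).mono (by omega)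
  have hWcoeff : ∀ n, g ≤ n → W.coeff n = 0 := fun n hn => by
    rw [← toSeries_coeff_neg_two_mul]
    exact hWV _ (by omega)
  have hWsum : W = ∑ k : Fin g, C (W.coeff k) * X ^ (k : ℕ) := by
    rw [Fin.sum_univ_eq_sum_range (fun k => C (W.coeff k) * X ^ k) g]
    ext n
    rw [finsetSum_coeff]
    simp only [coeff_C_mul, coeff_X_pow, mul_ite, mul_one, mul_zero, Finset.sum_ite_eq,
      Finset.mem_range]
    split_ifs with hn
    · rfl
    · exact hWcoeff n (by omega)
  have hH : H hbar t q p = fun k : Fin g => W.coeff k := by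
    refine eq_nonsing_inv_mulVec (Matrix.det_vandermonde_ne_zero_iff.2 hq) ?_
    funext j
    have h1 : (Matrix.vandermonde q).mulVec (fun k : Fin g => W.coeff k) j = W.eval (q j) := by
      conv_rhs => rw [hWsum, eval_finsetSum]
      rw [Matrix.mulVec, dotProduct]
      exact Finset.sum_congr rfl fun k _ => by
        rw [Matrix.vandermonde_apply, eval_mul, eval_C, eval_pow, eval_X, mul_comm]
    have h2 : (L 0 1).eval (q j) = 0 := by
      rw [hb, ← X_sub_C_mul_omitFactor q j]
      simp
    have h3 := congrArg (eval (q j)) h.trace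
    rw [eval_add, hp] at h3
    have h4 : ∑ i, (divDiff (L 0 0) (q i)).eval (q j) = (derivative (L 0 0)).eval (q j) -
        ∑ i ∈ Finset.univ.erase j, (p i - p j) / (q j - q i) := by
      rw [← Finset.add_sum_erase _ _ (Finset.mem_univ j), eval_divDiff_self, sub_eq_add_neg,
        ← Finset.sum_neg_distrib]
      congr 1
      refine Finset.sum_congr rfl fun i hi => ?_
      rw [eval_divDiff_of_ne _ fun h0 => Finset.ne_of_mem_erase hi (hq h0).symm, hp, hp]
      ring
    rw [h1, hW]
    simp only [eval_add, eval_sub, eval_mul, eval_C, eval_finsetSum, h2, hp, h4]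
    linear_combination -(p j) * h3
  rw [hH]
  exact hWsum

end Coefficients

/-! ### The evolution of the Darboux coordinates -/

section Evolution

variable {g : ℕ} {hbar : ℂ} {t α : Times g} {L L' A : Matrix (Fin 2) (Fin 2) ℂ[X]}
  {q p : Fin g → ℂ}

theorem eval_sum_C_mul_omitFactor (m : Fin g → ℂ) (j : Fin g) :
    (∑ i, C (m i) * omitFactor q i).eval (q j) = m j * (omitFactor q j).eval (q j) := by
  rw [eval_finsetSum, Finset.sum_eq_single_of_mem j (Finset.mem_univ j) fun i _ hi => by
    rw [eval_mul, eval_omitFactor_of_ne q hi, mul_zero], eval_mul, eval_C]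

theorem eval_derivative_sum_C_mul_omitFactor (hq : Function.Injective q) (m : Fin g → ℂ)
    (j : Fin g) :
    (derivative (∑ i, C (m i) * omitFactor q i)).eval (q j) =
      (omitFactor q j).eval (q j) * ∑ i ∈ Finset.univ.erase j, (m j + m i) / (q j - q i) := by
  rw [derivative_sum, eval_finsetSum, ← Finset.add_sum_erase _ _ (Finset.mem_univ j),
    derivative_C_mul, eval_mul, eval_C, eval_derivative_omitFactor_self hq, Finset.mul_sum,
    Finset.mul_sum, ← Finset.sum_add_distrib]
  refine Finset.sum_congr rfl fun i hi => ?_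
  rw [derivative_C_mul, eval_mul, eval_C,
    eval_derivative_omitFactor_of_ne hq (Finset.ne_of_mem_erase hi)]
  ring

theorem eval_derivative_sum_C_mul_divDiff (hq : Function.Injective q) (m : Fin g → ℂ) (P : ℂ[X])
    (j : Fin g) :
    (derivative (∑ i, C (m i) * divDiff P (q i))).eval (q j) =
      m j * (derivative (derivative P)).eval (q j) / 2 +
      ((derivative P).eval (q j) * ∑ i ∈ Finset.univ.erase j, m i / (q j - q i) -
        ∑ i ∈ Finset.univ.erase j, m i * (P.eval (q j) - P.eval (q i)) / (q j - q i) ^ 2) := by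
  rw [derivative_sum, eval_finsetSum, ← Finset.add_sum_erase _ _ (Finset.mem_univ j),
    derivative_C_mul, eval_mul, eval_C, ← eval_derivative_divDiff_self, Finset.mul_sum,
    ← Finset.sum_sub_distrib]
  congr 1
  · ring
  refine Finset.sum_congr rfl fun i hi => ?_
  rw [derivative_C_mul, eval_mul, eval_C, eval_derivative_divDiff_of_ne _ fun h0 =>
    Finset.ne_of_mem_erase hi (hq h0).symm]
  ring

/-- The evolution of the Darboux coordinates, from the zero curvature equation at `λ = q_j`. -/
theorem evolution_eq (hq : Function.Injective q) (hb : L 0 1 = ∏ j, (X - C (q j)))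
    (hp : ∀ j, (L 0 0).eval (q j) = p j) (htr : L 0 0 + L 1 1 = P1 t)
    (hZ : ZeroCurvature hbar L L' A)
    (hH : P2 hbar t - (L 0 0 * L 1 1 - L 0 1 * L 1 0) +
        C hbar * (derivative (L 0 0) - ∑ j, divDiff (L 0 0) (q j)) =
      ∑ k : Fin g, C (H hbar t q p k) * X ^ (k : ℕ))
    (hA₁ : A 0 1 = (C (nu t α 0) * X + C (nu t α 1)) * ∏ j, (X - C (q j)) +
      ∑ j, C (mu t α q j) * omitFactor q j)
    {c₀ : ℂ} (hA₀ : A 0 0 = C c₀ + ∑ i : Fin (g + 2), C (cCoeff t α i) * X ^ ((i : ℕ) + 1) +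
      (C (nu t α 0) * X + C (nu t α 1)) * L 0 0 +
      ∑ j, C (mu t α q j) * divDiff (L 0 0) (q j))
    {j : Fin g} {dq dp : ℂ}
    (hdq : (L' 0 1).eval (q j) + (derivative (L 0 1)).eval (q j) * dq = 0)
    (hdp : dp = (L' 0 0).eval (q j) + (derivative (L 0 0)).eval (q j) * dq) :
    dq = qField hbar t α q p j ∧ dp = pField hbar t α q p j := by
  have hr := eval_omitFactor_ne_zero hq j
  have hb0 : (∏ i, (X - C (q i))).eval (q j) = 0 := by
    rw [← X_sub_C_mul_omitFactor q j]; simp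
  have hb0' : (L 0 1).eval (q j) = 0 := by rw [hb, hb0]
  have hb1 : (derivative (L 0 1)).eval (q j) = (omitFactor q j).eval (q j) := by
    rw [hb, eval_derivative_prod]
  have htr0 := congrArg (eval (q j)) htr
  have htr1 := congrArg (fun P => (derivative P).eval (q j)) htr
  have hA₁0 := congrArg (eval (q j)) hA₁
  have hA₁1 := congrArg (fun P => (derivative P).eval (q j)) hA₁
  have hA₀1 := congrArg (fun P => (derivative P).eval (q j)) hA₀
  have hH1 := congrArg (fun P => (derivative P).eval (q j)) hH
  have hZ01 := congrArg (eval (q j)) (hZ 0 1)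
  have hZ00 := congrArg (eval (q j)) (hZ 0 0)
  rw [eval_add, eval_mul, eval_sum_C_mul_omitFactor, hb0] at hA₁0
  have hdd := eval_derivative_sum_C_mul_divDiff hq (fun _ => 1) (L 0 0) j
  simp only [C_1, one_mul] at hdd
  have hcsum : (derivative (∑ i : Fin (g + 2), C (cCoeff t α i) * X ^ ((i : ℕ) + 1))).eval (q j) =
      ∑ i : Fin (g + 2), ((i : ℕ) + 1) * cCoeff t α i * q j ^ (i : ℕ) := by
    rw [derivative_sum, eval_finsetSum]
    refine Finset.sum_congr rfl fun i _ => ?_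
    simp
    ring
  have hHsum : (derivative (∑ k : Fin g, C (H hbar t q p k) * X ^ (k : ℕ))).eval (q j) =
      ∑ k : Fin g, (k : ℕ) * H hbar t q p k * q j ^ ((k : ℕ) - 1) := by
    rw [derivative_sum, eval_finsetSum]
    refine Finset.sum_congr rfl fun i _ => ?_
    rw [derivative_C_mul_X_pow, eval_mul, eval_C, eval_pow, eval_X]
    ring
  simp only [derivative_mul, eval_add, eval_mul,
    eval_derivative_sum_C_mul_omitFactor hq, eval_derivative_prod, hb0, derivative_add,
    derivative_C, derivative_X, eval_C, eval_X, eval_zero, eval_one] at hA₁1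
  rw [derivative_add, derivative_add, derivative_add, eval_add, eval_add, eval_add,
    eval_derivative_sum_C_mul_divDiff hq, hcsum] at hA₀1
  simp only [derivative_mul, eval_add, eval_mul, derivative_add, derivative_C, derivative_X, eval_C,
    eval_X, eval_zero, eval_one] at hA₀1
  rw [hHsum] at hH1
  simp only [derivative_add, derivative_sub, derivative_mul, eval_add, eval_sub, eval_mul, hdd,
    derivative_C, eval_C, eval_zero, hb1, hb0'] at hH1
  simp only [Matrix.sub_apply, Matrix.mul_apply, Fin.sum_univ_two, eval_add, eval_sub, eval_mul,
    eval_C, hb0'] at hZ01 hZ00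
  simp only [derivative_add, eval_add] at htr0 htr1
  simp only [hp] at *
  set r := (omitFactor q j).eval (q j)
  set a' := (derivative (L 0 0)).eval (q j)
  set a'' := (derivative (derivative (L 0 0))).eval (q j)
  set T₁ := ∑ i ∈ Finset.univ.erase j, 1 / (q j - q i) with hT₁
  set T₂ := ∑ i ∈ Finset.univ.erase j, (p j - p i) / (q j - q i) ^ 2 with hT₂
  set M₁ := ∑ i ∈ Finset.univ.erase j, mu t α q i / (q j - q i) with hM₁
  set M₂ := ∑ i ∈ Finset.univ.erase j, mu t α q i * (p j - p i) / (q j - q i) ^ 2 with hM₂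
  have hS₁ : ∑ i ∈ Finset.univ.erase j, (mu t α q j + mu t α q i) / (q j - q i) =
      mu t α q j * T₁ + M₁ := by
    rw [hT₁, hM₁, Finset.mul_sum, ← Finset.sum_add_distrib]
    exact Finset.sum_congr rfl fun i _ => by ring
  have hS₂ : ∑ i ∈ Finset.univ.erase j, (mu t α q i + mu t α q j) * (p i - p j) / (q j - q i) ^ 2 =
      -(mu t α q j * T₂ + M₂) := by
    rw [hT₂, hM₂, Finset.mul_sum, ← Finset.sum_add_distrib, ← Finset.sum_neg_distrib]
    exact Finset.sum_congr rfl fun i _ => by ring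
  have hdq' : dq = qField hbar t α q p j := by
    rw [hb1] at hdq
    refine mul_left_cancel₀ hr ?_
    rw [qField, hS₁]
    rw [hS₁] at hA₁1
    linear_combination hdq - hZ01 - hbar * hA₁1 - ((L 1 1).eval (q j) - p j) * hA₁0 -
      mu t α q j * r * htr0
  refine ⟨hdq', ?_⟩
  rw [qField, hS₁] at hdq'
  rw [pField, hS₂]
  linear_combination hdp + hZ00 + hbar * hA₀1 + (L 1 0).eval (q j) * hA₁0 + a' * hdq' +
    mu t α q j * hH1 + mu t α q j * a' * htr0 + mu t α q j * p j * htr1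

end Evolution

/-! ### The Hamiltonian structure -/

section Hamiltonian

variable {g : ℕ}

/-- The right hand side of the linear system for `H`. -/
noncomputable def moment (hbar : ℂ) (t : Times g) (q p : Fin g → ℂ) (j : Fin g) : ℂ :=
  p j ^ 2 - (P1 t).eval (q j) * p j + (P2 hbar t).eval (q j) +
    hbar * ∑ i ∈ Finset.univ.erase j, (p i - p j) / (q j - q i)

variable {hbar : ℂ} {t α : Times g} {q p : Fin g → ℂ}

theorem sum_H_mul_pow (hq : Function.Injective q) (j : Fin g) :
    ∑ k : Fin g, H hbar t q p k * q j ^ (k : ℕ) = moment hbar t q p j := by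
  have hdet := (Matrix.det_vandermonde_ne_zero_iff.2 hq).isUnit
  have h : (Matrix.vandermonde q).mulVec (H hbar t q p) = moment hbar t q p := by
    change (Matrix.vandermonde q).mulVec ((Matrix.vandermonde q)⁻¹.mulVec (moment hbar t q p)) = _
    rw [Matrix.mulVec_mulVec, Matrix.mul_nonsing_inv _ hdet, Matrix.one_mulVec]
  rw [← h, Matrix.mulVec, dotProduct]
  exact Finset.sum_congr rfl fun k _ => by rw [Matrix.vandermonde_apply, mul_comm]

theorem sum_mu_mul_pow (hq : Function.Injective q) (k : Fin g) :
    ∑ j, mu t α q j * q j ^ (k : ℕ) = nu t α k.succ.succ := by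
  have hdet : IsUnit (Matrix.vandermonde q).transpose.det := by
    rw [Matrix.det_transpose]
    exact (Matrix.det_vandermonde_ne_zero_iff.2 hq).isUnit
  have h : (Matrix.vandermonde q).transpose.mulVec (mu t α q) = fun k => nu t α k.succ.succ := by
    rw [mu, Matrix.mulVec_mulVec, Matrix.mul_nonsing_inv _ hdet, Matrix.one_mulVec]
  rw [← congrFun h k, Matrix.mulVec, dotProduct]
  exact Finset.sum_congr rfl fun j _ => by
    rw [Matrix.transpose_apply, Matrix.vandermonde_apply, mul_comm]

/-- Pairing any vector with `ν`, by means of `μ`. -/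
theorem sum_nu_mul (hq : Function.Injective q) (h : Fin g → ℂ) :
    ∑ k : Fin g, nu t α k.succ.succ * h k =
      ∑ j, mu t α q j * ∑ k : Fin g, h k * q j ^ (k : ℕ) := by
  simp only [← sum_mu_mul_pow hq, Finset.sum_mul, Finset.mul_sum]
  rw [Finset.sum_comm]
  exact Finset.sum_congr rfl fun j _ => Finset.sum_congr rfl fun k _ => by ring

theorem sum_sum_erase_mul_single (f : Fin g → Fin g → ℂ) (j : Fin g) :
    ∑ i, ∑ k ∈ Finset.univ.erase i, f i k * Pi.single (M := fun _ => ℂ) j 1 k =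
      ∑ i ∈ Finset.univ.erase j, f i j := by
  have h : ∀ i, ∑ k ∈ Finset.univ.erase i, f i k * Pi.single (M := fun _ => ℂ) j 1 k =
      if i = j then 0 else f i j := by
    intro i
    split_ifs with hij
    · refine Finset.sum_eq_zero fun k hk => ?_
      rw [Pi.single_eq_of_ne (hij ▸ Finset.ne_of_mem_erase hk), mul_zero]
    · rw [Finset.sum_eq_single_of_mem j (Finset.mem_erase.2 ⟨Ne.symm hij, Finset.mem_univ j⟩)
        fun k _ hk => by rw [Pi.single_eq_of_ne hk, mul_zero]]
      rw [Pi.single_eq_same, mul_one]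
  rw [Finset.sum_congr rfl fun i _ => h i, ← Finset.add_sum_erase _ _ (Finset.mem_univ j), if_pos rfl,
    zero_add]
  exact Finset.sum_congr rfl fun i hi => if_neg (Finset.ne_of_mem_erase hi)

theorem sum_mul_single (f : Fin g → ℂ) (j : Fin g) :
    ∑ i, f i * Pi.single (M := fun _ => ℂ) j 1 i = f j := by
  rw [Finset.sum_eq_single_of_mem j (Finset.mem_univ j)
    fun k _ hk => by rw [Pi.single_eq_of_ne hk, mul_zero], Pi.single_eq_same, mul_one]

theorem hasDerivAt_update_apply (x : Fin g → ℂ) (j i : Fin g) :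
    HasDerivAt (fun u => Function.update x j u i) (Pi.single (M := fun _ => ℂ) j 1 i) (x j) :=
  hasDerivAt_pi.1 (hasDerivAt_update x j (x j)) i

/-- The Hamiltonian in terms of `μ`, which does not depend on `p`. -/
theorem Ham_eq (hq : Function.Injective q) :
    Ham hbar t α q p = ∑ j, mu t α q j * moment hbar t q p j -
      hbar * ∑ j, ∑ i : Fin (g + 2), cCoeff t α i * q j ^ ((i : ℕ) + 1) -
      hbar * nu t α 1 * ∑ j, p j - hbar * nu t α 0 * ∑ j, q j * p j := by
  rw [Ham, sum_nu_mul hq]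
  simp only [sum_H_mul_pow hq]

theorem hasDerivAt_Ham_right (hq : Function.Injective q) (j : Fin g) :
    HasDerivAt (fun u => Ham hbar t α q (Function.update p j u)) (qField hbar t α q p j) (p j) := by
  simp only [Ham_eq hq, moment]
  have hp := hasDerivAt_update_apply p j
  have hmom := fun i => ((((hp i).fun_pow 2).fun_sub ((hp i).const_mul ((P1 t).eval (q i)))).add_const
    ((P2 hbar t).eval (q i))).fun_add ((HasDerivAt.fun_sum (u := Finset.univ.erase i) fun k _ =>
      ((hp k).fun_sub (hp i)).div_const (q i - q k)).const_mul hbar)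
  have h := (((HasDerivAt.fun_sum (u := Finset.univ) fun i _ =>
    (hmom i).const_mul (mu t α q i)).sub_const (hbar * ∑ j, ∑ i : Fin (g + 2),
      cCoeff t α i * q j ^ ((i : ℕ) + 1))).fun_sub ((HasDerivAt.fun_sum (u := Finset.univ) fun i _ =>
      hp i).const_mul (hbar * nu t α 1))).fun_sub ((HasDerivAt.fun_sum (u := Finset.univ) fun i _ =>
      (hp i).const_mul (q i)).const_mul (hbar * nu t α 0))
  refine h.congr_deriv ?_
  simp only [Function.update_eq_self]
  set δ : Fin g → ℂ := Pi.single j 1 with hδ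
  have e₁ : ∑ i, mu t α q i * (((2 : ℕ) : ℂ) * p i ^ (2 - 1) * δ i - (P1 t).eval (q i) * δ i +
      hbar * ∑ k ∈ Finset.univ.erase i, (δ k - δ i) / (q i - q k)) =
      ∑ i, (mu t α q i * (2 * p i - (P1 t).eval (q i) -
        hbar * ∑ k ∈ Finset.univ.erase i, 1 / (q i - q k))) * δ i +
      hbar * ∑ i, ∑ k ∈ Finset.univ.erase i, (mu t α q i / (q i - q k)) * δ k := by
    rw [Finset.mul_sum, ← Finset.sum_add_distrib]
    refine Finset.sum_congr rfl fun i _ => ?_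
    have : ∑ k ∈ Finset.univ.erase i, (δ k - δ i) / (q i - q k) =
        ∑ k ∈ Finset.univ.erase i, 1 / (q i - q k) * δ k -
        (∑ k ∈ Finset.univ.erase i, 1 / (q i - q k)) * δ i := by
      rw [Finset.sum_mul, ← Finset.sum_sub_distrib]
      exact Finset.sum_congr rfl fun k _ => by ring
    have h2 : ∑ k ∈ Finset.univ.erase i, mu t α q i / (q i - q k) * δ k =
        mu t α q i * ∑ k ∈ Finset.univ.erase i, 1 / (q i - q k) * δ k := by
      rw [Finset.mul_sum]
      exact Finset.sum_congr rfl fun k _ => by ring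
    rw [this, h2]
    push_cast
    ring
  have e₂ : ∑ i, δ i = 1 := by
    have h1 := sum_mul_single (fun _ => 1) j
    simp only [one_mul] at h1
    exact h1
  rw [e₁, e₂, hδ, sum_mul_single, sum_mul_single, sum_sum_erase_mul_single, qField]
  have e₃ : ∑ i ∈ Finset.univ.erase j, (mu t α q j + mu t α q i) / (q j - q i) =
      mu t α q j * ∑ k ∈ Finset.univ.erase j, 1 / (q j - q k) -
      ∑ i ∈ Finset.univ.erase j, mu t α q i / (q i - q j) := by
    rw [Finset.mul_sum, ← Finset.sum_sub_distrib]
    refine Finset.sum_congr rfl fun i _ => ?_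
    rw [← neg_sub (q j) (q i), div_neg]
    ring
  rw [e₃]
  ring

/-- Near an injective tuple, the solution `H` of the Vandermonde system is continuous. -/
theorem continuousAt_H_update (hq : Function.Injective q) (j k : Fin g) :
    ContinuousAt (fun u => H hbar t (Function.update q j u) p k) (q j) := by
  have hz : ∀ i, ContinuousAt (fun u => Function.update q j u i) (q j) := fun i =>
    (hasDerivAt_update_apply q j i).continuousAt
  have hV : ContinuousAt (fun u => Matrix.vandermonde (Function.update q j u)) (q j) :=
    continuousAt_pi.2 fun i => continuousAt_pi.2 fun l => (hz i).pow l
  have hVinv : ContinuousAt (fun u => (Matrix.vandermonde (Function.update q j u))⁻¹) (q j) := by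
    refine ContinuousAt.comp (g := Inv.inv) (continuousAt_matrix_inv _ ?_) hV
    rw [Function.update_eq_self, show (Ring.inverse : ℂ → ℂ) = Inv.inv from funext Ring.inverse_eq_inv]
    exact continuousAt_inv₀ (Matrix.det_vandermonde_ne_zero_iff.2 hq)
  have hmom : ∀ i, ContinuousAt (fun u => moment hbar t (Function.update q j u) p i) (q j) := by
    intro i
    refine ((continuousAt_const.sub (((P1 t).continuousAt.comp (hz i)).mul continuousAt_const)).add
      ((P2 hbar t).continuousAt.comp (hz i))).add (continuousAt_const.mul
      (tendsto_finsetSum _ fun l hl => ContinuousAt.div continuousAt_const ((hz i).sub (hz l)) ?_))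
    rw [Function.update_eq_self, sub_ne_zero]
    exact fun h0 => Finset.ne_of_mem_erase hl (hq h0).symm
  change ContinuousAt (fun u => ∑ l, (Matrix.vandermonde (Function.update q j u))⁻¹ k l *
    moment hbar t (Function.update q j u) p l) (q j)
  exact tendsto_finsetSum _ fun l _ =>
    ((continuousAt_pi.1 (continuousAt_pi.1 hVinv k) l).mul (hmom l))

theorem eventually_injective_update (hq : Function.Injective q) (j : Fin g) :
    ∀ᶠ u in 𝓝 (q j), Function.Injective (Function.update q j u) := by
  have h : ∀ᶠ u in 𝓝 (q j), ∀ i, i ≠ j → u ≠ q i := by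
    rw [eventually_all]
    intro i
    by_cases hij : i = j
    · exact Eventually.of_forall fun u h => absurd hij h
    · exact (isOpen_ne.eventually_mem (show q j ≠ q i from fun h0 => hij (hq h0).symm)).mono
        fun u hu _ => hu
  filter_upwards [h] with u hu a b hab
  rcases eq_or_ne a j with rfl | ha <;> rcases eq_or_ne b a with rfl | hb
  · rfl
  · rw [Function.update_self, Function.update_of_ne hb] at hab
    exact absurd hab (hu b hb)
  · rfl
  · rcases eq_or_ne b j with rfl | hbj
    · rw [Function.update_self, Function.update_of_ne ha] at hab
      exact absurd hab.symm (hu a ha)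
    · rw [Function.update_of_ne ha, Function.update_of_ne hbj] at hab
      exact hq hab

/-- The derivative of a product whose first factor vanishes only requires the second factor to be
continuous. -/
theorem HasDerivAt.mul_continuousAt_of_eq_zero {u v : ℂ → ℂ} {u' s : ℂ} (hu : HasDerivAt u u' s)
    (hu0 : u s = 0) (hv : ContinuousAt v s) : HasDerivAt (fun x => u x * v x) (u' * v s) s := by
  have h := hasFDerivAt_mul_of_eq_zero hu.hasFDerivAt hu0 hv
  refine (h.hasDerivAt).congr_deriv ?_
  simp [mul_comm]

theorem hasDerivAt_Ham_left (hq : Function.Injective q) (j : Fin g) :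
    HasDerivAt (fun u => Ham hbar t α (Function.update q j u) p) (-pField hbar t α q p j) (q j) := by
  have hz := hasDerivAt_update_apply q j
  -- With `μ` frozen at `q`, `∑ ν_{k+1} H_k = ∑_i μ_i (moment_i + ∑_k (q_i^k - z_i^k) H_k)`.
  have hev : (fun u => Ham hbar t α (Function.update q j u) p) =ᶠ[𝓝 (q j)] fun u =>
      ∑ i, mu t α q i * (moment hbar t (Function.update q j u) p i + ∑ k : Fin g,
        (q i ^ (k : ℕ) - Function.update q j u i ^ (k : ℕ)) *
          H hbar t (Function.update q j u) p k) -
      hbar * ∑ i, ∑ l : Fin (g + 2), cCoeff t α l * Function.update q j u i ^ ((l : ℕ) + 1) -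
      hbar * nu t α 1 * ∑ i, p i - hbar * nu t α 0 * ∑ i, Function.update q j u i * p i := by
    filter_upwards [eventually_injective_update hq j] with u hu
    rw [Ham, sum_nu_mul hq]
    congr 4
    funext i
    rw [← sum_H_mul_pow hu, ← Finset.sum_add_distrib]
    congr 1
    exact Finset.sum_congr rfl fun k _ => by ring
  refine HasDerivAt.congr_of_eventuallyEq ?_ hev
  have hmom := fun i => ((((((P1 t).hasDerivAt _).comp (q j) (hz i)).mul_const (p i)).const_sub
    (p i ^ 2)).fun_add (((P2 hbar t).hasDerivAt _).comp (q j) (hz i))).fun_add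
    ((HasDerivAt.fun_sum (u := Finset.univ.erase i) fun k hk =>
      (hasDerivAt_const (q j) (p k - p i)).fun_div ((hz i).fun_sub (hz k)) (by
        rw [Function.update_eq_self, sub_ne_zero]
        exact fun h0 => Finset.ne_of_mem_erase hk (hq h0).symm)).const_mul hbar)
  have hH := fun (i k : Fin g) => HasDerivAt.mul_continuousAt_of_eq_zero
    (((hz i).fun_pow (k : ℕ)).const_sub (q i ^ (k : ℕ))) (by simp)
    (continuousAt_H_update (hbar := hbar) (t := t) (p := p) hq j k)
  have h := (((HasDerivAt.fun_sum (u := Finset.univ) fun i _ =>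
    ((hmom i).fun_add (HasDerivAt.fun_sum (u := Finset.univ) fun k _ => hH i k)).const_mul
      (mu t α q i)).fun_sub ((HasDerivAt.fun_sum (u := Finset.univ) fun i _ =>
      HasDerivAt.fun_sum (u := Finset.univ) fun (l : Fin (g + 2)) _ =>
        ((hz i).fun_pow ((l : ℕ) + 1)).const_mul (cCoeff t α l)).const_mul hbar)).sub_const
      (hbar * nu t α 1 * ∑ i, p i)).fun_sub ((HasDerivAt.fun_sum (u := Finset.univ) fun i _ =>
      (hz i).mul_const (p i)).const_mul (hbar * nu t α 0))
  refine h.congr_deriv ?_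
  simp only [Function.update_eq_self]
  set δ : Fin g → ℂ := Pi.single j 1 with hδ
  have e₁ : ∀ i, mu t α q i * (-((derivative (P1 t)).eval (q i) * δ i * p i) +
      (derivative (P2 hbar t)).eval (q i) * δ i + hbar * ∑ k ∈ Finset.univ.erase i,
        (0 * (q i - q k) - (p k - p i) * (δ i - δ k)) / (q i - q k) ^ 2 +
      ∑ k : Fin g, -(((k : ℕ) : ℂ) * q i ^ ((k : ℕ) - 1) * δ i) * H hbar t q p k) =
      (mu t α q i * (-((derivative (P1 t)).eval (q i) * p i) + (derivative (P2 hbar t)).eval (q i) -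
        hbar * ∑ k ∈ Finset.univ.erase i, (p k - p i) / (q i - q k) ^ 2 -
        ∑ k : Fin g, (k : ℕ) * H hbar t q p k * q i ^ ((k : ℕ) - 1))) * δ i +
      hbar * ∑ k ∈ Finset.univ.erase i, mu t α q i * (p k - p i) / (q i - q k) ^ 2 * δ k := by
    intro i
    have h1 : ∑ k ∈ Finset.univ.erase i,
        (0 * (q i - q k) - (p k - p i) * (δ i - δ k)) / (q i - q k) ^ 2 =
        ∑ k ∈ Finset.univ.erase i, (p k - p i) / (q i - q k) ^ 2 * δ k -
        (∑ k ∈ Finset.univ.erase i, (p k - p i) / (q i - q k) ^ 2) * δ i := by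
      rw [Finset.sum_mul, ← Finset.sum_sub_distrib]
      exact Finset.sum_congr rfl fun k _ => by ring
    have h2 : ∑ k ∈ Finset.univ.erase i, mu t α q i * (p k - p i) / (q i - q k) ^ 2 * δ k =
        mu t α q i * ∑ k ∈ Finset.univ.erase i, (p k - p i) / (q i - q k) ^ 2 * δ k := by
      rw [Finset.mul_sum]
      exact Finset.sum_congr rfl fun k _ => by ring
    have h3 : ∑ k : Fin g, -(((k : ℕ) : ℂ) * q i ^ ((k : ℕ) - 1) * δ i) * H hbar t q p k =
        -(∑ k : Fin g, (k : ℕ) * H hbar t q p k * q i ^ ((k : ℕ) - 1)) * δ i := by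
      rw [neg_mul, Finset.sum_mul, ← Finset.sum_neg_distrib]
      exact Finset.sum_congr rfl fun k _ => by ring
    rw [h1, h2, h3]
    ring
  have e₂ : ∀ i, ∑ l : Fin (g + 2), cCoeff t α l *
      ((((l : ℕ) + 1 : ℕ) : ℂ) * q i ^ ((l : ℕ) + 1 - 1) * δ i) =
      (∑ l : Fin (g + 2), ((l : ℕ) + 1) * cCoeff t α l * q i ^ (l : ℕ)) * δ i := by
    intro i
    rw [Finset.sum_mul]
    refine Finset.sum_congr rfl fun l _ => ?_
    rw [Nat.add_sub_cancel]
    push_cast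
    ring
  have e₃ : ∑ i, δ i * p i = p j := by
    rw [← sum_mul_single p j]
    exact Finset.sum_congr rfl fun i _ => mul_comm _ _
  simp only [e₁, e₂, e₃, Finset.sum_add_distrib, ← Finset.mul_sum]
  rw [hδ, sum_mul_single, sum_mul_single, sum_sum_erase_mul_single, pField]
  have e₄ : ∑ i ∈ Finset.univ.erase j,
      (mu t α q i + mu t α q j) * (p i - p j) / (q j - q i) ^ 2 =
      mu t α q j * ∑ i ∈ Finset.univ.erase j, (p i - p j) / (q j - q i) ^ 2 -
      ∑ i ∈ Finset.univ.erase j, mu t α q i * (p j - p i) / (q i - q j) ^ 2 := by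
    rw [Finset.mul_sum, ← Finset.sum_sub_distrib]
    refine Finset.sum_congr rfl fun i _ => ?_
    rw [← neg_sub (q j) (q i), neg_sq]
    ring
  rw [e₄]
  ring

end Hamiltonian

/-! ### The companion gauge -/

section Companion

variable {g : ℕ} {hbar : ℂ} {U : Set (Times g)} {L : Times g → Matrix (Fin 2) (Fin 2) ℂ[X]}
  {Psi : ℂ → Times g → Matrix (Fin 2) (Fin 2) ℂ} {t α : Times g} {q : Fin g → ℂ} {x : ℂ}

theorem companionWave_zero (y : ℂ) (s : Times g) (j : Fin 2) :
    companionWave L Psi y s 0 j = Psi y s 0 j := by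
  simp [companionWave, Matrix.mul_apply, Fin.sum_univ_two]

theorem companionWave_one (y : ℂ) (s : Times g) (j : Fin 2) :
    companionWave L Psi y s 1 j =
      (L s 0 0).eval y * Psi y s 0 j + (L s 0 1).eval y * Psi y s 1 j := by
  simp [companionWave, Matrix.mul_apply, Fin.sum_univ_two]

theorem IsIsomonodromic.isUnit_det_companionWave (h : IsIsomonodromic hbar U L Psi) (ht : t ∈ U)
    (hx : (L t 0 1).eval x ≠ 0) : IsUnit (companionWave L Psi x t).det := by
  rw [companionWave, Matrix.det_mul, Matrix.det_fin_two_of]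
  simpa [isUnit_iff_ne_zero] using ⟨hx, h.det_ne_zero x t ht⟩

theorem eval_prod_ne_zero (hx : x ∉ Set.range q) : (∏ j, (X - C (q j))).eval x ≠ 0 := by
  rw [eval_prod]
  refine Finset.prod_ne_zero_iff.2 fun j _ => ?_
  simpa [sub_eq_zero] using fun h0 : x = q j => hx ⟨j, h0.symm⟩

theorem eval_omitFactor (hx : x ∉ Set.range q) (j : Fin g) :
    (omitFactor q j).eval x = (∏ j, (X - C (q j))).eval x / (x - q j) := by
  have hne : x - q j ≠ 0 := sub_ne_zero.2 fun h0 => hx ⟨j, h0.symm⟩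
  rw [eq_div_iff hne, ← X_sub_C_mul_omitFactor q j, eval_mul]
  simp [mul_comm]

/-- In the companion gauge the first row is `(0, 1)`. The trace acquires the term `ħ L₁₂' / L₁₂`,
which is the sum of the simple poles, and the determinant is that of `L` up to terms of order `ħ`.
-/
theorem IsIsomonodromic.companionLax_eq (h : IsIsomonodromic hbar U L Psi) (ht : t ∈ U)
    {p : Fin g → ℂ} (hb : L t 0 1 = ∏ j, (X - C (q j))) (hp : ∀ j, (L t 0 0).eval (q j) = p j)
    (hq : Function.Injective q) (hx : x ∉ Set.range q) :
    companionLax hbar L Psi x t =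
      !![0, 1;
        -(P2 hbar t).eval x + ∑ k : Fin g, H hbar t q p k * x ^ (k : ℕ)
          - ∑ j, hbar * p j / (x - q j),
        (P1 t).eval x + ∑ j, hbar / (x - q j)] := by
  have hxq : ∀ j, x ≠ q j := fun j h0 => hx ⟨j, h0.symm⟩
  have hb0 : (L t 0 1).eval x ≠ 0 := by
    rw [hb]
    exact eval_prod_ne_zero hx
  have hdet := h.isUnit_det_companionWave ht hb0
  set T := ∑ j, 1 / (x - q j) with hT
  have hb' : (derivative (L t 0 1)).eval x = (L t 0 1).eval x * T := by
    rw [hb, derivative_prod_X_sub_C, eval_finsetSum, hT, Finset.mul_sum]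
    exact Finset.sum_congr rfl fun j _ => by rw [eval_omitFactor hx]; ring
  have htr := congrArg (eval x) (h.normalized t ht).trace
  have hH := congrArg (eval x) ((h.normalized t ht).sum_H hq hb hp)
  have hpole : ∑ j, hbar / (x - q j) = hbar * T := by
    rw [hT, Finset.mul_sum]
    exact Finset.sum_congr rfl fun j _ => by ring
  have hdiv : ∑ j, (divDiff (L t 0 0) (q j)).eval x =
      (L t 0 0).eval x * T - ∑ j, p j / (x - q j) := by
    rw [hT, Finset.mul_sum, ← Finset.sum_sub_distrib]
    refine Finset.sum_congr rfl fun j _ => ?_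
    rw [eval_divDiff_of_ne _ (hxq j), hp]
    ring
  have hpole' : ∑ j, hbar * p j / (x - q j) = hbar * ∑ j, p j / (x - q j) := by
    rw [Finset.mul_sum]
    exact Finset.sum_congr rfl fun j _ => by ring
  simp only [eval_add, eval_sub, eval_mul, eval_C, eval_finsetSum, eval_pow, eval_X, hdiv] at hH htr
  rw [hpole, hpole', companionLax]
  have key : (Matrix.of fun i j => hbar * deriv (fun y => companionWave L Psi y t i j) x) =
      !![0, 1; -(P2 hbar t).eval x + ∑ k : Fin g, H hbar t q p k * x ^ (k : ℕ)
          - hbar * ∑ j, p j / (x - q j), (P1 t).eval x + hbar * T] * companionWave L Psi x t := by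
    have hspec : ∀ i j, hbar * deriv (fun y => Psi y t i j) x =
        (L t i 0).eval x * Psi x t 0 j + (L t i 1).eval x * Psi x t 1 j := fun i j => by
      rw [h.spectral x t ht, Matrix.mul_apply, Fin.sum_univ_two]
      rfl
    have hd := fun j => ((((L t 0 0).hasDerivAt x).fun_mul
      (h.differentiableAt_wave_left ht x 0 j).hasDerivAt).fun_add (((L t 0 1).hasDerivAt x).fun_mul
      (h.differentiableAt_wave_left ht x 1 j).hasDerivAt)).deriv
    ext i j
    rw [Matrix.of_apply, Matrix.mul_apply, Fin.sum_univ_two, companionWave_zero, companionWave_one]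
    fin_cases i
    · simp only [Fin.zero_eta, companionWave_zero, hspec]
      simp
    · have h0 := hspec 0 j
      have h1 := hspec 1 j
      simp only [Fin.mk_one, companionWave_one, hd]
      simp only [Matrix.of_apply, Matrix.cons_val', Matrix.cons_val_zero, Matrix.cons_val_one,
        Matrix.cons_val_fin_one]
      linear_combination (L t 0 0).eval x * h0 + (L t 0 1).eval x * h1 + hbar * Psi x t 1 j * hb' +
        (Psi x t 0 j * (L t 0 0).eval x + Psi x t 1 j * (L t 0 1).eval x) * htr + Psi x t 0 j * hH
  rw [key, Matrix.mul_assoc, Matrix.mul_nonsing_inv _ hdet, Matrix.mul_one]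

/-- The first row of the companion deformation matrix. -/
theorem IsIsomonodromic.auxMatrix_zero (h : IsIsomonodromic hbar U L Psi) (ht : t ∈ U)
    {A : Matrix (Fin 2) (Fin 2) ℂ[X]}
    (hA : ∀ x i j, deform hbar α (fun s => Psi x s i j) t = (evalMat A x * Psi x t) i j)
    (hx : (L t 0 1).eval x ≠ 0) :
    auxMatrix hbar α L Psi x t 0 = ![(A 0 0).eval x - (L t 0 0).eval x * ((A 0 1).eval x /
      (L t 0 1).eval x), (A 0 1).eval x / (L t 0 1).eval x] := by
  set W := companionWave L Psi x t with hW
  have hdet : IsUnit W.det := h.isUnit_det_companionWave ht hx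
  set r : Fin 2 → ℂ := ![(A 0 0).eval x - (L t 0 0).eval x * ((A 0 1).eval x /
      (L t 0 1).eval x), (A 0 1).eval x / (L t 0 1).eval x] with hr
  have hrow : (fun j => deform hbar α (fun s => companionWave L Psi x s 0 j) t) =
      Matrix.vecMul r W := by
    funext j
    simp only [companionWave_zero, hA, Matrix.vecMul, dotProduct, Fin.sum_univ_two, Matrix.mul_apply,
      hW, companionWave_one, hr, Matrix.cons_val_zero, Matrix.cons_val_one, evalMat_apply]
    field_simp
    ring
  have hmul : auxMatrix hbar α L Psi x t 0 =
      Matrix.vecMul (fun j => deform hbar α (fun s => companionWave L Psi x s 0 j) t) W⁻¹ := rfl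
  rw [hmul, hrow, Matrix.vecMul_vecMul, Matrix.mul_nonsing_inv _ hdet, Matrix.vecMul_one]

end Companion

end TwistedPainleve

open TwistedPainleve

theorem theorem5p1 (g : ℕ) (hbar : ℂ) (hhbar : hbar ≠ 0)
    (U : Set (TwistedPainleve.Times g)) (hU : IsOpen U)
    (L : TwistedPainleve.Times g → Matrix (Fin 2) (Fin 2) (Polynomial ℂ))
    (Psi : ℂ → TwistedPainleve.Times g → Matrix (Fin 2) (Fin 2) ℂ)
    (q p : TwistedPainleve.Times g → Fin g → ℂ)
    (hL : TwistedPainleve.IsIsomonodromic hbar U L Psi)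
    (hqp : TwistedPainleve.IsDarboux U L q p)
    (t : TwistedPainleve.Times g) (ht : t ∈ U) (α : TwistedPainleve.Times g) :
    -- the coefficients `H`, `ν`, `μ`, `c` are those of the companion Lax pair
    (∀ x : ℂ, x ∉ Set.range (q t) →
      TwistedPainleve.companionLax hbar L Psi x t =
        !![0, 1;
          -(TwistedPainleve.P2 hbar t).eval x
            + ∑ k : Fin g, TwistedPainleve.H hbar t (q t) (p t) k * x ^ (k : ℕ)
            - ∑ j, hbar * p t j / (x - q t j),
          (TwistedPainleve.P1 t).eval x + ∑ j, hbar / (x - q t j)]) ∧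
    (∀ x : ℂ, x ∉ Set.range (q t) →
      TwistedPainleve.auxMatrix hbar α L Psi x t 0 1 =
        TwistedPainleve.nu t α 0 * x + TwistedPainleve.nu t α 1
          + ∑ j, TwistedPainleve.mu t α (q t) j / (x - q t j)) ∧
    (∃ c₀ : ℂ, ∀ x : ℂ, x ∉ Set.range (q t) →
      TwistedPainleve.auxMatrix hbar α L Psi x t 0 0 =
        c₀ + ∑ i : Fin (g + 2), TwistedPainleve.cCoeff t α i * x ^ ((i : ℕ) + 1)
          - ∑ j, TwistedPainleve.mu t α (q t) j * p t j / (x - q t j)) ∧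
    -- the evolutions of the Darboux coordinates
    (∀ j : Fin g,
      DifferentiableAt ℂ (fun s => q s j) t ∧ DifferentiableAt ℂ (fun s => p s j) t ∧
      TwistedPainleve.deform hbar α (fun s => q s j) t =
        TwistedPainleve.qField hbar t α (q t) (p t) j ∧
      TwistedPainleve.deform hbar α (fun s => p s j) t =
        TwistedPainleve.pField hbar t α (q t) (p t) j) ∧
    -- they are Hamiltonian
    (∀ j : Fin g,
      HasDerivAt (fun y => TwistedPainleve.Ham hbar t α (q t) (Function.update (p t) j y))
        (TwistedPainleve.deform hbar α (fun s => q s j) t) (p t j) ∧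
      HasDerivAt (fun y => TwistedPainleve.Ham hbar t α (Function.update (q t) j y) (p t))
        (-TwistedPainleve.deform hbar α (fun s => p s j) t) (q t j)) ∧
    -- and the explicit evolution field is the Hamiltonian field at every point of the phase space
    (∀ x y : Fin g → ℂ, Function.Injective x → ∀ j : Fin g,
      HasDerivAt (fun u => TwistedPainleve.Ham hbar t α x (Function.update y j u))
        (TwistedPainleve.qField hbar t α x y j) (y j) ∧
      HasDerivAt (fun u => TwistedPainleve.Ham hbar t α (Function.update x j u) y)
        (-TwistedPainleve.pField hbar t α x y j) (x j)) := by
  have hnorm := hL.normalized t ht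
  have hq := hqp.injective t ht
  have hb := hqp.upper_right_eq hL ht
  have hp : ∀ j, (L t 0 0).eval (q t j) = p t j := fun j => (hqp.value t ht j).symm
  obtain ⟨A, hA⟩ := hL.exists_deformation ht α
  have hZ := hL.zeroCurvature hU ht α hA
  have hcurve : ∀ᶠ s : ℂ in nhds 0, IsNormalized hbar (t + s • hbar • α) (L (t + s • hbar • α)) :=
    (eventually_curve hU ht (hbar • α)).mono fun s hs => hL.normalized _ hs
  obtain ⟨ξ₁, h₁⟩ := hnorm.exists_isFormalSlope (Or.inl rfl)
  obtain ⟨ξ₂, h₂⟩ := hnorm.exists_isFormalSlope (Or.inr rfl)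
  have hexp : HasDeformedExponents hbar t α (L t) A ξ₁ ξ₂ := by
    refine ⟨h₁, h₂, fun k hk => ?_, fun k hk => ?_⟩
    · exact IsFormalSlope.coeff_deformation (L := fun s : ℂ => L (t + s • hbar • α))
        (L' := Matrix.of fun i j => deformPolynomial hbar α (g + 1) (fun s => L s i j) t)
        hhbar hcurve
        (hL.hasDerivAt_coeff hU ht α) (by simpa only [zero_smul, add_zero] using hZ) (Or.inl rfl)
        (by simpa using h₁) hk
    · exact IsFormalSlope.coeff_deformation (L := fun s : ℂ => L (t + s • hbar • α))
        (L' := Matrix.of fun i j => deformPolynomial hbar α (g + 1) (fun s => L s i j) t)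
        hhbar hcurve
        (hL.hasDerivAt_coeff hU ht α) (by simpa only [zero_smul, add_zero] using hZ) (Or.inr rfl)
        (by simpa using h₂) hk
  have hA₁ := hexp.upper_right hnorm.twisted hq hb
  obtain ⟨c₀, hA₀⟩ := hexp.upper_left hnorm.twisted hq hb hp
  have hb0 : ∀ x, x ∉ Set.range (q t) → (L t 0 1).eval x ≠ 0 := fun x hx => by
    rw [hb]
    exact eval_prod_ne_zero hx
  have hquot : ∀ x, x ∉ Set.range (q t) → (A 0 1).eval x / (L t 0 1).eval x =
      nu t α 0 * x + nu t α 1 + ∑ j, mu t α (q t) j / (x - q t j) := by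
    intro x hx
    rw [div_eq_iff (hb0 x hx), hA₁, hb, Polynomial.eval_add, Polynomial.eval_mul, add_mul,
      Finset.sum_mul, Polynomial.eval_finsetSum]
    congr 1
    · simp
    · refine Finset.sum_congr rfl fun j _ => ?_
      rw [Polynomial.eval_mul, Polynomial.eval_C, eval_omitFactor hx]
      ring
  have hevol : ∀ j, deform hbar α (fun s => q s j) t = qField hbar t α (q t) (p t) j ∧
      deform hbar α (fun s => p s j) t = pField hbar t α (q t) (p t) j := by
    intro j
    obtain ⟨h1, h2⟩ := hqp.deform_eq hL hU ht α j
    exact evolution_eq hq hb hp hnorm.trace hZ (hnorm.sum_H hq hb hp) hA₁ hA₀ h1 h2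
  refine ⟨fun x hx => hL.companionLax_eq ht hb hp hq hx, fun x hx => ?_, ⟨c₀, fun x hx => ?_⟩,
    fun j => ⟨hqp.differentiableAt_zero hL hU ht j, hqp.differentiableAt_value hL hU ht j, hevol j⟩,
    fun j => ?_, fun x y hx j => ⟨hasDerivAt_Ham_right hx j, hasDerivAt_Ham_left hx j⟩⟩
  · rw [hL.auxMatrix_zero ht hA (hb0 x hx), ← hquot x hx]
    rfl
  · rw [hL.auxMatrix_zero ht hA (hb0 x hx), hquot x hx]
    have hdiv : ∑ j, mu t α (q t) j * (divDiff (L t 0 0) (q t j)).eval x =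
        (L t 0 0).eval x * ∑ j, mu t α (q t) j / (x - q t j) -
          ∑ j, mu t α (q t) j * p t j / (x - q t j) := by
      rw [Finset.mul_sum, ← Finset.sum_sub_distrib]
      refine Finset.sum_congr rfl fun j _ => ?_
      rw [eval_divDiff_of_ne _ fun h0 => hx ⟨j, h0.symm⟩, hp]
      ring
    have hA₀x := congrArg (Polynomial.eval x) hA₀
    simp only [Polynomial.eval_add, Polynomial.eval_mul, Polynomial.eval_C, Polynomial.eval_X,
      Polynomial.eval_finsetSum, Polynomial.eval_pow, hdiv] at hA₀x
    rw [Matrix.cons_val_zero, hA₀x]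
    ring
  · rw [(hevol j).1, (hevol j).2]
    exact ⟨hasDerivAt_Ham_right hq j, hasDerivAt_Ham_left hq j⟩
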